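/- Let $N\ge 1$, let $\mathbb{B}_N$ be the open unit ball of $\mathbb{C}^N$ and $S_N$ the unit sphere. Let $H^2(\mathbb{B}_N)$ be the Hardy space of holomorphic functions $f$ on $\mathbb{B}_N$ with $$\|f\|^2=\sup_{0<r<1}\int_{S_N}|f(r\zeta)|^2\,d\sigma(\zeta)<\infty ,$$ where $\sigma$ is normalized surface measure, and for $\alpha>-1$ let $A^2_\alpha(\mathbb{B}_N)$ be the weighted Bergman space of holomorphic functions $f$ on $\mathbb{B}_N$ with $$\|f\|^2=\int_{\mathbb{B}_N}|f(z)|^2c_\alpha(1-|z|^2)^\alpha\,dv(z)<\infty ,$$ where $v$ is Lebesgue measure and $c_\alpha$ makes $c_\alpha(1-|z|^2)^\alpha dv$ a probability measure. Both are Hilbert spaces. For $\gamma\ge 1$ put $\mathcal{H}_\gamma=H^2(\mathbb{B}_N)$ if $\gamma=1$ and $\mathcal{H}_\gamma=A^2_{\gamma-2}(\mathbb{B}_N)$ if $\gamma>1$. Let $\varphi$ be a (biholomorphic) automorphism of $\mathbb{B}_N$ that has no fixed point in $\mathbb{B}_N$ and whose continuous extension to $\overline{\mathbb{B}_N}$ fixes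 two distinct points $a\neq b$ of $S_N$, where $a$ is the Denjoy–Wolff point of $\varphi$, that is, the iterates of $\varphi$ converge to $a$ uniformly on compact subsets of $\mathbb{B}_N$. Let $\psi$ be continuous on $\overline{\mathbb{B}_N}$ and holomorphic on $\mathbb{B}_N$, with $\inf_{z\in\mathbb{B}_N}|\psi(z)|>0$. Then $\varphi$ extends holomorphically to a neighbourhood of $\overline{\mathbb{B}_N}$, the derivative $\varphi'(a)$ is invertible, and the spectral radius $\rho$ of $\varphi'(a)^{-1}$ is also the spectral radius of $\varphi'(b)$. For every $\gamma\ge 1$, with $K=(N-1+\gamma)/2$, the weighted composition operator $C_{\psi,\varphi}f=\psi\cdot(f\circ\varphi)$ is bounded on $\mathcal{H}_\gamma$ and its spectrum is $$\left\{\lambda\in\mathbb{C}:\ \min\{|\psi(a)|\rho^{K},|\psi(b)|\rho^{-K}\}\le|\lambda|\le\max\{|\psi(a)|\rho^{K},|\psi(b)|\rho^{-K}\}\right\}.$$ Moreover, every interior point of this set is an eigenvalue of $C_{\psi,\varphi}$ or of its adjoint $C_{\psi,\varphi}^*$. -/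

import Mathlib

open MeasureTheory Metric Set Filter Topology
open scoped ENNReal Pointwise

namespace WCO

/-- `ℂ^N` with its Euclidean norm. -/
abbrev CN (N : ℕ) : Type := EuclideanSpace ℂ (Fin N)

/-- The normalized surface measure on the unit sphere of `ℂ^N`. -/
noncomputable def surfaceMeasure (N : ℕ) : Measure (sphere (0 : CN N) 1) :=
  ((volume : Measure (CN N)).toSphere univ)⁻¹ • (volume : Measure (CN N)).toSphere

/-- `∫_{S_N} |f(rζ)|² dσ(ζ)`. -/
noncomputable def hardyMean {N : ℕ} (f : CN N → ℂ) (r : ℝ) : ℝ :=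
  ∫ ζ, ‖f (r • (ζ : CN N))‖ ^ 2 ∂(surfaceMeasure N)

/-- `∫_{S_N} ⟨f(rζ), g(rζ)⟩ dσ(ζ)`, conjugate-linear in `f`. -/
noncomputable def hardyPairing {N : ℕ} (f g : CN N → ℂ) (r : ℝ) : ℂ :=
  ∫ ζ, inner ℂ (f (r • (ζ : CN N))) (g (r • (ζ : CN N))) ∂(surfaceMeasure N)

section Sphere

variable {N : ℕ}

/-- Multiplication by a unimodular scalar, as a real linear isometry of `ℂ^N`. -/
noncomputable def rot (N : ℕ) (u : Circle) : CN N ≃ₗᵢ[ℝ] CN N where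
  toFun z := (u : ℂ) • z
  invFun z := ((u⁻¹ : Circle) : ℂ) • z
  map_add' x y := smul_add _ _ _
  map_smul' r x := smul_comm _ _ _
  left_inv z := by simp [smul_smul]
  right_inv z := by simp [smul_smul]
  norm_map' z := by
    change ‖(u : ℂ) • z‖ = ‖z‖
    rw [norm_smul, Circle.norm_coe, one_mul]

/-- The induced homeomorphism of the unit sphere. -/
noncomputable def rotSphere (N : ℕ) (u : Circle) : sphere (0 : CN N) 1 ≃ₜ sphere (0 : CN N) 1 where
  toFun ζ := ⟨rot N u ζ, by simp⟩
  invFun ζ := ⟨(rot N u).symm ζ, by simp⟩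
  left_inv ζ := by simp
  right_inv ζ := by simp
  continuous_toFun := by fun_prop
  continuous_invFun := by fun_prop

theorem measurePreserving_rotSphere (u : Circle) :
    MeasurePreserving (rotSphere N u) (surfaceMeasure N) (surfaceMeasure N) := by
  refine ⟨(rotSphere N u).continuous.measurable, ?_⟩
  rw [surfaceMeasure, Measure.map_smul]
  congr 1
  ext s hs
  rw [Measure.map_apply (rotSphere N u).continuous.measurable hs,
    Measure.toSphere_apply' _ hs,
    Measure.toSphere_apply' _ ((rotSphere N u).continuous.measurable hs)]
  congr 1
  have key : (Ioo (0 : ℝ) 1 • (Subtype.val '' (rotSphere N u ⁻¹' s)) : Set (CN N)) =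
      (rot N u) ⁻¹' (Ioo (0 : ℝ) 1 • (Subtype.val '' s)) := by
    ext z
    simp only [Set.mem_smul, mem_image, mem_preimage]
    constructor
    · rintro ⟨r, hr, _, ⟨ζ, hζ, rfl⟩, rfl⟩
      exact ⟨r, hr, _, ⟨_, hζ, rfl⟩, by simp [rotSphere]⟩
    · rintro ⟨r, hr, _, ⟨ζ, hζ, rfl⟩, h⟩
      refine ⟨r, hr, _, ⟨(rotSphere N u).symm ζ, by simpa using hζ, rfl⟩, ?_⟩
      apply (rot N u).injective
      rw [← h]
      simp [rotSphere]
  rw [key]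
  exact ((rot N u).measurePreserving).measure_preimage_equiv
    (f := (rot N u).toHomeomorph.toMeasurableEquiv) _

theorem integral_rot (u : Circle) (F : CN N → ℝ) :
    ∫ ζ, F ((u : ℂ) • (ζ : CN N)) ∂(surfaceMeasure N) = ∫ ζ, F (ζ : CN N) ∂(surfaceMeasure N) :=
  (measurePreserving_rotSphere u).integral_comp (rotSphere N u).measurableEmbedding
    (fun ζ : sphere (0 : CN N) 1 => F (ζ : CN N))

theorem smul_mem_ball {w : ℂ} (hw : ‖w‖ < 1) (ζ : sphere (0 : CN N) 1) :
    w • (ζ : CN N) ∈ ball (0 : CN N) 1 := by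
  simp [norm_smul, hw]

theorem rsmul_mem_ball {r : ℝ} (hr : r ∈ Ioo (0 : ℝ) 1) (ζ : sphere (0 : CN N) 1) :
    r • (ζ : CN N) ∈ ball (0 : CN N) 1 := by
  simp [norm_smul, abs_of_pos hr.1, hr.2]

theorem continuous_dilate {f : CN N → ℂ} (hf : ContinuousOn f (ball 0 1)) {r : ℝ}
    (hr : r ∈ Ioo (0 : ℝ) 1) : Continuous fun ζ : sphere (0 : CN N) 1 => f (r • (ζ : CN N)) :=
  hf.comp_continuous (by fun_prop) fun ζ => rsmul_mem_ball hr ζ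

theorem hardyMean_nonneg (f : CN N → ℂ) (r : ℝ) : 0 ≤ hardyMean f r :=
  integral_nonneg fun _ => by positivity

theorem hardyMean_smul (c : ℂ) (f : CN N → ℂ) (r : ℝ) :
    hardyMean (c • f) r = ‖c‖ ^ 2 * hardyMean f r := by
  rw [hardyMean, hardyMean, ← integral_const_mul]
  simp [mul_pow]

variable [NeZero N]

instance : Nontrivial (CN N) := by
  have : Nonempty (Fin N) := ⟨⟨0, Nat.pos_of_ne_zero (NeZero.ne N)⟩⟩
  exact inferInstanceAs (Nontrivial (EuclideanSpace ℂ (Fin N)))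

theorem toSphere_univ_ne_zero : (volume : Measure (CN N)).toSphere univ ≠ 0 := by
  rw [Ne, Measure.measure_univ_eq_zero]
  exact Measure.toSphere_ne_zero _

instance : IsProbabilityMeasure (surfaceMeasure N) := by
  constructor
  rw [surfaceMeasure, Measure.smul_apply, smul_eq_mul]
  exact ENNReal.inv_mul_cancel toSphere_univ_ne_zero (measure_ne_top _ _)

instance : (surfaceMeasure N).IsOpenPosMeasure := by
  constructor
  intro U hU hne
  rw [surfaceMeasure, Measure.smul_apply, smul_eq_mul]
  exact mul_ne_zero (ENNReal.inv_ne_zero.2 (measure_ne_top _ _)) (hU.measure_ne_zero _ hne)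

theorem integrable_of_continuous {F : Type*} [NormedAddCommGroup F]
    {h : sphere (0 : CN N) 1 → F} (hh : Continuous h) : Integrable h (surfaceMeasure N) :=
  hh.integrable_of_hasCompactSupport (HasCompactSupport.of_compactSpace _)

/-- Mean values over spheres of `|f|²` increase with the radius, for `f` holomorphic. -/
theorem hardyMean_mono {f : CN N → ℂ} (hf : DifferentiableOn ℂ f (ball 0 1)) :
    MonotoneOn (hardyMean f) (Ioo 0 1) := by
  intro r hr R hR hrR
  rcases hrR.eq_or_lt with rfl | hlt
  · exact le_rfl
  have hc := hf.continuousOn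
  have hrb : (r : ℂ) ∈ ball (0 : ℂ) R := by simpa [abs_of_pos hr.1] using hlt
  set P : ℝ → ℝ := fun θ => poissonKernel 0 (r : ℂ) (circleMap 0 R θ) with hP
  have hPpos : ∀ θ, 0 ≤ P θ := by
    intro θ
    simp only [hP, poissonKernel_def]
    apply div_nonneg _ (sq_nonneg _)
    simp only [sub_zero, norm_circleMap_zero, Complex.norm_real, Real.norm_eq_abs, sq_abs]
    nlinarith [hr.1]
  have hPc : Continuous P := by
    simp only [hP, poissonKernel_def]
    refine Continuous.div (by fun_prop) (by fun_prop) ?_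
    intro θ h0
    have h1 : circleMap 0 R θ = r := by
      simpa [sub_eq_zero] using h0
    have h2 := congrArg norm h1
    simp [abs_of_pos hr.1, abs_of_pos hR.1] at h2
    exact hlt.ne' h2
  have hP1 : (2 * Real.pi)⁻¹ * ∫ θ in (0 : ℝ)..2 * Real.pi, P θ = 1 := by
    have := DiffContOnCl.circleAverage_poissonKernel_smul (f := fun _ : ℂ => (1 : ℂ)) (c := 0)
      (R := R) (w := (r : ℂ)) (by exact diffContOnCl_const) hrb
    simp only [Real.circleAverage_def, Pi.smul_apply'] at this
    have h2 := congrArg Complex.re this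
    simp only [Complex.real_smul, mul_one] at h2
    rw [intervalIntegral.integral_ofReal] at h2
    exact_mod_cast h2
  have hsl : ∀ ζ : sphere (0 : CN N) 1, ‖f (r • (ζ : CN N))‖ ^ 2 ≤
      (2 * Real.pi)⁻¹ * ∫ θ in (0 : ℝ)..2 * Real.pi,
        P θ * ‖f ((circleMap 0 R θ) • (ζ : CN N))‖ ^ 2 := by
    intro ζ
    have hd : DifferentiableOn ℂ (fun w : ℂ => f (w • (ζ : CN N))) (ball 0 1) :=
      hf.comp (by fun_prop) fun w hw => smul_mem_ball (by simpa using hw) ζ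
    have hdc : DiffContOnCl ℂ (fun w : ℂ => f (w • (ζ : CN N))) (ball 0 R) :=
      (hd.mono (closure_ball_subset_closedBall.trans
        (closedBall_subset_ball hR.2))).diffContOnCl
    have hpo := DiffContOnCl.circleAverage_poissonKernel_smul hdc hrb
    simp only [Real.circleAverage_def, Pi.smul_apply'] at hpo
    have hcf : Continuous fun θ : ℝ => f ((circleMap 0 R θ) • (ζ : CN N)) :=
      hc.comp_continuous (by fun_prop) fun θ =>
        smul_mem_ball (by simp [abs_of_pos hR.1, hR.2]) ζ
    set c : ℂ := f ((r : ℂ) • (ζ : CN N)) with hcdef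
    have hrc : f (r • (ζ : CN N)) = c := by
      rw [hcdef, Complex.coe_smul]
    rw [hrc]
    have e1 : ‖c‖ ^ 2 = (2 * Real.pi)⁻¹ * ∫ θ in (0 : ℝ)..2 * Real.pi,
        P θ * (inner ℝ c (f ((circleMap 0 R θ) • (ζ : CN N)))) := by
      have h3 := (innerSL ℝ c).intervalIntegral_comp_comm (μ := volume)
        ((hPc.smul hcf).intervalIntegrable 0 (2 * Real.pi))
      have h4 : inner ℝ c c = ‖c‖ ^ 2 := real_inner_self_eq_norm_sq c
      simp only [innerSL_apply_apply, Pi.smul_apply', real_inner_smul_right] at h3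
      rw [← h4, h3, ← real_inner_smul_right]
      exact congrArg (inner ℝ c) hpo.symm
    have hs1 : Continuous fun θ => P θ * (‖c‖ ^ 2 / 2) := hPc.mul_const _
    have hs2 : Continuous fun θ => P θ * ‖f ((circleMap 0 R θ) • (ζ : CN N))‖ ^ 2 * 2⁻¹ :=
      (hPc.mul (hcf.norm.pow 2)).mul_const _
    have hsum := hs1.add hs2
    have e2 : ∫ θ in (0 : ℝ)..2 * Real.pi,
        P θ * (inner ℝ c (f ((circleMap 0 R θ) • (ζ : CN N)))) ≤
        ∫ θ in (0 : ℝ)..2 * Real.pi,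
          (P θ * (‖c‖ ^ 2 / 2) + P θ * ‖f ((circleMap 0 R θ) • (ζ : CN N))‖ ^ 2 * 2⁻¹) := by
      apply intervalIntegral.integral_mono_on (by positivity)
      · exact (hPc.mul (continuous_const.inner hcf)).intervalIntegrable _ _
      · exact hsum.intervalIntegrable _ _
      · intro θ _
        have h5 := real_inner_le_norm c (f ((circleMap 0 R θ) • (ζ : CN N)))
        have h6 := two_mul_le_add_sq ‖c‖ ‖f ((circleMap 0 R θ) • (ζ : CN N))‖
        have h7 : inner ℝ c (f ((circleMap 0 R θ) • (ζ : CN N))) ≤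
          ‖c‖ ^ 2 / 2 + ‖f ((circleMap 0 R θ) • (ζ : CN N))‖ ^ 2 * 2⁻¹ := by linarith
        nlinarith [mul_le_mul_of_nonneg_left h7 (hPpos θ)]
    rw [intervalIntegral.integral_add
        (hs1.intervalIntegrable _ _) (hs2.intervalIntegrable _ _),
      intervalIntegral.integral_mul_const, intervalIntegral.integral_mul_const] at e2
    have e3 := mul_le_mul_of_nonneg_left e2 (show 0 ≤ (2 * Real.pi)⁻¹ by positivity)
    rw [← e1, mul_add, ← mul_assoc, hP1, ← mul_assoc] at e3
    linarith
  have hcirc : ∀ θ : ℝ, ∫ ζ, ‖f ((circleMap 0 R θ) • (ζ : CN N))‖ ^ 2 ∂(surfaceMeasure N) =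
      hardyMean f R := by
    intro θ
    rw [hardyMean, ← integral_rot (Circle.exp θ) (fun z => ‖f (R • z)‖ ^ 2)]
    refine integral_congr_ae (Eventually.of_forall fun ζ => ?_)
    change ‖f (circleMap 0 R θ • (ζ : CN N))‖ ^ 2 = ‖f (R • ((Circle.exp θ : ℂ) • (ζ : CN N)))‖ ^ 2
    rw [← Complex.coe_smul, smul_smul, Circle.coe_exp, circleMap_zero]
  have hG : Continuous fun p : sphere (0 : CN N) 1 × ℝ =>
      P p.2 * ‖f ((circleMap 0 R p.2) • (p.1 : CN N))‖ ^ 2 := by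
    refine (hPc.comp continuous_snd).mul ((Continuous.norm ?_).pow 2)
    refine hc.comp_continuous ?_ fun p => smul_mem_ball (by simp [abs_of_pos hR.1, hR.2]) p.1
    fun_prop
  have hGi : Integrable (Function.uncurry fun (ζ : sphere (0 : CN N) 1) (θ : ℝ) =>
      P θ * ‖f ((circleMap 0 R θ) • (ζ : CN N))‖ ^ 2)
      ((surfaceMeasure N).prod (volume.restrict (Ioc 0 (2 * Real.pi)))) := by
    have h1 : IntegrableOn (fun p : sphere (0 : CN N) 1 × ℝ =>
        P p.2 * ‖f ((circleMap 0 R p.2) • (p.1 : CN N))‖ ^ 2)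
        (univ ×ˢ Icc 0 (2 * Real.pi)) ((surfaceMeasure N).prod volume) :=
      hG.continuousOn.integrableOn_compact (isCompact_univ.prod isCompact_Icc)
    have h2 := h1.mono_set (prod_mono_right (s := univ) (Ioc_subset_Icc_self))
    rw [IntegrableOn, ← Measure.prod_restrict, Measure.restrict_univ] at h2
    exact h2
  have hpi : (0 : ℝ) ≤ 2 * Real.pi := by positivity
  calc hardyMean f r
      ≤ ∫ ζ : sphere (0 : CN N) 1, ((2 * Real.pi)⁻¹ * ∫ θ in Ioc 0 (2 * Real.pi),
        P θ * ‖f ((circleMap 0 R θ) • (ζ : CN N))‖ ^ 2) ∂(surfaceMeasure N) := by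
        refine integral_mono (integrable_of_continuous ((continuous_dilate hc hr).norm.pow 2))
          (hGi.integral_prod_left.const_mul _) fun ζ => ?_
        have := hsl ζ
        rwa [intervalIntegral.integral_of_le hpi] at this
    _ = (2 * Real.pi)⁻¹ * ∫ θ in Ioc 0 (2 * Real.pi), P θ * hardyMean f R := by
        rw [integral_const_mul, integral_integral_swap hGi]
        simp_rw [integral_const_mul, hcirc]
    _ = hardyMean f R := by
        rw [integral_mul_const, ← intervalIntegral.integral_of_le hpi, ← mul_assoc, hP1, one_mul]

end Sphere

section Hardy

variable {N : ℕ} [NeZero N]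

theorem hardyMean_add_le {f g : CN N → ℂ} (hf : ContinuousOn f (ball 0 1))
    (hg : ContinuousOn g (ball 0 1)) {r : ℝ} (hr : r ∈ Ioo (0 : ℝ) 1) :
    hardyMean (f + g) r ≤ 2 * hardyMean f r + 2 * hardyMean g r := by
  have hfi : Integrable (fun ζ : sphere (0 : CN N) 1 => ‖f (r • (ζ : CN N))‖ ^ 2)
    (surfaceMeasure N) := integrable_of_continuous ((continuous_dilate hf hr).norm.pow 2)
  have hgi : Integrable (fun ζ : sphere (0 : CN N) 1 => ‖g (r • (ζ : CN N))‖ ^ 2)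
    (surfaceMeasure N) := integrable_of_continuous ((continuous_dilate hg hr).norm.pow 2)
  rw [hardyMean, hardyMean, hardyMean, ← integral_const_mul, ← integral_const_mul,
    ← integral_add (hfi.const_mul 2) (hgi.const_mul 2)]
  refine integral_mono (integrable_of_continuous
    ((continuous_dilate (hf.add hg) hr).norm.pow 2))
    ((hfi.const_mul 2).add (hgi.const_mul 2)) fun ζ => ?_
  have h1 := norm_add_le (f (r • (ζ : CN N))) (g (r • (ζ : CN N)))
  have h2 : ‖f (r • (ζ : CN N)) + g (r • (ζ : CN N))‖ ^ 2 ≤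
      (‖f (r • (ζ : CN N))‖ + ‖g (r • (ζ : CN N))‖) ^ 2 := by gcongr
  change ‖f (r • (ζ : CN N)) + g (r • (ζ : CN N))‖ ^ 2 ≤
    2 * ‖f (r • (ζ : CN N))‖ ^ 2 + 2 * ‖g (r • (ζ : CN N))‖ ^ 2
  nlinarith [sq_nonneg (‖f (r • (ζ : CN N))‖ - ‖g (r • (ζ : CN N))‖)]

/-- The holomorphic functions `f` on the unit ball with `sup_{0<r<1} ∫ |f(rζ)|² dσ(ζ) < ∞`.
A function on the ball is represented by its extension by zero to `ℂ^N`. -/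
def hardySubmodule (N : ℕ) [NeZero N] : Submodule ℂ (CN N → ℂ) where
  carrier := {f | DifferentiableOn ℂ f (ball 0 1) ∧ (∀ z ∉ ball (0 : CN N) 1, f z = 0) ∧
    BddAbove (hardyMean f '' Ioo 0 1)}
  zero_mem' := by
    refine ⟨differentiableOn_const 0, fun _ _ => rfl, 0, ?_⟩
    rintro _ ⟨r, _, rfl⟩
    simp [hardyMean]
  add_mem' := by
    rintro f g ⟨hf, hf0, A, hA⟩ ⟨hg, hg0, B, hB⟩
    refine ⟨hf.add hg, fun z hz => by simp [hf0 z hz, hg0 z hz], 2 * A + 2 * B, ?_⟩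
    rintro _ ⟨r, hr, rfl⟩
    have h1 := hA (mem_image_of_mem _ hr)
    have h2 := hB (mem_image_of_mem _ hr)
    have h3 := hardyMean_add_le hf.continuousOn hg.continuousOn hr
    linarith
  smul_mem' := by
    rintro c f ⟨hf, hf0, A, hA⟩
    refine ⟨hf.const_smul c, fun z hz => by simp [hf0 z hz], ‖c‖ ^ 2 * A, ?_⟩
    rintro _ ⟨r, hr, rfl⟩
    rw [hardyMean_smul]
    exact mul_le_mul_of_nonneg_left (hA (mem_image_of_mem _ hr)) (by positivity)

/-- The Hardy space `H²` of the unit ball of `ℂ^N`. -/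
def HardySpace (N : ℕ) [NeZero N] : Type := hardySubmodule N

namespace HardySpace

instance : AddCommGroup (HardySpace N) := inferInstanceAs (AddCommGroup (hardySubmodule N))

instance : Module ℂ (HardySpace N) := inferInstanceAs (Module ℂ (hardySubmodule N))

/-- The underlying function. -/
def toFun (f : HardySpace N) : CN N → ℂ := Subtype.val (p := (· ∈ hardySubmodule N)) f

instance : CoeFun (HardySpace N) fun _ => CN N → ℂ := ⟨toFun⟩

theorem mem (f : HardySpace N) : f.toFun ∈ hardySubmodule N :=
  Subtype.property (p := (· ∈ hardySubmodule N)) f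

theorem ext {f g : HardySpace N} (h : ∀ z, f z = g z) : f = g :=
  Subtype.ext (p := (· ∈ hardySubmodule N)) (funext h)

@[simp] theorem add_apply (f g : HardySpace N) (z : CN N) : (f + g) z = f z + g z := rfl

@[simp] theorem sub_apply (f g : HardySpace N) (z : CN N) : (f - g) z = f z - g z := rfl

@[simp] theorem smul_apply (c : ℂ) (f : HardySpace N) (z : CN N) : (c • f) z = c * f z := rfl

@[simp] theorem zero_apply (z : CN N) : (0 : HardySpace N) z = 0 := rfl

theorem differentiableOn (f : HardySpace N) : DifferentiableOn ℂ f (ball 0 1) := f.mem.1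

theorem tendsto_mean (f : HardySpace N) :
    Tendsto (hardyMean f) (𝓝[<] 1) (𝓝 (sSup (hardyMean f '' Ioo 0 1))) := by
  have hne : (Ioo (0 : ℝ) 1).Nonempty := ⟨1 / 2, by norm_num, by norm_num⟩
  exact (hardyMean_mono f.mem.1).tendsto_nhdsWithin_Ioo_left hne f.mem.2.2

theorem integrable_pairing (f g : HardySpace N) {r : ℝ} (hr : r ∈ Ioo (0 : ℝ) 1) :
    Integrable (fun ζ : sphere (0 : CN N) 1 => inner ℂ (f (r • (ζ : CN N))) (g (r • (ζ : CN N))))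
      (surfaceMeasure N) :=
  integrable_of_continuous ((continuous_dilate f.mem.1.continuousOn hr).inner
    (continuous_dilate g.mem.1.continuousOn hr))

theorem pairing_self (f : HardySpace N) (r : ℝ) : hardyPairing f f r = (hardyMean f r : ℂ) := by
  rw [hardyPairing, hardyMean, ← integral_complex_ofReal]
  simp [inner_self_eq_norm_sq_to_K]

theorem eventually_Ioo : ∀ᶠ r : ℝ in 𝓝[<] 1, r ∈ Ioo (0 : ℝ) 1 :=
  Ioo_mem_nhdsLT (by norm_num)

theorem exists_tendsto_pairing (f g : HardySpace N) :
    ∃ L, Tendsto (hardyPairing f g) (𝓝[<] 1) (𝓝 L) := by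
  have hM : ∀ h : HardySpace N, Tendsto (fun r => (hardyMean h r : ℂ)) (𝓝[<] 1)
      (𝓝 ((sSup (hardyMean h '' Ioo 0 1) : ℝ) : ℂ)) := fun h =>
    (Complex.continuous_ofReal.tendsto _).comp (tendsto_mean h)
  refine ⟨_, Tendsto.congr' ?_ ((((hM (f + g)).sub (hM (f - g))).add
    (((hM (f - Complex.I • g)).sub (hM (f + Complex.I • g))).mul_const Complex.I)).div_const 4)⟩
  filter_upwards [eventually_Ioo] with r hr
  have hi : ∀ h : HardySpace N, Integrable (fun ζ : sphere (0 : CN N) 1 =>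
      ((‖h (r • (ζ : CN N))‖ ^ 2 : ℝ) : ℂ)) (surfaceMeasure N) := fun h =>
    integrable_of_continuous (Complex.continuous_ofReal.comp
      ((continuous_dilate h.mem.1.continuousOn hr).norm.pow 2))
  have hi2 : ∀ h k : HardySpace N, Integrable (fun ζ : sphere (0 : CN N) 1 =>
      ((‖h (r • (ζ : CN N))‖ ^ 2 : ℝ) : ℂ) - ((‖k (r • (ζ : CN N))‖ ^ 2 : ℝ) : ℂ))
      (surfaceMeasure N) := fun h k => (hi h).sub (hi k)
  simp only [hardyMean, hardyPairing, ← integral_complex_ofReal]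
  rw [← integral_sub (hi _) (hi _), ← integral_sub (hi _) (hi _), ← integral_mul_const,
    ← integral_add (hi2 _ _) ((hi2 _ _).mul_const _), ← integral_div]
  refine integral_congr_ae (Eventually.of_forall fun ζ => ?_)
  simp only
  rw [inner_eq_sum_norm_sq_div_four]
  simp

/-- The inner product of `H²`: `lim_{r → 1⁻} ∫ ⟨f(rζ), g(rζ)⟩ dσ(ζ)`, conjugate-linear in `f`. -/
noncomputable def pair (f g : HardySpace N) : ℂ := limUnder (𝓝[<] (1 : ℝ)) (hardyPairing f g)

theorem tendsto_pairing (f g : HardySpace N) :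
    Tendsto (hardyPairing f g) (𝓝[<] 1) (𝓝 (pair f g)) :=
  tendsto_nhds_limUnder (exists_tendsto_pairing f g)

theorem pair_self_eq (f : HardySpace N) :
    pair f f = ((sSup (hardyMean f '' Ioo 0 1) : ℝ) : ℂ) := by
  refine tendsto_nhds_unique (tendsto_pairing f f) ?_
  refine ((Complex.continuous_ofReal.tendsto _).comp (tendsto_mean f)).congr fun r => ?_
  exact (pairing_self f r).symm

theorem mean_le_sSup (f : HardySpace N) {r : ℝ} (hr : r ∈ Ioo (0 : ℝ) 1) :
    hardyMean f r ≤ sSup (hardyMean f '' Ioo 0 1) :=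
  le_csSup f.mem.2.2 (mem_image_of_mem _ hr)

theorem eq_zero_of_mean (f : HardySpace N) (h : sSup (hardyMean f '' Ioo 0 1) = 0) : f = 0 := by
  have hr : ∀ r ∈ Ioo (0 : ℝ) 1, ∀ ζ : sphere (0 : CN N) 1, f (r • (ζ : CN N)) = 0 := by
    intro r hr
    have hc := continuous_dilate f.mem.1.continuousOn hr
    have h0 : hardyMean f r = 0 :=
      le_antisymm (h ▸ mean_le_sSup f hr) (hardyMean_nonneg _ _)
    have hc2 : Continuous fun ζ : sphere (0 : CN N) 1 => ‖f (r • (ζ : CN N))‖ ^ 2 :=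
      hc.norm.pow 2
    rw [hardyMean, integral_eq_zero_iff_of_nonneg (fun _ => sq_nonneg _)
      (integrable_of_continuous hc2)] at h0
    have h1 := (Continuous.ae_eq_iff_eq (surfaceMeasure N) hc2 continuous_zero).1 h0
    intro ζ
    simpa using congrFun h1 ζ
  have hne : ∀ z ∈ ball (0 : CN N) 1, z ≠ 0 → f z = 0 := by
    intro z hz hz0
    have hpos : 0 < ‖z‖ := norm_pos_iff.2 hz0
    have := hr ‖z‖ ⟨hpos, by simpa using hz⟩ ⟨‖z‖⁻¹ • z, by simp [norm_smul, hpos.ne']⟩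
    simpa [smul_smul, hpos.ne'] using this
  have h00 : f 0 = 0 := by
    have hcont : Tendsto f (𝓝[≠] (0 : CN N)) (𝓝 (f 0)) :=
      ((f.mem.1.continuousOn.continuousAt (ball_mem_nhds 0 one_pos)).tendsto).mono_left
        nhdsWithin_le_nhds
    refine tendsto_nhds_unique hcont (Tendsto.congr' ?_ tendsto_const_nhds)
    filter_upwards [self_mem_nhdsWithin, nhdsWithin_le_nhds (ball_mem_nhds (0 : CN N) one_pos)]
      with z hz hzb using (hne z hzb hz).symm
  refine ext fun z => ?_
  by_cases hz : z ∈ ball (0 : CN N) 1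
  · by_cases hz0 : z = 0
    · rw [hz0]; exact h00
    · exact hne z hz hz0
  · exact f.mem.2.1 z hz

/-- The inner product axioms for `pair`. -/
@[reducible] noncomputable def innerCore : InnerProductSpace.Core ℂ (HardySpace N) where
  inner := pair
  conj_inner_symm f g := by
    refine tendsto_nhds_unique ((Complex.continuous_conj.tendsto _).comp (tendsto_pairing g f))
      ((tendsto_pairing f g).congr fun r => ?_)
    simp only [Function.comp_apply, hardyPairing, ← integral_conj, inner_conj_symm]
  re_inner_nonneg f := by
    rw [pair_self_eq]
    simpa using (hardyMean_nonneg _ _).trans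
      (mean_le_sSup f (r := 1 / 2) ⟨by norm_num, by norm_num⟩)
  add_left f g h := by
    refine tendsto_nhds_unique (tendsto_pairing (f + g) h)
      (Tendsto.congr' ?_ ((tendsto_pairing f h).add (tendsto_pairing g h)))
    filter_upwards [eventually_Ioo] with r hr
    simp only [hardyPairing, add_apply, inner_add_left]
    rw [integral_add (integrable_pairing f h hr) (integrable_pairing g h hr)]
  smul_left f g c := by
    refine tendsto_nhds_unique (tendsto_pairing (c • f) g)
      (Tendsto.congr ?_ ((tendsto_pairing f g).const_mul _))
    intro r
    simp only [hardyPairing, smul_apply, ← smul_eq_mul (a := c), inner_smul_left]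
    rw [integral_const_mul]
  definite f h := by
    rw [pair_self_eq] at h
    exact eq_zero_of_mean f (by exact_mod_cast h)

noncomputable instance : NormedAddCommGroup (HardySpace N) :=
  (innerCore (N := N)).toNormedAddCommGroup

noncomputable instance : InnerProductSpace ℂ (HardySpace N) :=
  InnerProductSpace.ofCore (innerCore (N := N)).toCore

/-- The norm of `H²` is `‖f‖² = sup_{0<r<1} ∫ |f(rζ)|² dσ(ζ)`. -/
theorem norm_sq_eq (f : HardySpace N) : ‖f‖ ^ 2 = sSup (hardyMean f '' Ioo 0 1) := by
  have h : inner ℂ f f = _ := pair_self_eq f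
  have h2 : (inner ℂ f f : ℂ) = ((‖f‖ ^ 2 : ℝ) : ℂ) := by
    rw [inner_self_eq_norm_sq_to_K]; simp
  rw [h2] at h
  exact_mod_cast h

end HardySpace

end Hardy

section Bergman

/-- The measure `(1 - |z|²)^α dv(z)` on the unit ball. -/
noncomputable def ballWeight (N : ℕ) (α : ℝ) : Measure (CN N) :=
  (volume.restrict (ball 0 1)).withDensity fun z => ENNReal.ofReal ((1 - ‖z‖ ^ 2) ^ α)

/-- The normalized measure `dv_α(z) = c_α (1 - |z|²)^α dv(z)` on the unit ball. -/
noncomputable def bergmanMeasure (N : ℕ) (α : ℝ) : Measure (CN N) :=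
  (ballWeight N α univ)⁻¹ • ballWeight N α

variable {N : ℕ}

theorem measurable_weight (α : ℝ) :
    Measurable fun z : CN N => ENNReal.ofReal ((1 - ‖z‖ ^ 2) ^ α) := by
  fun_prop

theorem bergmanMeasure_absolutelyContinuous (α : ℝ) :
    bergmanMeasure N α ≪ volume.restrict (ball (0 : CN N) 1) :=
  (Measure.smul_absolutelyContinuous).trans (withDensity_absolutelyContinuous _ _)

theorem aestronglyMeasurable_bergman {f : CN N → ℂ} (hf : DifferentiableOn ℂ f (ball 0 1))
    (α : ℝ) : AEStronglyMeasurable f (bergmanMeasure N α) :=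
  (hf.continuousOn.aestronglyMeasurable measurableSet_ball).mono_ac
    (bergmanMeasure_absolutelyContinuous α)

theorem memLp_bergman_iff {f : CN N → ℂ} (hf : DifferentiableOn ℂ f (ball 0 1)) (α : ℝ) :
    MemLp f 2 (bergmanMeasure N α) ↔ Integrable (fun z => ‖f z‖ ^ 2) (bergmanMeasure N α) :=
  memLp_two_iff_integrable_sq_norm (aestronglyMeasurable_bergman hf α)

/-- The holomorphic functions `f` on the unit ball with `∫ |f|² dv_α < ∞`.
A function on the ball is represented by its extension by zero to `ℂ^N`. -/
def bergmanSubmodule (N : ℕ) (α : ℝ) : Submodule ℂ (CN N → ℂ) where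
  carrier := {f | DifferentiableOn ℂ f (ball 0 1) ∧ (∀ z ∉ ball (0 : CN N) 1, f z = 0) ∧
    Integrable (fun z => ‖f z‖ ^ 2) (bergmanMeasure N α)}
  zero_mem' := ⟨differentiableOn_const 0, fun _ _ => rfl, by simp⟩
  add_mem' := by
    rintro f g ⟨hf, hf0, hfi⟩ ⟨hg, hg0, hgi⟩
    refine ⟨hf.add hg, fun z hz => by simp [hf0 z hz, hg0 z hz], ?_⟩
    exact (memLp_bergman_iff (hf.add hg) α).1
      (((memLp_bergman_iff hf α).2 hfi).add ((memLp_bergman_iff hg α).2 hgi))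
  smul_mem' := by
    rintro c f ⟨hf, hf0, hfi⟩
    refine ⟨hf.const_smul c, fun z hz => by simp [hf0 z hz], ?_⟩
    exact (memLp_bergman_iff (hf.const_smul c) α).1 (((memLp_bergman_iff hf α).2 hfi).const_smul c)

variable [NeZero N] {α : ℝ}

theorem ballWeight_univ_ne_top (hα : -1 < α) : ballWeight N α univ ≠ ∞ := by
  have h1 : IntegrableOn (fun y : ℝ => (1 - y) ^ α) (Ioo 0 1) := by
    have h := (intervalIntegral.intervalIntegrable_rpow' (a := 0) (b := 1) hα).comp_sub_left 1
    simp only [sub_zero, sub_self] at h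
    have h' := h.symm
    rw [intervalIntegrable_iff_integrableOn_Ioo_of_le (by norm_num)] at h'
    exact h'
  have h2 : IntegrableOn (fun y : ℝ => y ^ (Module.finrank ℝ (CN N) - 1) • (1 - y ^ 2) ^ α)
      (Ioo 0 1) := by
    have h3 : IntegrableOn (fun y : ℝ =>
        (y ^ (Module.finrank ℝ (CN N) - 1) * (1 + y) ^ α) * (1 - y) ^ α) (Ioo 0 1) := by
      refine Integrable.bdd_mul (c := max 1 (2 ^ α)) h1 ?_ ?_
      · exact Measurable.aestronglyMeasurable (by fun_prop)
      · refine (ae_restrict_iff' measurableSet_Ioo).2 (Eventually.of_forall fun y hy => ?_)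
        have hy0 : 0 ≤ y ^ (Module.finrank ℝ (CN N) - 1) := pow_nonneg hy.1.le _
        have hy1 : y ^ (Module.finrank ℝ (CN N) - 1) ≤ 1 := pow_le_one₀ hy.1.le hy.2.le
        have hp : 0 ≤ (1 + y) ^ α := Real.rpow_nonneg (by linarith [hy.1]) _
        rw [Real.norm_of_nonneg (mul_nonneg hy0 hp)]
        refine (mul_le_of_le_one_left hp hy1).trans ?_
        rcases le_total 0 α with ha | ha
        · exact le_max_of_le_right (Real.rpow_le_rpow (by linarith [hy.1]) (by linarith [hy.2]) ha)
        · exact le_max_of_le_left (Real.rpow_le_one_of_one_le_of_nonpos (by linarith [hy.1]) ha)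
    refine h3.congr_fun (fun y hy => ?_) measurableSet_Ioo
    have e : (1 - y ^ 2 : ℝ) = (1 + y) * (1 - y) := by ring
    simp only [smul_eq_mul]
    rw [e, Real.mul_rpow (by linarith [hy.1]) (by linarith [hy.2]), mul_assoc]
  have h3 := (integrableOn_fun_norm_addHaar (volume : Measure (CN N))
    (f := fun y : ℝ => (1 - y ^ 2) ^ α) (r := 1)).2 h2
  rw [ballWeight, withDensity_apply _ MeasurableSet.univ, Measure.restrict_univ]
  exact (Integrable.lintegral_lt_top h3).ne

/-- The weighted Bergman space `A²_α` of the unit ball of `ℂ^N`, for `α > -1`. -/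
def BergmanSpace (N : ℕ) [NeZero N] {α : ℝ} (_ : -1 < α) : Type := bergmanSubmodule N α

namespace BergmanSpace

variable {hα : -1 < α}

instance : AddCommGroup (BergmanSpace N hα) :=
  inferInstanceAs (AddCommGroup (bergmanSubmodule N α))

instance : Module ℂ (BergmanSpace N hα) := inferInstanceAs (Module ℂ (bergmanSubmodule N α))

/-- The underlying function. -/
def toFun (f : BergmanSpace N hα) : CN N → ℂ := Subtype.val (p := (· ∈ bergmanSubmodule N α)) f

instance : CoeFun (BergmanSpace N hα) fun _ => CN N → ℂ := ⟨toFun⟩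

theorem mem (f : BergmanSpace N hα) : f.toFun ∈ bergmanSubmodule N α :=
  Subtype.property (p := (· ∈ bergmanSubmodule N α)) f

theorem ext {f g : BergmanSpace N hα} (h : ∀ z, f z = g z) : f = g :=
  Subtype.ext (p := (· ∈ bergmanSubmodule N α)) (funext h)

@[simp] theorem add_apply (f g : BergmanSpace N hα) (z : CN N) : (f + g) z = f z + g z := rfl

@[simp] theorem smul_apply (c : ℂ) (f : BergmanSpace N hα) (z : CN N) : (c • f) z = c * f z := rfl

@[simp] theorem zero_apply (z : CN N) : (0 : BergmanSpace N hα) z = 0 := rfl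

theorem memLp (f : BergmanSpace N hα) : MemLp f 2 (bergmanMeasure N α) :=
  (memLp_bergman_iff f.mem.1 α).2 f.mem.2.2

theorem integrable_inner (f g : BergmanSpace N hα) :
    Integrable (fun z => inner ℂ (f z) (g z)) (bergmanMeasure N α) := by
  have h := f.memLp.star.integrable_mul g.memLp
  refine h.congr (Eventually.of_forall fun z => ?_)
  simp [mul_comm]

/-- The inner product of `A²_α`: `∫ ⟨f, g⟩ dv_α`, conjugate-linear in `f`. -/
noncomputable def pair (f g : BergmanSpace N hα) : ℂ :=
  ∫ z, inner ℂ (f z) (g z) ∂(bergmanMeasure N α)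

theorem pair_self_eq (f : BergmanSpace N hα) :
    pair f f = ((∫ z, ‖f z‖ ^ 2 ∂(bergmanMeasure N α) : ℝ) : ℂ) := by
  rw [pair, ← integral_complex_ofReal]
  simp [inner_self_eq_norm_sq_to_K]

theorem eq_zero_of_integral (f : BergmanSpace N hα)
    (h : ∫ z, ‖f z‖ ^ 2 ∂(bergmanMeasure N α) = 0) : f = 0 := by
  rw [integral_eq_zero_iff_of_nonneg (fun _ => sq_nonneg _) f.mem.2.2, bergmanMeasure] at h
  have h1 : ∀ᵐ z ∂(ballWeight N α), ‖f z‖ ^ 2 = 0 :=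
    (Measure.ae_ennreal_smul_measure_iff
      (ENNReal.inv_ne_zero.2 (ballWeight_univ_ne_top hα))).1 h
  rw [ballWeight, ae_withDensity_iff (measurable_weight α)] at h1
  have h2 : f.toFun =ᵐ[volume.restrict (ball (0 : CN N) 1)] fun _ => 0 := by
    filter_upwards [h1, ae_restrict_mem measurableSet_ball] with z hz hzb
    have hlt : ‖z‖ < 1 := by simpa using hzb
    have hpos : 0 < (1 - ‖z‖ ^ 2) ^ α :=
      Real.rpow_pos_of_pos (by nlinarith [norm_nonneg z]) _
    simpa using hz (by simpa using hpos)
  have h3 := Measure.eqOn_open_of_ae_eq h2 isOpen_ball f.mem.1.continuousOn continuousOn_const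
  refine ext fun z => ?_
  by_cases hz : z ∈ ball (0 : CN N) 1
  · exact h3 hz
  · exact f.mem.2.1 z hz

/-- The inner product axioms for `pair`. -/
@[reducible] noncomputable def innerCore : InnerProductSpace.Core ℂ (BergmanSpace N hα) where
  inner := pair
  conj_inner_symm f g := by
    simp only [pair, ← integral_conj, inner_conj_symm]
  re_inner_nonneg f := by
    rw [pair_self_eq]
    simpa using integral_nonneg fun z => sq_nonneg ‖f z‖
  add_left f g h := by
    simp only [pair, add_apply, inner_add_left]
    exact integral_add (integrable_inner f h) (integrable_inner g h)
  smul_left f g c := by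
    simp only [pair, smul_apply, ← smul_eq_mul (a := c), inner_smul_left]
    rw [integral_const_mul]
  definite f h := by
    rw [pair_self_eq] at h
    exact eq_zero_of_integral f (by exact_mod_cast h)

noncomputable instance : NormedAddCommGroup (BergmanSpace N hα) :=
  (innerCore (N := N) (hα := hα)).toNormedAddCommGroup

noncomputable instance : InnerProductSpace ℂ (BergmanSpace N hα) :=
  InnerProductSpace.ofCore (innerCore (N := N) (hα := hα)).toCore

/-- The norm of `A²_α` is `‖f‖² = ∫ |f|² dv_α`. -/
theorem norm_sq_eq (f : BergmanSpace N hα) :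
    ‖f‖ ^ 2 = ∫ z, ‖f z‖ ^ 2 ∂(bergmanMeasure N α) := by
  have h : inner ℂ f f = _ := pair_self_eq f
  have h2 : (inner ℂ f f : ℂ) = ((‖f‖ ^ 2 : ℝ) : ℂ) := by
    rw [inner_self_eq_norm_sq_to_K]; simp
  rw [h2] at h
  exact_mod_cast h

end BergmanSpace

end Bergman

section Automorphisms

variable {N : ℕ}

/-- `φ` restricts to an automorphism of the unit ball: a holomorphic bijection of the ball onto
itself with holomorphic inverse. The values of `φ` off the open ball play no role. -/
def IsBallAut (φ : CN N → CN N) : Prop :=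
  DifferentiableOn ℂ φ (ball 0 1) ∧ MapsTo φ (ball 0 1) (ball 0 1) ∧
    ∃ χ : CN N → CN N, DifferentiableOn ℂ χ (ball 0 1) ∧ MapsTo χ (ball 0 1) (ball 0 1) ∧
      InvOn χ φ (ball 0 1) (ball 0 1)

/-- `a` is a boundary fixed point of `φ`: `φ(z) → a` as `z → a` in the ball. -/
def IsBoundaryFixedPt (φ : CN N → CN N) (a : CN N) : Prop :=
  a ∈ sphere (0 : CN N) 1 ∧ Tendsto φ (𝓝[ball 0 1] a) (𝓝 a)

/-- `a` is the Denjoy–Wolff point of `φ`: the iterates of `φ` converge to `a` uniformly on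
compact subsets of the ball. -/
def IsDenjoyWolffPt (φ : CN N → CN N) (a : CN N) : Prop :=
  ∀ C : Set (CN N), IsCompact C → C ⊆ ball 0 1 →
    TendstoUniformlyOn (fun k : ℕ => φ^[k]) (fun _ => a) atTop C

/-- `Φ` is a holomorphic map on a neighbourhood of the closed ball that extends `φ`. -/
def IsHolomorphicExtension (φ Φ : CN N → CN N) : Prop :=
  (∃ U : Set (CN N), IsOpen U ∧ closedBall 0 1 ⊆ U ∧ DifferentiableOn ℂ Φ U) ∧
    EqOn Φ φ (ball 0 1)

/-- The ball algebra: continuous on the closed ball and holomorphic inside. -/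
def MemBallAlgebra (ψ : CN N → ℂ) : Prop :=
  ContinuousOn ψ (closedBall 0 1) ∧ DifferentiableOn ℂ ψ (ball 0 1)

/-- `inf_{z ∈ ball} |ψ(z)| > 0`. -/
def BoundedAwayFromZero (ψ : CN N → ℂ) : Prop :=
  ∃ c : ℝ, 0 < c ∧ ∀ z ∈ ball (0 : CN N) 1, c ≤ ‖ψ z‖

/-- The closed annulus with radii `s` and `t`, in whichever order they fall. -/
def closedAnnulus (s t : ℝ) : Set ℂ := {l | min s t ≤ ‖l‖ ∧ ‖l‖ ≤ max s t}

/-- The spectral radius of a linear map of `ℂ^N`, as a real number. -/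
noncomputable def specRad (A : CN N →L[ℂ] CN N) : ℝ := (spectralRadius ℂ A).toReal

end Automorphisms

end WCO

open WCO

/-! Up to a unitary map, an automorphism is a Möbius involution (`exists_moebius_of_isBallAut`, from
the Schwarz lemma), and the geometry is read off the formula for `1 - ⟨φ(w), φ(z)⟩`
(`one_sub_inner_moebius`). Let κ be the dilation factor of φ at b; at a it is κ⁻¹. At a fixed point
e on the sphere with dilation factor d, the derivative multiplies the e-component by d and scales
norms on the complement of e by √d. Since a attracts, κ > 1, and so κ is the spectral radius of both
φ'(b) and φ'(a)⁻¹. The coordinate h(z) = (1 - ⟨z,b⟩)/(1 - ⟨z,a⟩) satisfies h ∘ φ = κh, so the height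
log|h| rises by log κ at every step; large positive height means near a, large negative height near
b.

The Hardy and Bergman spaces enter only through `IsBallSpace`, with an exponent p = 2K. There is a
weight k, of modulus d^(p/2) at a fixed point with dilation factor d, for which U f = k · (f ∘ φ) is
a contraction. Hence T = C_{ψ,φ} is multiplication by W = ψ/k after U, and |W| tends to s =
|ψ(a)|κ^K at a and to t = |ψ(b)|κ^(-K) at b. The power T^n multiplies U^n f by the product of W
along orbits. An orbit spends boundedly many steps away from a and b, so ‖T^n‖ = O(μ^n) for every μ
> max(s,t). The same argument for T⁻¹, where a and b change roles, confines the spectrum to the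
annulus (`exists_isWeightedComp_bounds`).

To fill the annulus, multiplication by the bounded functions h^(iτ) conjugates T to all its
rotations (`exists_rotation`), so one eigenvalue of each intermediate modulus suffices. If t < s, a
function g vanishing to high order at a and b has ‖T^n g‖ = O(μ^n) for a chosen μ > t and ‖T^(-n) g‖
= O(ν^n) for a chosen ν > 1/s. The bilateral series ∑ λ^(-n) T^n g then converges on intermediate
circles, is formally fixed by λ⁻¹T, and cannot vanish on a whole circle because its Fourier
coefficients do not (`exists_hasEigenvalue_of_orbit_bounds`). If s < t, the same argument applies to
the adjoint and the reproducing kernel at 0, because the φ-orbit of 0 runs into a and its backward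
orbit into b. If s = t, the spectrum is nonempty and rotation invariant inside a circle. -/

namespace WCO

/-! ### Möbius involutions of the ball -/

section Moebius

variable {E : Type*} [NormedAddCommGroup E]

/-- The number `√(1 - |c|²)`. -/
noncomputable def defect (c : E) : ℝ := Real.sqrt (1 - ‖c‖ ^ 2)

theorem defect_sq {c : E} (hc : ‖c‖ < 1) : defect c ^ 2 = 1 - ‖c‖ ^ 2 :=
  Real.sq_sqrt (by nlinarith [norm_nonneg c])

theorem defect_pos {c : E} (hc : ‖c‖ < 1) : 0 < defect c :=
  Real.sqrt_pos.2 (by nlinarith [norm_nonneg c])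

theorem norm_mul_norm_lt_one {c z : E} (hc : ‖c‖ < 1) (hz : ‖z‖ ≤ 1) : ‖c‖ * ‖z‖ < 1 := by
  nlinarith [norm_nonneg c, norm_nonneg z]

theorem one_add_defect_ne_zero {c : E} (hc : ‖c‖ < 1) : (1 + defect c : ℂ) ≠ 0 := by
  have := defect_pos hc
  exact_mod_cast (by positivity : (1 + defect c) ≠ 0)

variable [InnerProductSpace ℂ E]

/-- The Möbius involution of the unit ball that exchanges `0` and `c`. -/
noncomputable def moebius (c z : E) : E :=
  (1 - inner ℂ c z)⁻¹ • (c - (defect c : ℂ) • z - (inner ℂ c z / (1 + defect c)) • c)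

theorem re_one_sub_inner_pos {c z : E} (h : ‖c‖ * ‖z‖ < 1) : 0 < (1 - inner ℂ c z : ℂ).re := by
  have := (Complex.abs_re_le_norm (inner ℂ c z)).trans (norm_inner_le_norm c z)
  rw [Complex.sub_re, Complex.one_re]
  linarith [le_abs_self (inner ℂ c z : ℂ).re]

theorem one_sub_inner_ne_zero {c z : E} (h : ‖c‖ * ‖z‖ < 1) : (1 - inner ℂ c z : ℂ) ≠ 0 := by
  intro h0
  have := re_one_sub_inner_pos h
  rw [h0] at this
  simp at this

theorem inner_self_eq_one_sub_defect_sq {c : E} (hc : ‖c‖ < 1) :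
    inner ℂ c c = (1 : ℂ) - (defect c : ℂ) ^ 2 := by
  rw [inner_self_eq_norm_sq_to_K, ← Complex.ofReal_pow, defect_sq hc]
  simp

/-- A direct expansion using |c|² = 1 - s². For c ≠ 0 the coefficient 1/(1+s) is (1-s)/|c|², so the
numerator of `moebius` is c - Pz - sQz with P the projection onto c and Q = 1 - P; this form also
covers c = 0. Only nonzero denominators are assumed, because the identity is needed at boundary
points and slightly outside the ball. -/
theorem one_sub_inner_moebius {c z w : E} (hc : ‖c‖ < 1) (hz : (1 - inner ℂ c z : ℂ) ≠ 0)
    (hw : (1 - inner ℂ c w : ℂ) ≠ 0) :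
    1 - inner ℂ (moebius c w) (moebius c z) =
      ((defect c : ℂ) ^ 2 * (1 - inner ℂ w z)) /
        ((1 - inner ℂ c z) * (starRingEnd ℂ) (1 - inner ℂ c w)) := by
  have hw' : (1 - inner ℂ w c : ℂ) ≠ 0 := by
    intro h
    apply hw
    have := congrArg (starRingEnd ℂ) h
    simpa using this
  have hs := one_add_defect_ne_zero hc
  simp only [moebius, inner_smul_left, inner_smul_right, inner_sub_left, inner_sub_right, map_inv₀,
    map_sub, map_one, map_div₀, map_add, Complex.conj_ofReal, inner_conj_symm,
    inner_self_eq_one_sub_defect_sq hc]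
  field_simp
  ring

theorem one_sub_norm_sq_moebius {c z : E} (hc : ‖c‖ < 1) (hz : (1 - inner ℂ c z : ℂ) ≠ 0) :
    1 - ‖moebius c z‖ ^ 2 = defect c ^ 2 * (1 - ‖z‖ ^ 2) / ‖(1 - inner ℂ c z : ℂ)‖ ^ 2 := by
  have h := one_sub_inner_moebius hc hz hz
  rw [inner_self_eq_norm_sq_to_K, inner_self_eq_norm_sq_to_K, Complex.mul_conj,
    Complex.normSq_eq_norm_sq] at h
  apply Complex.ofReal_injective
  push_cast at h ⊢
  exact h

theorem norm_moebius_lt {c z : E} (hc : ‖c‖ < 1) (hz : ‖z‖ < 1) : ‖moebius c z‖ < 1 := by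
  have hD := one_sub_inner_ne_zero (norm_mul_norm_lt_one hc hz.le)
  have h := one_sub_norm_sq_moebius hc hD
  have h1 : 0 < defect c ^ 2 * (1 - ‖z‖ ^ 2) / ‖(1 - inner ℂ c z : ℂ)‖ ^ 2 := by
    have := defect_pos hc
    have : 0 < ‖(1 - inner ℂ c z : ℂ)‖ := norm_pos_iff.2 hD
    have : 0 < 1 - ‖z‖ ^ 2 := by nlinarith [norm_nonneg z]
    positivity
  nlinarith [norm_nonneg (moebius c z)]

theorem inner_moebius {c z : E} (hc : ‖c‖ < 1) (hz : (1 - inner ℂ c z : ℂ) ≠ 0) :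
    1 - inner ℂ c (moebius c z) = (defect c : ℂ) ^ 2 / (1 - inner ℂ c z) := by
  have hs := one_add_defect_ne_zero hc
  simp only [moebius, inner_smul_right, inner_sub_right, inner_self_eq_one_sub_defect_sq hc]
  field_simp
  ring

/-- By `inner_moebius` the second denominator is s² divided by the first, so it remains to compare
the coefficients of z and of c. -/
theorem moebius_moebius {c z : E} (hc : ‖c‖ < 1) (hz : (1 - inner ℂ c z : ℂ) ≠ 0) :
    moebius c (moebius c z) = z := by
  have hs := one_add_defect_ne_zero hc
  have hs0 : (defect c : ℂ) ≠ 0 := by exact_mod_cast (defect_pos hc).ne'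
  have h1 := inner_moebius hc hz
  have h2 : inner ℂ c (moebius c z) = 1 - (defect c : ℂ) ^ 2 / (1 - inner ℂ c z) := by
    rw [← h1]; ring
  rw [moebius, h2]
  rw [moebius]
  set D := (1 - inner ℂ c z : ℂ) with hD
  have hz' : inner ℂ c z = 1 - D := by rw [hD]; ring
  rw [hz']
  match_scalars
  · field_simp
    ring
  · field_simp
    ring

theorem moebius_zero (c : E) : moebius c 0 = c := by simp [moebius]

theorem moebius_self {c : E} (hc : ‖c‖ < 1) : moebius c c = 0 := by
  have := moebius_moebius (z := 0) hc (by simp)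
  rwa [moebius_zero] at this

theorem differentiableAt_moebius {c z : E} (hz : (1 - inner ℂ c z : ℂ) ≠ 0) :
    DifferentiableAt ℂ (moebius c) z := by
  have h1 : DifferentiableAt ℂ (fun z : E => (inner ℂ c z : ℂ)) z :=
    (innerSL ℂ c).differentiableAt
  have h2 : DifferentiableAt ℂ (fun z : E => (1 - inner ℂ c z : ℂ)⁻¹) z :=
    (h1.const_sub 1).inv hz
  unfold moebius
  exact h2.smul (((differentiableAt_const _).sub (differentiableAt_id.const_smul _)).sub
    ((by simpa only [div_eq_mul_inv] using h1.mul_const _ : DifferentiableAt ℂ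
      (fun z : E => (inner ℂ c z : ℂ) / (1 + defect c)) z).smul_const c))

end Moebius

/-! ### Automorphisms via the Schwarz lemma -/

section Automorphism

variable {E : Type*} [NormedAddCommGroup E] [InnerProductSpace ℂ E]

/-- On each complex line through 0 the hypothesis is the equality case of the Schwarz lemma, so G is
linear there, with slope given by the derivative at 0. -/
theorem eq_fderiv_of_norm_eq {G : E → E} (hG : DifferentiableOn ℂ G (ball 0 1))
    (hn : ∀ z ∈ ball (0 : E) 1, ‖G z‖ = ‖z‖) {z : E} (hz : z ∈ ball (0 : E) 1) :
    G z = fderiv ℂ G 0 z := by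
  have h0 : G 0 = 0 := by simpa using hn 0 (by simp)
  rcases eq_or_ne z 0 with rfl | hz0
  · simp [h0]
  have hzn : 0 < ‖z‖ := norm_pos_iff.2 hz0
  have hz1 : ‖z‖ < 1 := by simpa using hz
  set ζ : E := ((‖z‖ : ℂ)⁻¹) • z with hζ
  have hζ1 : ‖ζ‖ = 1 := by
    rw [hζ, norm_smul, norm_inv, Complex.norm_real, norm_norm, inv_mul_cancel₀ hzn.ne']
  have hzζ : z = (‖z‖ : ℂ) • ζ := by
    rw [hζ, smul_smul, mul_inv_cancel₀ (by exact_mod_cast hzn.ne'), one_smul]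
  set g : ℂ → E := fun t => G (t • ζ) with hg
  have hmem : ∀ t ∈ ball (0 : ℂ) 1, t • ζ ∈ ball (0 : E) 1 := by
    intro t ht
    simpa [norm_smul, hζ1] using ht
  have hgd : DifferentiableOn ℂ g (ball 0 1) := hG.comp (by fun_prop) hmem
  have hgn : ∀ t ∈ ball (0 : ℂ) 1, ‖g t‖ = ‖t‖ := by
    intro t ht
    rw [hg]
    simp only
    rw [hn _ (hmem t ht), norm_smul, hζ1, mul_one]
  have hg0 : g 0 = 0 := by simp [hg, h0]
  have hmaps : MapsTo g (ball 0 1) (closedBall (g 0) 1) := by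
    intro t ht
    rw [hg0, mem_closedBall_zero_iff, hgn t ht]
    exact (mem_ball_zero_iff.1 ht).le
  -- Any nonzero point of the disc would serve: equality in the Schwarz bound at one point forces an
  -- affine map, given strict convexity of the target.
  have ht0 : ((1 / 2 : ℝ) : ℂ) ∈ ball (0 : ℂ) 1 := by
    simp only [mem_ball_zero_iff, Complex.norm_real]; norm_num
  have hds : ‖dslope g 0 ((1 / 2 : ℝ) : ℂ)‖ = 1 / 1 := by
    rw [dslope_of_ne _ (by norm_num), slope_def_module, hg0, sub_zero, sub_zero, norm_smul,
      hgn _ ht0]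
    simp
  have : StrictConvexSpace ℝ E := by
    let _ := InnerProductSpace.rclikeToReal ℂ E
    infer_instance
  have haff := Complex.affine_of_mapsTo_ball_of_norm_dslope_eq_div hgd hmaps ht0 hds
  set v := dslope g 0 ((1 / 2 : ℝ) : ℂ)
  have hlin : ∀ t ∈ ball (0 : ℂ) 1, g t = t • v := by
    intro t ht
    have := haff ht
    simpa [hg0] using this
  have hGd : HasFDerivAt G (fderiv ℂ G 0) ((0 : ℂ) • ζ) := by
    rw [zero_smul]
    exact (hG.differentiableAt (ball_mem_nhds 0 one_pos)).hasFDerivAt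
  have hd1 : HasDerivAt g (fderiv ℂ G 0 ζ) 0 := by
    have h2 : HasDerivAt (fun t : ℂ => t • ζ) ζ 0 := by
      simpa using (hasDerivAt_id (0 : ℂ)).smul_const ζ
    exact hGd.comp_hasDerivAt (0 : ℂ) h2
  have hd2 : HasDerivAt g v 0 := by
    have h2 : HasDerivAt (fun t : ℂ => t • v) v 0 := by
      simpa using (hasDerivAt_id (0 : ℂ)).smul_const v
    refine h2.congr_of_eventuallyEq ?_
    filter_upwards [ball_mem_nhds (0 : ℂ) one_pos] with t ht using hlin t ht
  have hv := hd1.unique hd2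
  have hzb : (‖z‖ : ℂ) ∈ ball (0 : ℂ) 1 := by simpa using hz1
  have := hlin _ hzb
  rw [← hv, hg] at this
  simp only at this
  rw [← hzζ, ← map_smul, ← hzζ] at this
  exact this

theorem mapsTo_moebius {c : E} (hc : ‖c‖ < 1) :
    MapsTo (moebius c) (ball 0 1) (ball 0 1) := by
  intro z hz
  simpa using norm_moebius_lt hc (by simpa using hz)

theorem differentiableOn_moebius {c : E} (hc : ‖c‖ < 1) :
    DifferentiableOn ℂ (moebius c) (ball 0 1) := by
  intro z hz
  exact (differentiableAt_moebius (one_sub_inner_ne_zero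
    (norm_mul_norm_lt_one hc (mem_ball_zero_iff.1 hz).le))).differentiableWithinAt

theorem moebius_moebius_of_mem {c z : E} (hc : ‖c‖ < 1) (hz : z ∈ ball (0 : E) 1) :
    moebius c (moebius c z) = z :=
  moebius_moebius hc (one_sub_inner_ne_zero
    (norm_mul_norm_lt_one hc (mem_ball_zero_iff.1 hz).le))

/-- Every automorphism of the ball is a unitary map followed by a Möbius involution. -/
theorem exists_moebius_of_isBallAut {N : ℕ} {φ : CN N → CN N} (hφ : IsBallAut φ) :
    ∃ (c : CN N) (V : CN N ≃ₗᵢ[ℂ] CN N), ‖c‖ < 1 ∧ EqOn φ (fun z => moebius c (V z)) (ball 0 1) := by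
  obtain ⟨hd, hm, χ, hχd, hχm, hl, hr⟩ := hφ
  have h0 : (0 : CN N) ∈ ball (0 : CN N) 1 := by simp
  set c := φ 0 with hcdef
  have hc : ‖c‖ < 1 := by simpa using hm h0
  -- G and its inverse F both fix 0 and preserve the ball, so the Schwarz lemma applied to each
  -- makes G norm preserving.
  set G : CN N → CN N := fun z => moebius c (φ z) with hGdef
  set F : CN N → CN N := fun z => χ (moebius c z) with hFdef
  have hGd : DifferentiableOn ℂ G (ball 0 1) := (differentiableOn_moebius hc).comp hd hm
  have hFd : DifferentiableOn ℂ F (ball 0 1) := hχd.comp (differentiableOn_moebius hc)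
    (mapsTo_moebius hc)
  have hGm : MapsTo G (ball 0 1) (ball 0 1) := (mapsTo_moebius hc).comp hm
  have hFm : MapsTo F (ball 0 1) (ball 0 1) := hχm.comp (mapsTo_moebius hc)
  have hG0 : G 0 = 0 := moebius_self hc
  have hF0 : F 0 = 0 := by
    simp only [hFdef, moebius_zero]
    exact hl h0
  have hFG : ∀ z ∈ ball (0 : CN N) 1, F (G z) = z := by
    intro z hz
    simp only [hFdef, hGdef]
    rw [moebius_moebius_of_mem hc (hm hz)]
    exact hl hz
  have hn : ∀ z ∈ ball (0 : CN N) 1, ‖G z‖ = ‖z‖ := by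
    intro z hz
    apply le_antisymm
    · exact Complex.norm_le_norm_of_mapsTo_ball hGd
        (hGm.mono_right ball_subset_closedBall) hG0 (mem_ball_zero_iff.1 hz)
    · have := Complex.norm_le_norm_of_mapsTo_ball hFd
        (hFm.mono_right ball_subset_closedBall) hF0 (mem_ball_zero_iff.1 (hGm hz))
      rwa [hFG z hz] at this
  have hVn : ∀ z, ‖fderiv ℂ G 0 z‖ = ‖z‖ := by
    intro z
    -- Linearity of G is known only on the ball, so z is first scaled into it.
    set t : ℝ := (1 + ‖z‖)⁻¹
    have ht : 0 < t := by positivity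
    have hz : (t : ℂ) • z ∈ ball (0 : CN N) 1 := by
      rw [mem_ball_zero_iff, norm_smul, Complex.norm_real, Real.norm_of_nonneg ht.le,
        inv_mul_lt_one₀ (by positivity)]
      linarith
    have h1 := hn _ hz
    rw [eq_fderiv_of_norm_eq hGd hn hz, map_smul, norm_smul, norm_smul] at h1
    exact mul_left_cancel₀ (by simpa using ht.ne') h1
  let V : CN N →ₗᵢ[ℂ] CN N := ⟨(fderiv ℂ G 0 : CN N →ₗ[ℂ] CN N), hVn⟩
  refine ⟨c, V.toLinearIsometryEquiv rfl, hc, fun z hz => ?_⟩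
  have h1 : V z = G z := (eq_fderiv_of_norm_eq hGd hn hz).symm
  simp only [LinearIsometry.coe_toLinearIsometryEquiv, h1, hGdef]
  exact (moebius_moebius_of_mem hc (hm hz)).symm

end Automorphism

/-! ### Boundary fixed points: dilation factors and derivatives -/

section BoundaryFixedPoint

variable {E : Type*} [NormedAddCommGroup E] [InnerProductSpace ℂ E]

theorem inner_symm_apply (V : E ≃ₗᵢ[ℂ] E) (c z : E) :
    inner ℂ (V.symm c) z = inner ℂ c (V z) := by
  rw [← V.inner_map_map, V.apply_symm_apply]

theorem one_sub_inner_moebius_isometry {c z w : E} (V : E ≃ₗᵢ[ℂ] E) (hc : ‖c‖ < 1)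
    (hz : (1 - inner ℂ (V.symm c) z : ℂ) ≠ 0) (hw : (1 - inner ℂ (V.symm c) w : ℂ) ≠ 0) :
    1 - inner ℂ (moebius c (V w)) (moebius c (V z)) =
      ((defect c : ℂ) ^ 2 * (1 - inner ℂ w z)) /
        ((1 - inner ℂ (V.symm c) z) * (starRingEnd ℂ) (1 - inner ℂ (V.symm c) w)) := by
  rw [inner_symm_apply] at hz hw
  rw [one_sub_inner_moebius hc hz hw, V.inner_map_map, inner_symm_apply, inner_symm_apply]

theorem one_sub_norm_sq_moebius_isometry {c z : E} (V : E ≃ₗᵢ[ℂ] E) (hc : ‖c‖ < 1)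
    (hz : (1 - inner ℂ (V.symm c) z : ℂ) ≠ 0) :
    1 - ‖moebius c (V z)‖ ^ 2 =
      defect c ^ 2 * (1 - ‖z‖ ^ 2) / ‖(1 - inner ℂ (V.symm c) z : ℂ)‖ ^ 2 := by
  rw [inner_symm_apply] at hz ⊢
  rw [one_sub_norm_sq_moebius hc hz, V.norm_map]

theorem norm_symm_mul_norm_lt {c e : E} (V : E ≃ₗᵢ[ℂ] E) (hc : ‖c‖ < 1) (he : ‖e‖ ≤ 1) :
    ‖V.symm c‖ * ‖e‖ < 1 :=
  norm_mul_norm_lt_one (by simpa using hc) he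

theorem inner_self_eq_one {e : E} (he : ‖e‖ = 1) : inner ℂ e e = (1 : ℂ) := by
  rw [inner_self_eq_norm_sq_to_K, he]
  simp

theorem one_sub_inner_ne_zero_of_ne {a b : E} (ha : ‖a‖ = 1) (hb : ‖b‖ = 1) (hab : a ≠ b) :
    (1 - inner ℂ a b : ℂ) ≠ 0 := by
  intro h
  exact hab ((inner_eq_one_iff_of_norm_eq_one ha hb).1 (sub_eq_zero.1 h).symm)

theorem differentiableAt_moebius_isometry {c e : E} (V : E ≃ₗᵢ[ℂ] E)
    (h : (1 - inner ℂ (V.symm c) e : ℂ) ≠ 0) :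
    DifferentiableAt ℂ (fun z => moebius c (V z)) e := by
  rw [inner_symm_apply] at h
  exact (differentiableAt_moebius h).comp e V.differentiableAt

/-- Evaluated at the two fixed points, the basic identity has the nonzero factor 1 - ⟨a,b⟩ on both
sides, and it cancels. Taking moduli shows that the two dilation factors are reciprocal. -/
theorem conj_mul_eq_defect_sq {c a b : E} (V : E ≃ₗᵢ[ℂ] E) (hc : ‖c‖ < 1) (ha : ‖a‖ = 1)
    (hb : ‖b‖ = 1) (hab : a ≠ b) (hfa : moebius c (V a) = a) (hfb : moebius c (V b) = b) :
    (1 - inner ℂ (V.symm c) b) * (starRingEnd ℂ) (1 - inner ℂ (V.symm c) a) =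
      (defect c : ℂ) ^ 2 := by
  have hxa := one_sub_inner_ne_zero (norm_symm_mul_norm_lt V hc ha.le)
  have hxb := one_sub_inner_ne_zero (norm_symm_mul_norm_lt V hc hb.le)
  have h := one_sub_inner_moebius_isometry V hc hxb hxa
  rw [hfa, hfb] at h
  have h1 := one_sub_inner_ne_zero_of_ne ha hb hab
  have hxa' : (starRingEnd ℂ) (1 - inner ℂ (V.symm c) a) ≠ 0 := (map_ne_zero _).2 hxa
  rw [eq_div_iff (mul_ne_zero hxb hxa'), mul_comm] at h
  exact mul_right_cancel₀ h1 h

/-- The dilation factor of an automorphism at a boundary fixed point. -/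
noncomputable def dilation (c : E) (V : E ≃ₗᵢ[ℂ] E) (e : E) : ℝ :=
  defect c ^ 2 / ‖(1 - inner ℂ (V.symm c) e : ℂ)‖ ^ 2

theorem dilation_pos {c e : E} (V : E ≃ₗᵢ[ℂ] E) (hc : ‖c‖ < 1) (he : ‖e‖ = 1) :
    0 < dilation c V e := by
  have h1 := defect_pos hc
  have h2 := norm_pos_iff.2 (one_sub_inner_ne_zero (norm_symm_mul_norm_lt V hc he.le))
  unfold dilation
  positivity

theorem dilation_eq_inv {c a b : E} (V : E ≃ₗᵢ[ℂ] E) (hc : ‖c‖ < 1) (ha : ‖a‖ = 1)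
    (hb : ‖b‖ = 1) (hab : a ≠ b) (hfa : moebius c (V a) = a) (hfb : moebius c (V b) = b) :
    dilation c V a = (dilation c V b)⁻¹ := by
  have h := congrArg norm (conj_mul_eq_defect_sq V hc ha hb hab hfa hfb)
  rw [norm_mul, RCLike.norm_conj, norm_pow, Complex.norm_real,
    Real.norm_of_nonneg (defect_pos hc).le] at h
  have hxa := norm_pos_iff.2 (one_sub_inner_ne_zero (norm_symm_mul_norm_lt V hc ha.le))
  have hxb := norm_pos_iff.2 (one_sub_inner_ne_zero (norm_symm_mul_norm_lt V hc hb.le))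
  rw [dilation, dilation, ← h]
  field_simp

/-- The half-plane coordinate `(1 - ⟨z, b⟩) / (1 - ⟨z, a⟩)` is multiplied by the dilation factor. -/
theorem halfPlane_moebius {c a b z : E} (V : E ≃ₗᵢ[ℂ] E) (hc : ‖c‖ < 1) (ha : ‖a‖ = 1)
    (hb : ‖b‖ = 1) (hab : a ≠ b) (hfa : moebius c (V a) = a) (hfb : moebius c (V b) = b)
    (hz : ‖z‖ < 1) :
    (1 - inner ℂ b (moebius c (V z))) / (1 - inner ℂ a (moebius c (V z))) =
      (dilation c V b : ℂ) * ((1 - inner ℂ b z) / (1 - inner ℂ a z)) := by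
  have hxa := one_sub_inner_ne_zero (norm_symm_mul_norm_lt V hc ha.le)
  have hxb := one_sub_inner_ne_zero (norm_symm_mul_norm_lt V hc hb.le)
  have hxz := one_sub_inner_ne_zero (norm_symm_mul_norm_lt V hc hz.le)
  have h1 := one_sub_inner_moebius_isometry V hc hxz hxa
  have h2 := one_sub_inner_moebius_isometry V hc hxz hxb
  rw [hfa] at h1
  rw [hfb] at h2
  have h3 := conj_mul_eq_defect_sq V hc ha hb hab hfa hfb
  have hxa' : (starRingEnd ℂ) (1 - inner ℂ (V.symm c) a) ≠ 0 := (map_ne_zero _).2 hxa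
  have hxb' : (starRingEnd ℂ) (1 - inner ℂ (V.symm c) b) ≠ 0 := (map_ne_zero _).2 hxb
  have hs : (defect c : ℂ) ≠ 0 := by exact_mod_cast (defect_pos hc).ne'
  have hza : (1 - inner ℂ a z : ℂ) ≠ 0 := one_sub_inner_ne_zero (by rw [ha, one_mul]; exact hz)
  -- In the quotient of `h2` by `h1` only the conjugate of (1 - ⟨V⁻¹c,a⟩)/(1 - ⟨V⁻¹c,b⟩) survives as
  -- a factor; by `h3` it equals s²/|1 - ⟨V⁻¹c,b⟩|².
  rw [h1, h2, dilation]
  push_cast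
  rw [← Complex.mul_conj', ← h3]
  field_simp

/-- Along e + th the basic identity with second point e gives the e-component of the image
explicitly as 1 + t q(t), and q(0) is the derivative. -/
theorem inner_fderiv_moebius {c e : E} (V : E ≃ₗᵢ[ℂ] E) (hc : ‖c‖ < 1) (he : ‖e‖ = 1)
    (hfe : moebius c (V e) = e) (h : E) :
    inner ℂ e (fderiv ℂ (fun z => moebius c (V z)) e h) = (dilation c V e : ℂ) * inner ℂ e h := by
  have hx := one_sub_inner_ne_zero (norm_symm_mul_norm_lt V hc he.le)
  have hd := (differentiableAt_moebius_isometry V hx).hasFDerivAt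
  set A := fderiv ℂ (fun z => moebius c (V z)) e
  have hcurve : HasDerivAt (fun t : ℂ => e + t • h) h 0 := by
    simpa using ((hasDerivAt_id (0 : ℂ)).smul_const h).const_add e
  have hd' : HasFDerivAt (fun z => moebius c (V z)) A (e + (0 : ℂ) • h) := by simpa using hd
  have h1 : HasDerivAt (fun t : ℂ => (inner ℂ e (moebius c (V (e + t • h))) : ℂ))
      (inner ℂ e (A h)) 0 :=
    (innerSL ℂ e).hasFDerivAt.comp_hasDerivAt (0 : ℂ) (HasFDerivAt.comp_hasDerivAt
      (l := fun z => moebius c (V z)) (0 : ℂ) hd' hcurve)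
  set x : ℂ := 1 - inner ℂ (V.symm c) e with hxdef
  set q : ℂ → ℂ := fun t => (defect c : ℂ) ^ 2 * inner ℂ e h /
    ((x - t * inner ℂ (V.symm c) h) * (starRingEnd ℂ) x) with hq
  have hx' : (starRingEnd ℂ) x ≠ 0 := (map_ne_zero _).2 hx
  have hqd : DifferentiableAt ℂ q 0 := by
    refine DifferentiableAt.div (by fun_prop) (by fun_prop) ?_
    simpa using hx
  have h2 : HasDerivAt (fun t : ℂ => 1 + t * q t) (q 0) 0 := by
    simpa using ((hasDerivAt_id (0 : ℂ)).mul hqd.hasDerivAt).const_add 1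
  have hev : ∀ᶠ t : ℂ in 𝓝 0, x - t * inner ℂ (V.symm c) h ≠ 0 := by
    have : ContinuousAt (fun t : ℂ => x - t * inner ℂ (V.symm c) h) 0 := by fun_prop
    exact this.eventually_ne (by simpa using hx)
  have h3 : (fun t : ℂ => (inner ℂ e (moebius c (V (e + t • h))) : ℂ)) =ᶠ[𝓝 0]
      fun t => 1 + t * q t := by
    filter_upwards [hev] with t ht
    have e1 : (1 - inner ℂ (V.symm c) (e + t • h) : ℂ) = x - t * inner ℂ (V.symm c) h := by
      rw [inner_add_right, inner_smul_right, hxdef]; ring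
    have h4 := one_sub_inner_moebius_isometry V hc (z := e + t • h) (w := e) (by rwa [e1]) hx
    rw [hfe, e1, ← hxdef, inner_add_right, inner_self_eq_one he, inner_smul_right] at h4
    have h5 : (inner ℂ e (moebius c (V (e + t • h))) : ℂ) =
      1 - (defect c : ℂ) ^ 2 * (1 - (1 + t * inner ℂ e h)) /
        ((x - t * inner ℂ (V.symm c) h) * (starRingEnd ℂ) x) := by rw [← h4]; ring
    rw [h5, hq]
    ring
  have h6 := (h1.congr_of_eventuallyEq h3.symm).unique h2
  rw [h6, hq, dilation]
  simp only [zero_mul, sub_zero]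
  rw [Complex.mul_conj']
  push_cast
  ring

/-- For h orthogonal to e the image p of e + th still satisfies ⟨e,p⟩ = 1, so |p - e|² = |p|² - 1.
The formula for 1 - |p|², valid outside the ball too, gives the size of the difference quotient
exactly. -/
theorem norm_sq_fderiv_moebius {c e : E} (V : E ≃ₗᵢ[ℂ] E) (hc : ‖c‖ < 1) (he : ‖e‖ = 1)
    (hfe : moebius c (V e) = e) {h : E} (hh : inner ℂ e h = (0 : ℂ)) :
    ‖fderiv ℂ (fun z => moebius c (V z)) e h‖ ^ 2 = dilation c V e * ‖h‖ ^ 2 := by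
  have hx := one_sub_inner_ne_zero (norm_symm_mul_norm_lt V hc he.le)
  have hd := (differentiableAt_moebius_isometry V hx).hasFDerivAt
  set A := fderiv ℂ (fun z => moebius c (V z)) e
  have hcurve : HasDerivAt (fun t : ℂ => e + t • h) h 0 := by
    simpa using ((hasDerivAt_id (0 : ℂ)).smul_const h).const_add e
  have hd' : HasFDerivAt (fun z => moebius c (V z)) A (e + (0 : ℂ) • h) := by simpa using hd
  have h1 : HasDerivAt (fun t : ℂ => moebius c (V (e + t • h))) (A h) 0 :=
    HasFDerivAt.comp_hasDerivAt (l := fun z => moebius c (V z)) (0 : ℂ) hd' hcurve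
  have h2 := (h1.tendsto_slope.norm.pow 2)
  set x : ℂ := 1 - inner ℂ (V.symm c) e with hxdef
  set y : ℂ := inner ℂ (V.symm c) h with hy
  have hev : ∀ᶠ t : ℂ in 𝓝[≠] 0, x - t * y ≠ 0 := by
    have : ContinuousAt (fun t : ℂ => x - t * y) 0 := by fun_prop
    exact nhdsWithin_le_nhds (this.eventually_ne (by simpa using hx))
  have h3 : Tendsto (fun t : ℂ => defect c ^ 2 * ‖h‖ ^ 2 / ‖x - t * y‖ ^ 2) (𝓝[≠] 0)
      (𝓝 (dilation c V e * ‖h‖ ^ 2)) := by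
    have : ContinuousAt (fun t : ℂ => defect c ^ 2 * ‖h‖ ^ 2 / ‖x - t * y‖ ^ 2) 0 := by
      refine ContinuousAt.div (by fun_prop) (by fun_prop) ?_
      simpa using hx
    have h4 := this.tendsto.mono_left (nhdsWithin_le_nhds (s := {0}ᶜ))
    convert h4 using 2
    rw [dilation, zero_mul, sub_zero]
    ring
  refine tendsto_nhds_unique h2 (h3.congr' ?_)
  filter_upwards [hev, self_mem_nhdsWithin] with t ht ht0
  have e1 : (1 - inner ℂ (V.symm c) (e + t • h) : ℂ) = x - t * y := by
    rw [inner_add_right, inner_smul_right, hxdef]; ring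
  set p := moebius c (V (e + t • h)) with hp
  have h4 := one_sub_inner_moebius_isometry V hc (z := e + t • h) (w := e) (by rwa [e1]) hx
  rw [hfe, inner_add_right, inner_self_eq_one he, inner_smul_right, hh] at h4
  have h5 : (inner ℂ e p : ℂ) = 1 := by
    have : (1 - inner ℂ e p : ℂ) = 0 := by rw [h4]; simp
    exact (sub_eq_zero.1 this).symm
  have h6 := one_sub_norm_sq_moebius_isometry V hc (z := e + t • h) (by rwa [e1])
  rw [← hp, e1] at h6
  have h7 : ‖e + t • h‖ ^ 2 = 1 + ‖t‖ ^ 2 * ‖h‖ ^ 2 := by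
    rw [norm_add_sq (𝕜 := ℂ), inner_smul_right, hh, he, norm_smul]
    simp; ring
  have h8 : ‖p - e‖ ^ 2 = ‖p‖ ^ 2 - 1 := by
    have h9 : (inner ℂ p e : ℂ) = 1 := by rw [← inner_conj_symm, h5, map_one]
    rw [norm_sub_sq (𝕜 := ℂ), h9, he]
    simp; ring
  have ht' : ‖t‖ ≠ 0 := by simpa using ht0
  have hxt : ‖x - t * y‖ ≠ 0 := by simpa using ht
  rw [slope_def_module]
  simp only [zero_smul, add_zero, hfe, sub_zero]
  rw [← hp, norm_smul, mul_pow, h8, norm_inv]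
  have h10 : ‖p‖ ^ 2 - 1 = -(defect c ^ 2 * (1 - ‖e + t • h‖ ^ 2) / ‖x - t * y‖ ^ 2) := by
    rw [← h6]; ring
  rw [h10, h7]
  field_simp
  ring

end BoundaryFixedPoint

/-! ### Spectral radii of the derivatives at the fixed points -/

section SpectralRadius

variable {N : ℕ}

theorem isUnit_of_injective (A : CN N →L[ℂ] CN N) (h : Function.Injective A) : IsUnit A := by
  rw [ContinuousLinearMap.isUnit_iff_bijective]
  exact ⟨h, (LinearMap.injective_iff_surjective (f := (A : CN N →ₗ[ℂ] CN N))).1 h⟩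

/-- The complement of e is invariant, since A acts as t modulo it, and A scales norms there by √t.
An eigenvalue is therefore t itself or has modulus √t, which is at most t because 1 ≤ t. -/
theorem specRad_eq_of_dilation {A : CN N →L[ℂ] CN N} {e : CN N} {t : ℝ} (ht : 1 ≤ t)
    (he : ‖e‖ = 1) (h1 : ∀ h, inner ℂ e (A h) = (t : ℂ) * inner ℂ e h)
    (h2 : ∀ h, inner ℂ e h = (0 : ℂ) → ‖A h‖ ^ 2 = t * ‖h‖ ^ 2) : specRad A = t := by
  have ht0 : 0 ≤ t := by linarith
  have hmem : (t : ℂ) ∈ spectrum ℂ A := by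
    rw [spectrum.mem_iff]
    intro hu
    rw [ContinuousLinearMap.isUnit_iff_bijective] at hu
    -- The range of t - A is orthogonal to e, so e itself is not attained.
    obtain ⟨h, hh⟩ := hu.2 e
    have h3 := congrArg (fun v => (inner ℂ e v : ℂ)) hh
    simp [Algebra.algebraMap_eq_smul_one, h1, he] at h3
  have hle : ∀ k ∈ spectrum ℂ A, ‖k‖ ≤ t := by
    intro k hk
    rw [spectrum.mem_iff] at hk
    have hni : ¬ Function.Injective (algebraMap ℂ (CN N →L[ℂ] CN N) k - A) :=
      fun hi => hk (isUnit_of_injective _ hi)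
    rw [injective_iff_map_eq_zero] at hni
    push Not at hni
    obtain ⟨v, hv, hv0⟩ := hni
    have hAv : A v = k • v := by
      have h3 : k • v - A v = 0 := by simpa [Algebra.algebraMap_eq_smul_one] using hv
      exact (sub_eq_zero.1 h3).symm
    by_cases hev : (inner ℂ e v : ℂ) = 0
    · have h3 := h2 v hev
      rw [hAv, norm_smul, mul_pow] at h3
      have hvn : ‖v‖ ^ 2 ≠ 0 := by simpa using hv0
      have h4 := mul_right_cancel₀ hvn h3
      nlinarith [norm_nonneg k]
    · have h3 := h1 v
      rw [hAv, inner_smul_right] at h3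
      rw [mul_right_cancel₀ hev h3, Complex.norm_real, Real.norm_of_nonneg ht0]
  have : spectralRadius ℂ A = ENNReal.ofReal t := by
    apply le_antisymm
    · refine iSup₂_le fun k hk => ?_
      rw [← enorm_eq_nnnorm, ← ofReal_norm]
      exact ENNReal.ofReal_le_ofReal (hle k hk)
    · have h3 : ((‖(t : ℂ)‖₊ : ℝ≥0∞)) ≤ spectralRadius ℂ A :=
        le_iSup₂ (f := fun (k : ℂ) (_ : k ∈ spectrum ℂ A) => (‖k‖₊ : ℝ≥0∞)) _ hmem
      rwa [← enorm_eq_nnnorm, ← ofReal_norm, Complex.norm_real, Real.norm_of_nonneg ht0] at h3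
  rw [specRad, this, ENNReal.toReal_ofReal ht0]

/-- The inverse satisfies the same two relations with t⁻¹ ≥ 1, so the previous lemma applies to it.
This is the situation at the attracting point. -/
theorem isInvertible_and_specRad_inverse_of_dilation {A : CN N →L[ℂ] CN N} {e : CN N} {t : ℝ}
    (ht0 : 0 < t) (ht : t ≤ 1)
    (he : ‖e‖ = 1) (h1 : ∀ h, inner ℂ e (A h) = (t : ℂ) * inner ℂ e h)
    (h2 : ∀ h, inner ℂ e h = (0 : ℂ) → ‖A h‖ ^ 2 = t * ‖h‖ ^ 2) :
    A.IsInvertible ∧ specRad A.inverse = t⁻¹ := by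
  have htc : (t : ℂ) ≠ 0 := by exact_mod_cast ht0.ne'
  have hinj : Function.Injective (A : CN N →ₗ[ℂ] CN N) := by
    rw [injective_iff_map_eq_zero]
    intro v hv
    have hv' : A v = 0 := hv
    have h3 := h1 v
    rw [hv', inner_zero_right, zero_eq_mul, or_iff_right htc] at h3
    have h4 := h2 v h3
    rw [hv', norm_zero] at h4
    have : ‖v‖ ^ 2 = 0 := by
      have := h4.symm
      simpa [ht0.ne'] using this
    simpa using this
  let M : CN N ≃L[ℂ] CN N :=
    (LinearEquiv.ofInjectiveEndo (A : CN N →ₗ[ℂ] CN N) hinj).toContinuousLinearEquiv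
  have hM : (M : CN N →L[ℂ] CN N) = A := by
    ext1 v; rfl
  have hMv : ∀ v, A (M.symm v) = v := fun v => by
    rw [← hM]; exact M.apply_symm_apply v
  refine ⟨⟨M, hM⟩, ?_⟩
  rw [← hM, ContinuousLinearMap.inverse_equiv]
  have h1' : ∀ h, inner ℂ e (M.symm h) = ((t⁻¹ : ℝ) : ℂ) * inner ℂ e h := by
    intro h
    have := h1 (M.symm h)
    rw [hMv] at this
    rw [this]
    push_cast
    field_simp
  refine specRad_eq_of_dilation (one_le_inv_iff₀.2 ⟨ht0, ht⟩) he h1' fun h hh => ?_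
  have h3 := h1' h
  rw [hh, mul_zero] at h3
  have h4 := h2 _ h3
  rw [hMv] at h4
  rw [h4, ← mul_assoc, inv_mul_cancel₀ ht0.ne', one_mul]
  rfl

end SpectralRadius

/-! ### The Jacobian of a Möbius involution and changes of variables -/

section Jacobian

/-- The complex derivative of a Möbius involution. -/
noncomputable def moebiusDeriv {E : Type*} [NormedAddCommGroup E] [InnerProductSpace ℂ E]
    (c z : E) : E →L[ℂ] E :=
  (-(defect c : ℂ) / (1 - inner ℂ c z)) • (ContinuousLinearMap.id ℂ E +
    (innerSL ℂ c).smulRight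
      ((defect c : ℂ)⁻¹ • ((1 + defect c : ℂ)⁻¹ • c - moebius c z)))

theorem hasFDerivAt_moebius {E : Type*} [NormedAddCommGroup E] [InnerProductSpace ℂ E]
    {c z : E} (hc : ‖c‖ < 1) (hz : (1 - inner ℂ c z : ℂ) ≠ 0) :
    HasFDerivAt (moebius c) (moebiusDeriv c z) z := by
  have hs0 : (defect c : ℂ) ≠ 0 := by exact_mod_cast (defect_pos hc).ne'
  have hs := one_add_defect_ne_zero hc
  have h1 : HasFDerivAt (fun z : E => (inner ℂ c z : ℂ)) (innerSL ℂ c) z :=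
    (innerSL ℂ c).hasFDerivAt
  have h2 : HasFDerivAt (fun z : E => (1 - inner ℂ c z : ℂ)⁻¹) _ z :=
    (hasDerivAt_inv hz).comp_hasFDerivAt z (h1.const_sub 1)
  have h3 : HasFDerivAt (fun z : E => c - (defect c : ℂ) • z -
      (inner ℂ c z / (1 + defect c) : ℂ) • c) _ z :=
    (((hasFDerivAt_id z).const_smul (defect c : ℂ)).const_sub c).sub
      ((h1.mul_const (1 + defect c : ℂ)⁻¹).smul_const c)
  have h4 := h2.smul h3
  refine h4.congr_fderiv ?_
  ext1 h
  simp only [moebiusDeriv, moebius]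
  simp
  match_scalars <;> field_simp <;> first | ring1 | rfl

/-- The derivative is a scalar times a rank-one perturbation 1 + ⟨c,·⟩v of the identity, with
determinant 1 + ⟨c,v⟩ = s/(1 - ⟨c,z⟩) by `inner_moebius`. The scalar contributes its N-th power. -/
theorem det_moebiusDeriv {N : ℕ} {c z : CN N} (hc : ‖c‖ < 1) (hz : (1 - inner ℂ c z : ℂ) ≠ 0) :
    (moebiusDeriv c z : CN N →ₗ[ℂ] CN N).det =
      (-(defect c : ℂ) / (1 - inner ℂ c z)) ^ N * ((defect c : ℂ) / (1 - inner ℂ c z)) := by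
  have hs0 : (defect c : ℂ) ≠ 0 := by exact_mod_cast (defect_pos hc).ne'
  have hs := one_add_defect_ne_zero hc
  have h1 : (moebiusDeriv c z : CN N →ₗ[ℂ] CN N) =
      (-(defect c : ℂ) / (1 - inner ℂ c z)) • LinearMap.transvection
        (innerSL ℂ c : CN N →ₗ[ℂ] ℂ)
        ((defect c : ℂ)⁻¹ • ((1 + defect c : ℂ)⁻¹ • c - moebius c z)) := by
    ext1 h
    simp [moebiusDeriv, LinearMap.transvection.apply]
  have h2 : inner ℂ c (moebius c z) = 1 - (defect c : ℂ) ^ 2 / (1 - inner ℂ c z) := by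
    rw [← inner_moebius hc hz]; ring
  rw [h1, LinearMap.det_smul, LinearMap.transvection.det]
  have h3 : Module.finrank ℂ (CN N) = N := by simp
  rw [h3]
  congr 1
  simp only [ContinuousLinearMap.coe_coe, innerSL_apply_apply, inner_smul_right, inner_sub_right,
    h2, inner_self_eq_one_sub_defect_sq hc]
  field_simp
  ring

/-- A complex linear map has real determinant equal to the squared modulus of its complex
determinant. -/
theorem abs_det_moebiusDeriv {N : ℕ} {c z : CN N} (hc : ‖c‖ < 1)
    (hz : (1 - inner ℂ c z : ℂ) ≠ 0) :
    |((moebiusDeriv c z).restrictScalars ℝ).det| =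
      (defect c ^ 2 / ‖(1 - inner ℂ c z : ℂ)‖ ^ 2) ^ (N + 1) := by
  have h1 : ((moebiusDeriv c z).restrictScalars ℝ).det =
      ((moebiusDeriv c z : CN N →ₗ[ℂ] CN N).restrictScalars ℝ).det := rfl
  rw [h1, LinearMap.det_restrictScalars, Algebra.norm_complex_apply, det_moebiusDeriv hc hz]
  have hs := defect_pos hc
  simp only [Complex.normSq_eq_norm_sq, norm_mul, norm_pow, norm_div,
    norm_neg, Complex.norm_real, Real.norm_of_nonneg hs.le]
  rw [abs_of_nonneg (by positivity), ← pow_succ, ← pow_mul, mul_comm, pow_mul, div_pow]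

theorem moebius_image_ball {E : Type*} [NormedAddCommGroup E] [InnerProductSpace ℂ E] {c : E}
    (hc : ‖c‖ < 1) : moebius c '' ball 0 1 = ball 0 1 := by
  apply Subset.antisymm (mapsTo_moebius hc).image_subset
  intro z hz
  exact ⟨moebius c z, mapsTo_moebius hc hz, moebius_moebius_of_mem hc hz⟩

theorem setLIntegral_moebius {N : ℕ} {c : CN N} (hc : ‖c‖ < 1) (g : CN N → ℝ≥0∞) :
    ∫⁻ z in ball (0 : CN N) 1, g z = ∫⁻ z in ball (0 : CN N) 1,
      ENNReal.ofReal ((defect c ^ 2 / ‖(1 - inner ℂ c z : ℂ)‖ ^ 2) ^ (N + 1)) *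
        g (moebius c z) := by
  have hD : ∀ z ∈ ball (0 : CN N) 1, (1 - inner ℂ c z : ℂ) ≠ 0 := fun z hz =>
    one_sub_inner_ne_zero (norm_mul_norm_lt_one hc (mem_ball_zero_iff.1 hz).le)
  have h := lintegral_image_eq_lintegral_abs_det_fderiv_mul (volume : Measure (CN N))
    (s := ball 0 1) measurableSet_ball (f := moebius c)
    (f' := fun z => (moebiusDeriv c z).restrictScalars ℝ)
    (fun z hz => ((hasFDerivAt_moebius hc (hD z hz)).restrictScalars ℝ).hasFDerivWithinAt)
    (LeftInvOn.injOn fun z hz => moebius_moebius_of_mem hc hz) g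
  rw [moebius_image_ball hc] at h
  rw [h]
  refine setLIntegral_congr_fun measurableSet_ball fun z hz => ?_
  rw [abs_det_moebiusDeriv hc (hD z hz)]

theorem setLIntegral_isometry {N : ℕ} (V : CN N ≃ₗᵢ[ℂ] CN N) (g : CN N → ℝ≥0∞) :
    ∫⁻ z in ball (0 : CN N) 1, g (V z) = ∫⁻ z in ball (0 : CN N) 1, g z := by
  let V' : CN N ≃ₗᵢ[ℝ] CN N :=
    ⟨V.toLinearEquiv.restrictScalars ℝ, V.norm_map⟩
  have h := V'.measurePreserving.setLIntegral_comp_preimage_emb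
    V'.toHomeomorph.toMeasurableEquiv.measurableEmbedding g (ball 0 1)
  have h2 : V' ⁻¹' ball (0 : CN N) 1 = ball 0 1 := by
    ext z
    simp
  rw [h2] at h
  exact h

end Jacobian

/-! ### Polar coordinates and means over spheres -/

section Polar

variable {N : ℕ} [NeZero N]

theorem lintegral_polar {F : CN N → ℝ≥0∞} (hF : Measurable F) :
    ∫⁻ z, F z = ∫⁻ r : Ioi (0 : ℝ), ∫⁻ ζ : sphere (0 : CN N) 1,
      F ((r : ℝ) • (ζ : CN N)) ∂(volume : Measure (CN N)).toSphere
      ∂(Measure.volumeIoiPow (Module.finrank ℝ (CN N) - 1)) := by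
  have h1 : ∫⁻ z, F z = ∫⁻ z : ({0}ᶜ : Set (CN N)), F z ∂(volume.comap Subtype.val) := by
    rw [lintegral_subtype_comap (measurableSet_singleton _).compl,
      restrict_compl_singleton]
  have h2 := (Measure.measurePreserving_homeomorphUnitSphereProd
    (volume : Measure (CN N))).lintegral_comp
    (f := fun p : sphere (0 : CN N) 1 × Ioi (0 : ℝ) => F ((p.2 : ℝ) • (p.1 : CN N))) ?_
  · rw [h1]
    have h3 : ∀ z : ({0}ᶜ : Set (CN N)), F z =
        F (((homeomorphUnitSphereProd (CN N) z).2 : ℝ) •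
          ((homeomorphUnitSphereProd (CN N) z).1 : CN N)) := by
      intro z
      congr 1
      have hz : (z : CN N) ≠ 0 := z.2
      have : ‖(z : CN N)‖ ≠ 0 := by simpa using hz
      simp [smul_smul, this]
    simp_rw [h3]
    rw [h2, lintegral_prod_symm]
    exact (hF.comp (by fun_prop)).aemeasurable
  · exact hF.comp (by fun_prop)

/-- Integration of `|f|²` against a radial weight in terms of the means over spheres. -/
theorem setLIntegral_ball_eq_hardyMean {f : CN N → ℂ} (hf : ContinuousOn f (ball 0 1))
    {w : ℝ → ℝ≥0∞} (hw : Measurable w) :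
    ∫⁻ z in ball (0 : CN N) 1, ENNReal.ofReal (‖f z‖ ^ 2) * w ‖z‖ =
      ∫⁻ r : Ioi (0 : ℝ) in {r | (r : ℝ) < 1}, ENNReal.ofReal (hardyMean f r) * w r *
        (volume : Measure (CN N)).toSphere univ
        ∂(Measure.volumeIoiPow (Module.finrank ℝ (CN N) - 1)) := by
  set σ := (volume : Measure (CN N)).toSphere with hσ
  -- Nothing is known about f off the ball, while the polar formula needs a function measurable
  -- everywhere; hence the indicator.
  have hm1 : Measurable ((ball (0 : CN N) 1).indicator fun z => ENNReal.ofReal (‖f z‖ ^ 2)) := by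
    have hfm : Measurable ((ball (0 : CN N) 1).indicator f) := by
      classical
      rw [← piecewise_eq_indicator]
      exact hf.measurable_piecewise continuousOn_const measurableSet_ball
    have : ((ball (0 : CN N) 1).indicator fun z => ENNReal.ofReal (‖f z‖ ^ 2)) =
        fun z => ENNReal.ofReal (‖(ball (0 : CN N) 1).indicator f z‖ ^ 2) := by
      ext z
      by_cases hz : z ∈ ball (0 : CN N) 1 <;> simp [hz, indicator_of_mem, indicator_of_notMem]
    rw [this]
    fun_prop
  have hm : Measurable fun z =>
      (ball (0 : CN N) 1).indicator (fun z => ENNReal.ofReal (‖f z‖ ^ 2)) z * w ‖z‖ :=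
    hm1.mul (hw.comp measurable_norm)
  have h1 : ∫⁻ z in ball (0 : CN N) 1, ENNReal.ofReal (‖f z‖ ^ 2) * w ‖z‖ =
      ∫⁻ z, (ball (0 : CN N) 1).indicator (fun z => ENNReal.ofReal (‖f z‖ ^ 2)) z * w ‖z‖ := by
    rw [← lintegral_indicator measurableSet_ball]
    refine lintegral_congr fun z => ?_
    by_cases hz : z ∈ ball (0 : CN N) 1
    · rw [indicator_of_mem hz, indicator_of_mem hz]
    · rw [indicator_of_notMem hz, indicator_of_notMem hz, zero_mul]
  have hms : MeasurableSet {r : Ioi (0 : ℝ) | (r : ℝ) < 1} :=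
    measurableSet_lt measurable_subtype_coe measurable_const
  rw [h1, lintegral_polar hm, ← lintegral_indicator hms]
  refine lintegral_congr fun r => ?_
  have hr0 : (0 : ℝ) < r := r.2
  have hnorm : ∀ ζ : sphere (0 : CN N) 1, ‖(r : ℝ) • (ζ : CN N)‖ = r := by
    intro ζ
    simp [norm_smul, abs_of_pos hr0]
  by_cases hr : (r : ℝ) < 1
  · rw [indicator_of_mem (by exact hr)]
    have hmem : ∀ ζ : sphere (0 : CN N) 1, (r : ℝ) • (ζ : CN N) ∈ ball (0 : CN N) 1 :=
      fun ζ => rsmul_mem_ball ⟨hr0, hr⟩ ζ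
    simp_rw [hnorm, indicator_of_mem (hmem _)]
    have hc : Continuous fun ζ : sphere (0 : CN N) 1 => ‖f ((r : ℝ) • (ζ : CN N))‖ ^ 2 :=
      (continuous_dilate hf ⟨hr0, hr⟩).norm.pow 2
    rw [lintegral_mul_const _ (by exact hc.measurable.ennreal_ofReal)]
    have h2 : ∫⁻ ζ : sphere (0 : CN N) 1, ENNReal.ofReal (‖f ((r : ℝ) • (ζ : CN N))‖ ^ 2) ∂σ =
        ENNReal.ofReal (hardyMean f r) * σ univ := by
      rw [hardyMean, ofReal_integral_eq_lintegral_ofReal (integrable_of_continuous hc)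
        (Eventually.of_forall fun _ => sq_nonneg _), surfaceMeasure, lintegral_smul_measure,
        smul_eq_mul, mul_right_comm, ENNReal.inv_mul_cancel toSphere_univ_ne_zero
          (measure_ne_top _ _), one_mul]
    rw [h2]
    ring
  · rw [indicator_of_notMem (by exact hr)]
    have hmem : ∀ ζ : sphere (0 : CN N) 1, (r : ℝ) • (ζ : CN N) ∉ ball (0 : CN N) 1 := by
      intro ζ h
      rw [mem_ball_zero_iff, hnorm] at h
      exact hr h
    simp_rw [indicator_of_notMem (hmem _)]
    simp

theorem hardyMean_one (r : ℝ) : hardyMean (fun _ : CN N => (1 : ℂ)) r = 1 := by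
  simp [hardyMean]

theorem setLIntegral_ball_le_of_hardyMean_le {f : CN N → ℂ} (hf : ContinuousOn f (ball 0 1))
    {w : ℝ → ℝ≥0∞} (hw : Measurable w) {M : ℝ} (hM : ∀ r ∈ Ioo (0 : ℝ) 1, hardyMean f r ≤ M) :
    ∫⁻ z in ball (0 : CN N) 1, ENNReal.ofReal (‖f z‖ ^ 2) * w ‖z‖ ≤
      ENNReal.ofReal M * ∫⁻ z in ball (0 : CN N) 1, w ‖z‖ := by
  have h1 := setLIntegral_ball_eq_hardyMean (f := fun _ : CN N => (1 : ℂ)) continuousOn_const hw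
  simp only [norm_one, one_pow, ENNReal.ofReal_one, one_mul, hardyMean_one] at h1
  have hms : MeasurableSet {r : Ioi (0 : ℝ) | (r : ℝ) < 1} :=
    measurableSet_lt measurable_subtype_coe measurable_const
  rw [h1, setLIntegral_ball_eq_hardyMean hf hw, ← lintegral_const_mul _ (by fun_prop)]
  refine setLIntegral_mono' hms fun r hr => ?_
  rw [mul_assoc]
  gcongr
  exact hM _ ⟨r.2, hr⟩

/-- The lower bound is asked only where the weight is nonzero, so that a weight cut off to a shell
can be paired with a bound valid on that shell. -/
theorem le_setLIntegral_ball_of_le_hardyMean {f : CN N → ℂ} (hf : ContinuousOn f (ball 0 1))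
    {w : ℝ → ℝ≥0∞} (hw : Measurable w) {m : ℝ}
    (hm : ∀ r ∈ Ioo (0 : ℝ) 1, w r ≠ 0 → m ≤ hardyMean f r) :
    ENNReal.ofReal m * ∫⁻ z in ball (0 : CN N) 1, w ‖z‖ ≤
      ∫⁻ z in ball (0 : CN N) 1, ENNReal.ofReal (‖f z‖ ^ 2) * w ‖z‖ := by
  have h1 := setLIntegral_ball_eq_hardyMean (f := fun _ : CN N => (1 : ℂ)) continuousOn_const hw
  simp only [norm_one, one_pow, ENNReal.ofReal_one, one_mul, hardyMean_one] at h1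
  have hms : MeasurableSet {r : Ioi (0 : ℝ) | (r : ℝ) < 1} :=
    measurableSet_lt measurable_subtype_coe measurable_const
  rw [h1, setLIntegral_ball_eq_hardyMean hf hw, ← lintegral_const_mul _ (by fun_prop)]
  refine setLIntegral_mono' hms fun r hr => ?_
  rw [mul_assoc]
  by_cases h0 : w r = 0
  · simp [h0]
  gcongr
  exact hm _ ⟨r.2, hr⟩ h0

/-- The value at the centre is dominated by the means over spheres. -/
theorem norm_sq_zero_le_hardyMean {f : CN N → ℂ} (hf : DifferentiableOn ℂ f (ball 0 1)) {r : ℝ}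
    (hr : r ∈ Ioo (0 : ℝ) 1) : ‖f 0‖ ^ 2 ≤ hardyMean f r := by
  have hc := hf.continuousOn
  have h0 : ContinuousAt f 0 := hc.continuousAt (ball_mem_nhds 0 one_pos)
  have key : ∀ ε > 0, ‖f 0‖ ^ 2 - ε ≤ hardyMean f r := by
    intro ε hε
    have hcont : ContinuousAt (fun z => ‖f z‖ ^ 2) 0 := h0.norm.pow 2
    obtain ⟨δ, hδ, hball⟩ := Metric.continuousAt_iff.1 hcont ε hε
    -- The means increase with the radius, so it suffices to bound the mean at a radius so small
    -- that |f|² stays within ε of its value at 0.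
    set q := min r (δ / 2) with hq
    have hq0 : 0 < q := lt_min hr.1 (by positivity)
    have hqr : q ≤ r := min_le_left _ _
    have hqI : q ∈ Ioo (0 : ℝ) 1 := ⟨hq0, hqr.trans_lt hr.2⟩
    refine le_trans ?_ (hardyMean_mono hf hqI hr hqr)
    have h1 : ∫ _ : sphere (0 : CN N) 1, (‖f 0‖ ^ 2 - ε) ∂(surfaceMeasure N) = ‖f 0‖ ^ 2 - ε := by
      simp
    rw [← h1]
    refine integral_mono (integrable_const _)
      (integrable_of_continuous ((continuous_dilate hc hqI).norm.pow 2)) fun ζ => ?_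
    have h2 : dist (q • (ζ : CN N)) 0 < δ := by
      rw [dist_zero_right, norm_smul, Real.norm_of_nonneg hq0.le]
      simp only [norm_eq_of_mem_sphere, mul_one]
      have : q ≤ δ / 2 := min_le_right _ _
      linarith
    have h3 := hball h2
    rw [Real.dist_eq] at h3
    have := (abs_lt.1 h3).1
    linarith
  exact le_of_forall_sub_le key

end Polar

/-! ### Locally uniform limits of holomorphic functions -/

section Weierstrass

variable {E : Type*} [NormedAddCommGroup E] [NormedSpace ℂ E]

/-- A locally uniform limit of holomorphic functions on the unit ball is holomorphic. -/
theorem differentiableOn_ball_of_tendstoUniformlyOn {F : ℕ → E → ℂ} {g : E → ℂ}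
    (hF : ∀ n, DifferentiableOn ℂ (F n) (ball 0 1))
    (hu : ∀ r < 1, TendstoUniformlyOn F g atTop (ball 0 r)) :
    DifferentiableOn ℂ g (ball 0 1) := by
  intro z hz
  refine DifferentiableAt.differentiableWithinAt ?_
  rw [mem_ball_zero_iff] at hz
  set δ := (1 - ‖z‖) / 4 with hδ
  have hδ0 : 0 < δ := by rw [hδ]; linarith
  have hsub : ∀ x ∈ ball z δ, ball x δ ⊆ ball (0 : E) (1 - δ) := by
    intro x hx y hy
    rw [mem_ball, dist_eq_norm] at hx hy
    rw [mem_ball_zero_iff]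
    have : ‖y‖ ≤ ‖y - x‖ + ‖x - z‖ + ‖z‖ := by
      calc ‖y‖ = ‖(y - x) + (x - z) + z‖ := by abel_nf
        _ ≤ _ := norm_add₃_le
    linarith
  have hsub1 : ball (0 : E) (1 - δ) ⊆ ball 0 1 := ball_subset_ball (by linarith)
  have hd : ∀ n, ∀ x ∈ ball z δ, DifferentiableAt ℂ (F n) x := fun n x hx =>
    (hF n).differentiableAt (isOpen_ball.mem_nhds (hsub1 (hsub x hx (mem_ball_self hδ0))))
  have hC := (hu (1 - δ) (by linarith)).uniformCauchySeqOn
  have hC' : UniformCauchySeqOn (fun n x => fderiv ℂ (F n) x) atTop (ball z δ) := by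
    rw [Metric.uniformCauchySeqOn_iff] at hC ⊢
    intro ε hε
    -- Values of F m - F n then differ by less than εδ/2 on a ball of radius δ, and the Cauchy
    -- estimate bounds the derivative by ε/2.
    obtain ⟨n₀, hn₀⟩ := hC (ε * δ / 4) (by positivity)
    refine ⟨n₀, fun m hm n hn x hx => ?_⟩
    have hdm := hd m x hx
    have hdn := hd n x hx
    rw [dist_eq_norm, ← fderiv_sub hdm hdn]
    have hb : ∀ y ∈ ball x δ, ‖(F m - F n) y‖ < ε * δ / 4 := by
      intro y hy
      have := hn₀ m hm n hn y (hsub x hx hy)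
      rwa [dist_eq_norm] at this
    have h1 := Complex.norm_fderiv_le_div_of_mapsTo_ball (f := F m - F n) (c := x) (R₁ := δ)
      (R₂ := ε * δ / 2)
      (((hF m).sub (hF n)).mono ((hsub x hx).trans hsub1)) (fun y hy => by
        rw [mem_closedBall, dist_eq_norm]
        have h2 := norm_sub_le ((F m - F n) y) ((F m - F n) x)
        have h3 := hb y hy
        have h4 := hb x (mem_ball_self hδ0)
        linarith) hδ0
    refine h1.trans_lt ?_
    rw [div_lt_iff₀ hδ0]
    nlinarith
  -- The limit derivative is chosen at every point so as to be a total function; off the ball it is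
  -- the irrelevant value 0.
  have hlim : ∀ x : E, ∃ A : E →L[ℂ] ℂ, x ∈ ball z δ →
      Tendsto (fun n => fderiv ℂ (F n) x) atTop (𝓝 A) := by
    intro x
    by_cases hx : x ∈ ball z δ
    · obtain ⟨A, hA⟩ := cauchySeq_tendsto_of_complete (hC'.cauchySeq hx)
      exact ⟨A, fun _ => hA⟩
    · exact ⟨0, fun h => absurd h hx⟩
  choose g' hg' using hlim
  have hU : TendstoUniformlyOn (fun n x => fderiv ℂ (F n) x) g' atTop (ball z δ) :=
    hC'.tendstoUniformlyOn_of_tendsto fun x hx => hg' x hx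
  exact (hasFDerivAt_of_tendstoLocallyUniformlyOn isOpen_ball hU.tendstoLocallyUniformlyOn
    (fun n x hx => (hd n x hx).hasFDerivAt)
    (fun x hx => (hu (1 - δ) (by linarith)).tendsto_at (hsub x hx (mem_ball_self hδ0)))
    (mem_ball_self hδ0)).differentiableAt

end Weierstrass

/-- The multiplier `(s / (1 - ⟨z, c⟩))^p`, `s = √(1 - |c|²)`, that makes composition with a Möbius
involution isometric. -/
noncomputable def moebiusWeight {N : ℕ} (p : ℝ) (c z : CN N) : ℂ :=
  ((defect c : ℂ) / (1 - inner ℂ c z)) ^ (p : ℂ)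

/-! ### The multiplier attached to a Möbius involution -/

section Weight

variable {N : ℕ} {p : ℝ} {c z : CN N}

/-- The base of the power in `moebiusWeight` stays in the right half-plane, where the principal
branch is holomorphic. -/
theorem re_defect_div_pos (hc : ‖c‖ < 1) (hz : ‖c‖ * ‖z‖ < 1) :
    0 < ((defect c : ℂ) / (1 - inner ℂ c z)).re := by
  have h1 := re_one_sub_inner_pos hz
  have h2 : 0 < Complex.normSq (1 - inner ℂ c z) :=
    Complex.normSq_pos.2 (one_sub_inner_ne_zero hz)
  rw [Complex.div_re]
  simp only [Complex.ofReal_re, Complex.ofReal_im, zero_mul, zero_div, add_zero]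
  have := defect_pos hc
  positivity

theorem norm_moebiusWeight (hc : ‖c‖ < 1) :
    ‖moebiusWeight p c z‖ = (defect c / ‖(1 - inner ℂ c z : ℂ)‖) ^ p := by
  rw [moebiusWeight, Complex.norm_cpow_real, norm_div, Complex.norm_real,
    Real.norm_of_nonneg (defect_pos hc).le]

theorem moebiusWeight_ne_zero (hc : ‖c‖ < 1) (hz : ‖c‖ * ‖z‖ < 1) : moebiusWeight p c z ≠ 0 := by
  rw [← norm_pos_iff, norm_moebiusWeight hc]
  have := defect_pos hc
  have := norm_pos_iff.2 (one_sub_inner_ne_zero hz)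
  positivity

theorem differentiableAt_moebiusWeight (hc : ‖c‖ < 1) (hz : ‖c‖ * ‖z‖ < 1) :
    DifferentiableAt ℂ (moebiusWeight p c) z := by
  have h1 : DifferentiableAt ℂ (fun z : CN N => (inner ℂ c z : ℂ)) z :=
    (innerSL ℂ c).differentiableAt
  have h2 : DifferentiableAt ℂ (fun z : CN N => (defect c : ℂ) / (1 - inner ℂ c z)) z := by
    simpa only [div_eq_mul_inv] using
      ((h1.const_sub (1 : ℂ)).fun_inv (one_sub_inner_ne_zero hz)).const_mul (defect c : ℂ)
  exact h2.cpow_const (Or.inl (re_defect_div_pos hc hz))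

end Weight

/-- The properties of the Hardy and Bergman spaces of the unit ball that determine the spectra of
weighted composition operators: `H` is a space of holomorphic functions on the ball with bounded
evaluations, contractive multipliers and contractive weighted Möbius compositions. -/
structure IsBallSpace (N : ℕ) (p : ℝ) {H : Type*} [NormedAddCommGroup H] [InnerProductSpace ℂ H]
    (ev : H →ₗ[ℂ] (CN N → ℂ)) : Prop where
  differentiableOn : ∀ f, DifferentiableOn ℂ (ev f) (ball 0 1)
  eq_zero : ∀ f, (∀ z ∈ ball (0 : CN N) 1, ev f z = 0) → f = 0
  norm_apply_zero_le : ∀ f, ‖ev f 0‖ ≤ ‖f‖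
  exists_limit : ∀ (f : ℕ → H) (g : CN N → ℂ) (M : ℝ), DifferentiableOn ℂ g (ball 0 1) →
    (∀ r < 1, TendstoUniformlyOn (fun n => ev (f n)) g atTop (ball 0 r)) →
    (∀ᶠ n in atTop, ‖f n‖ ≤ M) →
    ∃ h, (∀ z ∈ ball (0 : CN N) 1, ev h z = g z) ∧ ‖h‖ ≤ M
  exists_mul : ∀ (W : CN N → ℂ) (M : ℝ), DifferentiableOn ℂ W (ball 0 1) →
    (∀ z ∈ ball (0 : CN N) 1, ‖W z‖ ≤ M) → ∀ f,
    ∃ g, (∀ z ∈ ball (0 : CN N) 1, ev g z = W z * ev f z) ∧ ‖g‖ ≤ M * ‖f‖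
  exists_moebius : ∀ c : CN N, ‖c‖ < 1 → ∀ f, ∃ g,
    (∀ z ∈ ball (0 : CN N) 1, ev g z = moebiusWeight p c z * ev f (moebius c z)) ∧ ‖g‖ ≤ ‖f‖
  exists_isometry : ∀ (V : CN N ≃ₗᵢ[ℂ] CN N) (f), ∃ g,
    (∀ z ∈ ball (0 : CN N) 1, ev g z = ev f (V z)) ∧ ‖g‖ ≤ ‖f‖
  exists_one : ∃ f, ∀ z ∈ ball (0 : CN N) 1, ev f z = 1

/-! ### Consequences of the axioms: point evaluations and completeness -/

namespace IsBallSpace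

variable {N : ℕ} {p : ℝ} {H : Type*} [NormedAddCommGroup H] [InnerProductSpace ℂ H]
  {ev : H →ₗ[ℂ] (CN N → ℂ)}

theorem ext (hH : IsBallSpace N p ev) {f g : H} (h : ∀ z ∈ ball (0 : CN N) 1, ev f z = ev g z) :
    f = g := by
  rw [← sub_eq_zero]
  refine hH.eq_zero _ fun z hz => ?_
  rw [map_sub, Pi.sub_apply, h z hz, sub_self]

/-- The weighted Möbius composition carries the evaluation at c to the evaluation at 0, with weight
s^p there. -/
theorem norm_apply_le (hH : IsBallSpace N p ev) {c : CN N} (hc : ‖c‖ < 1) (f : H) :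
    ‖ev f c‖ ≤ (defect c ^ p)⁻¹ * ‖f‖ := by
  obtain ⟨g, hg, hgf⟩ := hH.exists_moebius c hc f
  have h1 := hH.norm_apply_zero_le g
  rw [hg 0 (by simp), moebius_zero, norm_mul, norm_moebiusWeight hc] at h1
  simp only [inner_zero_right, sub_zero, norm_one, div_one] at h1
  have h2 : 0 < defect c ^ p := Real.rpow_pos_of_pos (defect_pos hc) _
  rw [← div_eq_inv_mul, le_div_iff₀ h2]
  linarith

theorem norm_apply_le_of_le (hH : IsBallSpace N p ev) (hp : 0 ≤ p) {r : ℝ} (hr : r < 1) {c : CN N}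
    (hc : ‖c‖ ≤ r) (f : H) : ‖ev f c‖ ≤ (Real.sqrt (1 - r ^ 2) ^ p)⁻¹ * ‖f‖ := by
  have hr0 : 0 ≤ r := (norm_nonneg c).trans hc
  refine (hH.norm_apply_le (hc.trans_lt hr) f).trans ?_
  have h1 : 0 < Real.sqrt (1 - r ^ 2) := Real.sqrt_pos.2 (by nlinarith)
  have h2 : Real.sqrt (1 - r ^ 2) ≤ defect c := Real.sqrt_le_sqrt (by gcongr)
  gcongr

/-- A space with these properties is complete. -/
theorem completeSpace (hH : IsBallSpace N p ev) (hp : 0 ≤ p) : CompleteSpace H := by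
  refine UniformSpace.complete_of_cauchySeq_tendsto fun f hf => ?_
  have hf' := Metric.cauchySeq_iff.1 hf
  have hC : ∀ r < 1, UniformCauchySeqOn (fun n => ev (f n)) atTop (ball 0 r) := by
    intro r hr
    rw [Metric.uniformCauchySeqOn_iff]
    intro ε hε
    rcases le_or_gt r 0 with hr0 | hr0
    · exact ⟨0, fun _ _ _ _ x hx => by simp [ball_eq_empty.2 hr0] at hx⟩
    have h1 : 0 < Real.sqrt (1 - r ^ 2) ^ p :=
      Real.rpow_pos_of_pos (Real.sqrt_pos.2 (by nlinarith)) _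
    obtain ⟨n₀, hn₀⟩ := hf' (ε * Real.sqrt (1 - r ^ 2) ^ p) (by positivity)
    refine ⟨n₀, fun m hm n hn x hx => ?_⟩
    have h2 := hH.norm_apply_le_of_le hp hr (mem_ball_zero_iff.1 hx).le (f m - f n)
    have h3 := hn₀ m hm n hn
    rw [dist_eq_norm] at h3 ⊢
    rw [map_sub, Pi.sub_apply, ← div_eq_inv_mul, le_div_iff₀ h1] at h2
    exact lt_of_mul_lt_mul_right (h2.trans_lt h3) h1.le
  have hlim : ∀ z : CN N, ∃ w : ℂ, z ∈ ball (0 : CN N) 1 →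
      Tendsto (fun n => ev (f n) z) atTop (𝓝 w) := by
    intro z
    by_cases hz : z ∈ ball (0 : CN N) 1
    · obtain ⟨r, hr1, hr2⟩ := exists_between (mem_ball_zero_iff.1 hz)
      obtain ⟨w, hw⟩ := cauchySeq_tendsto_of_complete
        ((hC r hr2).cauchySeq (mem_ball_zero_iff.2 hr1))
      exact ⟨w, fun _ => hw⟩
    · exact ⟨0, fun h => absurd h hz⟩
  choose g hg using hlim
  have hU : ∀ r < 1, TendstoUniformlyOn (fun n => ev (f n)) g atTop (ball 0 r) := fun r hr =>
    (hC r hr).tendstoUniformlyOn_of_tendsto fun z hz => hg z (ball_subset_ball hr.le hz)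
  have hgd := differentiableOn_ball_of_tendstoUniformlyOn (fun n => hH.differentiableOn (f n)) hU
  obtain ⟨R, hR⟩ := hf.norm_bddAbove
  obtain ⟨h, hh, -⟩ := hH.exists_limit f g R hgd hU
    (Eventually.of_forall fun n => hR (mem_range_self n))
  refine ⟨h, Metric.tendsto_atTop.2 fun ε hε => ?_⟩
  obtain ⟨n₀, hn₀⟩ := hf' (ε / 2) (by positivity)
  refine ⟨n₀, fun n hn => ?_⟩
  -- The limit axiom is used a second time, now with n fixed and m → ∞: lower semicontinuity of the
  -- norm turns the Cauchy bound into a bound for f n - h.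
  obtain ⟨k, hk, hkn⟩ := hH.exists_limit (fun m => f n - f m) (fun z => ev (f n) z - g z) (ε / 2)
    ((hH.differentiableOn _).sub hgd) (fun r hr => by
      rw [Metric.tendstoUniformlyOn_iff]
      intro η hη
      filter_upwards [Metric.tendstoUniformlyOn_iff.1 (hU r hr) η hη] with m hm z hz
      rw [map_sub, Pi.sub_apply, dist_sub_left]
      exact hm z hz)
    (by
      filter_upwards [eventually_ge_atTop n₀] with m hm
      have := hn₀ n hn m hm
      rw [dist_eq_norm] at this
      exact this.le)
  have hkeq : k = f n - h := hH.ext fun z hz => by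
    rw [hk z hz, map_sub, Pi.sub_apply, hh z hz]
  rw [dist_eq_norm, ← hkeq]
  linarith

end IsBallSpace

/-! ### Integrals against the Bergman weights -/

section BergmanIntegrals

variable {N : ℕ}

theorem lintegral_ballWeight (α : ℝ) (g : CN N → ℝ≥0∞) :
    ∫⁻ z, g z ∂(ballWeight N α) =
      ∫⁻ z in ball (0 : CN N) 1, g z * ENNReal.ofReal ((1 - ‖z‖ ^ 2) ^ α) := by
  rw [ballWeight, lintegral_withDensity_eq_lintegral_mul_non_measurable _ (measurable_weight α)
    (Eventually.of_forall fun _ => ENNReal.ofReal_lt_top)]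
  simp only [Pi.mul_apply, mul_comm]

theorem ballWeight_univ (α : ℝ) :
    ballWeight N α univ = ∫⁻ z in ball (0 : CN N) 1, ENNReal.ofReal ((1 - ‖z‖ ^ 2) ^ α) := by
  have := lintegral_ballWeight (N := N) α 1
  simpa using this

theorem ballWeight_univ_ne_zero (α : ℝ) : ballWeight N α univ ≠ 0 := by
  rw [ballWeight_univ, ← pos_iff_ne_zero, setLIntegral_pos_iff (measurable_weight α)]
  have : (Function.support fun z : CN N => ENNReal.ofReal ((1 - ‖z‖ ^ 2) ^ α)) ∩ ball 0 1 =
      ball 0 1 := by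
    refine inter_eq_right.2 fun z hz => ?_
    have hz1 : ‖z‖ < 1 := mem_ball_zero_iff.1 hz
    have : 0 < 1 - ‖z‖ ^ 2 := by nlinarith [norm_nonneg z]
    rw [Function.mem_support, Ne, ENNReal.ofReal_eq_zero, not_le]
    positivity
  rw [this]
  exact isOpen_ball.measure_pos volume ⟨0, by simp⟩

/-- With q = s/|1 - ⟨c,z⟩|, the Jacobian contributes q^(2(N+1)) and the weight (1 - |z|²)^α
contributes q^(2α). The total is the squared modulus of `moebiusWeight` with exponent N + 1 + α. -/
theorem setLIntegral_moebius_weight {c : CN N} (hc : ‖c‖ < 1) (α : ℝ) {g : CN N → ℝ}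
    (hg : ∀ z, 0 ≤ g z) :
    ∫⁻ z in ball (0 : CN N) 1, ENNReal.ofReal (g z) * ENNReal.ofReal ((1 - ‖z‖ ^ 2) ^ α) =
      ∫⁻ z in ball (0 : CN N) 1,
        ENNReal.ofReal ((defect c / ‖(1 - inner ℂ c z : ℂ)‖) ^ (2 * (N + 1 + α)) *
          g (moebius c z)) * ENNReal.ofReal ((1 - ‖z‖ ^ 2) ^ α) := by
  rw [setLIntegral_moebius hc]
  refine setLIntegral_congr_fun measurableSet_ball fun z hz => ?_
  have hz1 : ‖z‖ < 1 := mem_ball_zero_iff.1 hz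
  have hD := one_sub_inner_ne_zero (norm_mul_norm_lt_one hc hz1.le)
  have hDn := norm_pos_iff.2 hD
  have hs := defect_pos hc
  have hw : 0 < 1 - ‖z‖ ^ 2 := by nlinarith [norm_nonneg z]
  set q := defect c / ‖(1 - inner ℂ c z : ℂ)‖ with hq
  have hq0 : 0 < q := by positivity
  have h1 : 1 - ‖moebius c z‖ ^ 2 = q ^ 2 * (1 - ‖z‖ ^ 2) := by
    rw [one_sub_norm_sq_moebius hc hD, hq, div_pow]; ring
  have h2 : q ^ (2 * (N + 1 + α)) = (q ^ 2) ^ (N + 1) * (q ^ 2) ^ α := by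
    rw [Real.rpow_mul hq0.le, Real.rpow_two, Real.rpow_add (by positivity)]
    norm_cast
  rw [h1, ← div_pow, ← hq, Real.mul_rpow (by positivity) hw.le, h2,
    ← ENNReal.ofReal_mul (hg _), ← ENNReal.ofReal_mul (by positivity),
    ← ENNReal.ofReal_mul (mul_nonneg (by positivity) (hg _))]
  congr 1
  ring

variable [NeZero N] {α : ℝ}

theorem BergmanSpace.setLIntegral_eq {hα : -1 < α} (f : BergmanSpace N hα) :
    ∫⁻ z in ball (0 : CN N) 1, ENNReal.ofReal (‖f z‖ ^ 2) * ENNReal.ofReal ((1 - ‖z‖ ^ 2) ^ α) =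
      ENNReal.ofReal (‖f‖ ^ 2) * ballWeight N α univ := by
  rw [BergmanSpace.norm_sq_eq, ofReal_integral_eq_lintegral_ofReal f.mem.2.2
    (Eventually.of_forall fun _ => sq_nonneg _), bergmanMeasure, lintegral_smul_measure,
    smul_eq_mul, mul_right_comm, ENNReal.inv_mul_cancel (ballWeight_univ_ne_zero α)
    (ballWeight_univ_ne_top hα), one_mul, lintegral_ballWeight]

theorem BergmanSpace.exists_of_setLIntegral_le (hα : -1 < α) {f : CN N → ℂ}
    (hf : DifferentiableOn ℂ f (ball 0 1)) {M : ℝ} (hM : 0 ≤ M)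
    (h : ∫⁻ z in ball (0 : CN N) 1,
      ENNReal.ofReal (‖f z‖ ^ 2) * ENNReal.ofReal ((1 - ‖z‖ ^ 2) ^ α) ≤
        ENNReal.ofReal (M ^ 2) * ballWeight N α univ) :
    ∃ g : BergmanSpace N hα, (∀ z ∈ ball (0 : CN N) 1, g z = f z) ∧ ‖g‖ ≤ M := by
  set F := (ball (0 : CN N) 1).indicator f with hF
  have hFf : ∀ z ∈ ball (0 : CN N) 1, F z = f z := fun z hz => indicator_of_mem hz f
  have hFd : DifferentiableOn ℂ F (ball 0 1) := hf.congr hFf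
  have hB := ballWeight_univ_ne_zero (N := N) α
  have hB' := ballWeight_univ_ne_top (N := N) hα
  have h1 : ∫⁻ z, ENNReal.ofReal (‖F z‖ ^ 2) ∂(bergmanMeasure N α) ≤ ENNReal.ofReal (M ^ 2) := by
    rw [bergmanMeasure, lintegral_smul_measure, smul_eq_mul, lintegral_ballWeight,
      ENNReal.inv_mul_le_iff hB hB', mul_comm (ballWeight N α univ)]
    refine le_trans (le_of_eq ?_) h
    refine setLIntegral_congr_fun measurableSet_ball fun z hz => ?_
    simp only [hFf z hz]
  have hm : AEStronglyMeasurable (fun z => ‖F z‖ ^ 2) (bergmanMeasure N α) :=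
    (aestronglyMeasurable_bergman hFd α).norm.pow 2
  have h2 : Integrable (fun z => ‖F z‖ ^ 2) (bergmanMeasure N α) := by
    refine ⟨hm, ?_⟩
    rw [hasFiniteIntegral_iff_ofReal (Eventually.of_forall fun _ => sq_nonneg _)]
    exact h1.trans_lt ENNReal.ofReal_lt_top
  let g : BergmanSpace N hα := ⟨F, hFd, fun z hz => indicator_of_notMem hz f, h2⟩
  refine ⟨g, hFf, ?_⟩
  rw [← sq_le_sq₀ (norm_nonneg _) hM, BergmanSpace.norm_sq_eq]
  change ∫ z, ‖F z‖ ^ 2 ∂(bergmanMeasure N α) ≤ M ^ 2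
  rw [integral_eq_lintegral_of_nonneg_ae (Eventually.of_forall fun _ => sq_nonneg _) hm]
  exact ENNReal.toReal_le_of_le_ofReal (sq_nonneg M) h1

end BergmanIntegrals

/-! ### The Bergman spaces satisfy the axioms -/

section BergmanInstance

variable {N : ℕ} [NeZero N] {α : ℝ}

/-- The inclusion of `A²_α` in the functions on `ℂ^N`. -/
def BergmanSpace.evalMap (N : ℕ) [NeZero N] {α : ℝ} (hα : -1 < α) :
    BergmanSpace N hα →ₗ[ℂ] (CN N → ℂ) where
  toFun f := f
  map_add' _ _ := rfl
  map_smul' _ _ := rfl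

theorem measurable_radialWeight (α : ℝ) :
    Measurable fun r : ℝ => ENNReal.ofReal ((1 - r ^ 2) ^ α) := by fun_prop

/-- The exponent N + 1 + α is the one produced by the change of variables, so the weighted Möbius
compositions are isometric. The limit axiom is Fatou's lemma, and the bound at 0 integrates the
sub-mean value property over radii. -/
theorem BergmanSpace.isBallSpace (hα : -1 < α) :
    IsBallSpace N (N + 1 + α) (BergmanSpace.evalMap N hα) where
  differentiableOn f := f.mem.1
  eq_zero f h := BergmanSpace.ext fun z => by
    by_cases hz : z ∈ ball (0 : CN N) 1
    · exact h z hz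
    · exact f.mem.2.1 z hz
  norm_apply_zero_le f := by
    have h1 := le_setLIntegral_ball_of_le_hardyMean (f := f) f.mem.1.continuousOn
      (measurable_radialWeight α) (m := ‖f 0‖ ^ 2)
      fun r hr _ => norm_sq_zero_le_hardyMean f.mem.1 hr
    rw [f.setLIntegral_eq, ← ballWeight_univ, ENNReal.mul_le_mul_iff_left
      (ballWeight_univ_ne_zero α) (ballWeight_univ_ne_top hα),
      ENNReal.ofReal_le_ofReal_iff (sq_nonneg _)] at h1
    exact (sq_le_sq₀ (norm_nonneg _) (norm_nonneg _)).1 h1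
  exists_limit f g M hg hu hM := by
    have hM0 : 0 ≤ M := by
      obtain ⟨n, hn⟩ := hM.exists
      exact (norm_nonneg _).trans hn
    refine BergmanSpace.exists_of_setLIntegral_le hα hg hM0 ?_
    have hlim : ∀ z ∈ ball (0 : CN N) 1, Tendsto (fun n => f n z) atTop (𝓝 (g z)) := by
      intro z hz
      obtain ⟨r, hr1, hr2⟩ := exists_between (mem_ball_zero_iff.1 hz)
      exact (hu r hr2).tendsto_at (mem_ball_zero_iff.2 hr1)
    have h1 : ∫⁻ z in ball (0 : CN N) 1,
        ENNReal.ofReal (‖g z‖ ^ 2) * ENNReal.ofReal ((1 - ‖z‖ ^ 2) ^ α) =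
        ∫⁻ z in ball (0 : CN N) 1, liminf (fun n =>
          ENNReal.ofReal (‖f n z‖ ^ 2) * ENNReal.ofReal ((1 - ‖z‖ ^ 2) ^ α)) atTop := by
      refine setLIntegral_congr_fun measurableSet_ball fun z hz => ?_
      refine (Tendsto.liminf_eq ?_).symm
      exact ENNReal.Tendsto.mul_const (ENNReal.tendsto_ofReal ((hlim z hz).norm.pow 2))
        (Or.inr ENNReal.ofReal_ne_top)
    rw [h1]
    refine (lintegral_liminf_le' fun n => ?_).trans ?_
    · refine AEMeasurable.mul ?_ (measurable_weight α).aemeasurable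
      exact ((((f n).mem.1.continuousOn.aestronglyMeasurable measurableSet_ball).norm.pow
        2).aemeasurable).ennreal_ofReal
    · refine liminf_le_of_frequently_le' (Eventually.frequently ?_)
      filter_upwards [hM] with n hn
      rw [(f n).setLIntegral_eq]
      gcongr
  exists_mul W M hW hWM f := by
    have hM0 : 0 ≤ M := (norm_nonneg _).trans (hWM 0 (by simp))
    refine BergmanSpace.exists_of_setLIntegral_le hα (f := fun z => W z * f z) (hW.mul f.mem.1)
      (mul_nonneg hM0 (norm_nonneg f)) ?_
    rw [mul_pow, ENNReal.ofReal_mul (sq_nonneg M), mul_assoc, ← f.setLIntegral_eq,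
      ← lintegral_const_mul' _ _ ENNReal.ofReal_ne_top]
    refine setLIntegral_mono' measurableSet_ball fun z hz => ?_
    rw [norm_mul, mul_pow, ENNReal.ofReal_mul (sq_nonneg _), mul_assoc]
    gcongr
    exact hWM z hz
  exists_moebius c hc f := by
    refine BergmanSpace.exists_of_setLIntegral_le hα
      (f := fun z => moebiusWeight (N + 1 + α) c z * f (moebius c z)) ?_ (norm_nonneg f) ?_
    · refine DifferentiableOn.mul (fun z hz => ?_)
        (f.mem.1.comp (differentiableOn_moebius hc) (mapsTo_moebius hc))
      exact (differentiableAt_moebiusWeight hc (norm_mul_norm_lt_one hc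
        (mem_ball_zero_iff.1 hz).le)).differentiableWithinAt
    · rw [← f.setLIntegral_eq, setLIntegral_moebius_weight hc α (g := fun z => ‖f z‖ ^ 2) (fun z => sq_nonneg _)]
      refine le_of_eq (setLIntegral_congr_fun measurableSet_ball fun z hz => ?_)
      have := defect_pos hc
      rw [norm_mul, mul_pow, norm_moebiusWeight hc, ← Real.rpow_mul_natCast (by positivity),
        Nat.cast_two, mul_comm ((N : ℝ) + 1 + α)]
  exists_isometry V f := by
    refine BergmanSpace.exists_of_setLIntegral_le hα (f := fun z => f (V z)) ?_ (norm_nonneg f) ?_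
    · refine f.mem.1.comp V.differentiable.differentiableOn fun z hz => ?_
      simpa using hz
    · rw [← f.setLIntegral_eq, ← setLIntegral_isometry V (fun z =>
        ENNReal.ofReal (‖f z‖ ^ 2) * ENNReal.ofReal ((1 - ‖z‖ ^ 2) ^ α))]
      simp only [V.norm_map, le_refl]
  exists_one := by
    obtain ⟨g, hg, -⟩ := BergmanSpace.exists_of_setLIntegral_le (N := N) hα (f := fun _ => 1)
      (differentiableOn_const _) (M := 1) zero_le_one (by rw [ballWeight_univ]; simp)
    exact ⟨g, hg⟩

end BergmanInstance

/-! ### Hardy means as limits of Bergman integrals as α → -1 -/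

section Mass

variable {N : ℕ} [NeZero N]

theorem setLIntegral_volumeIoiPow (n : ℕ) {G : ℝ → ℝ≥0∞} (hG : Measurable G) :
    ∫⁻ r : Ioi (0 : ℝ) in {r | (r : ℝ) < 1}, G r ∂(Measure.volumeIoiPow n) =
      ∫⁻ r in Ioo (0 : ℝ) 1, ENNReal.ofReal (r ^ n) * G r := by
  have hms : MeasurableSet {r : Ioi (0 : ℝ) | (r : ℝ) < 1} :=
    measurableSet_lt measurable_subtype_coe measurable_const
  have himg : Subtype.val '' {r : Ioi (0 : ℝ) | (r : ℝ) < 1} = Ioo (0 : ℝ) 1 := by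
    ext x
    simp [and_comm]
  rw [Measure.volumeIoiPow, restrict_withDensity hms,
    lintegral_withDensity_eq_lintegral_mul _ (by fun_prop)
      (show Measurable fun r : Ioi (0 : ℝ) => G r from hG.comp measurable_subtype_coe)]
  simp only [Pi.mul_apply]
  rw [setLIntegral_subtype measurableSet_Ioi _ fun a : ℝ => ENNReal.ofReal (a ^ n) * G a, himg]

theorem lintegral_one_sub_rpow {α : ℝ} (hα : -1 < α) :
    ∫⁻ r in Ioo (1 / 2 : ℝ) 1, ENNReal.ofReal ((1 - r) ^ α) =
      ENNReal.ofReal ((1 / 2) ^ (α + 1) / (α + 1)) := by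
  have hi : IntervalIntegrable (fun r : ℝ => (1 - r) ^ α) volume (1 / 2) 1 := by
    have h := (intervalIntegral.intervalIntegrable_rpow' (a := 1 / 2) (b := 0) hα).comp_sub_left 1
    norm_num at h
    exact h
  rw [restrict_Ioo_eq_restrict_Ioc, ← ofReal_integral_eq_lintegral_ofReal hi.1,
    ← intervalIntegral.integral_of_le (by norm_num),
    intervalIntegral.integral_comp_sub_left (fun x : ℝ => x ^ α) 1, integral_rpow (Or.inl hα)]
  · rw [sub_self, Real.zero_rpow (by linarith)]
    norm_num
  · filter_upwards [ae_restrict_mem measurableSet_Ioc] with r hr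
    exact Real.rpow_nonneg (by linarith [hr.2]) _

/-- The total mass of the weight `(1 - |z|²)^α` grows like `1 / (1 + α)` as `α → -1`. -/
theorem exists_le_ballWeight_univ : ∃ c : ℝ, 0 < c ∧ ∀ α ∈ Ioo (-1 : ℝ) 0,
    c / (1 + α) ≤ (ballWeight N α univ).toReal := by
  set n := Module.finrank ℝ (CN N) - 1 with hn
  set σ := (volume : Measure (CN N)).toSphere univ with hσ
  have hσt : σ ≠ ∞ := measure_ne_top _ _
  have hσ0 : 0 < σ.toReal := ENNReal.toReal_pos toSphere_univ_ne_zero hσt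
  -- Only radii r > 1/2 are kept: (1/2)^n bounds r^n, the first factor 1/2 bounds (1 + r)^α, and the
  -- last one bounds (1/2)^(α+1) in the integral of (1 - r)^α.
  refine ⟨((1 / 2) ^ n / 2) * σ.toReal * (1 / 2), by positivity, fun α hα => ?_⟩
  rw [← ENNReal.ofReal_le_iff_le_toReal (ballWeight_univ_ne_top hα.1), ballWeight_univ]
  have h1 := setLIntegral_ball_eq_hardyMean (f := fun _ : CN N => (1 : ℂ)) continuousOn_const
    (measurable_radialWeight α)
  simp only [norm_one, one_pow, ENNReal.ofReal_one, one_mul, hardyMean_one] at h1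
  rw [h1, setLIntegral_volumeIoiPow n (G := fun r => ENNReal.ofReal ((1 - r ^ 2) ^ α) * σ)
    (by fun_prop)]
  have hpos : 0 < α + 1 := by linarith [hα.1]
  calc ENNReal.ofReal ((1 / 2) ^ n / 2 * σ.toReal * (1 / 2) / (1 + α))
      ≤ ENNReal.ofReal ((1 / 2) ^ n / 2 * σ.toReal) *
          ENNReal.ofReal ((1 / 2) ^ (α + 1) / (α + 1)) := by
        rw [← ENNReal.ofReal_mul (by positivity), mul_div_assoc, add_comm 1 α]
        gcongr
        have := Real.rpow_le_rpow_of_exponent_ge (x := 1 / 2) (y := 1) (z := α + 1)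
          (by norm_num) (by norm_num) (by linarith [hα.2])
        rwa [Real.rpow_one] at this
    _ = ∫⁻ r in Ioo (1 / 2 : ℝ) 1, ENNReal.ofReal ((1 / 2) ^ n / 2 * σ.toReal) *
          ENNReal.ofReal ((1 - r) ^ α) := by
        rw [lintegral_const_mul _ (by fun_prop), lintegral_one_sub_rpow hα.1]
    _ ≤ ∫⁻ r in Ioo (1 / 2 : ℝ) 1, ENNReal.ofReal (r ^ n) *
          (ENNReal.ofReal ((1 - r ^ 2) ^ α) * σ) := by
        refine setLIntegral_mono' measurableSet_Ioo fun r hr => ?_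
        have hr0 : 0 < 1 - r := by linarith [hr.2]
        have hr1 : 0 < r := by linarith [hr.1]
        have e1 : (1 / 2 : ℝ) ≤ (1 + r) ^ α := by
          calc (1 / 2 : ℝ) = 2 ^ (-1 : ℝ) := by rw [Real.rpow_neg_one]; norm_num
            _ ≤ 2 ^ α := Real.rpow_le_rpow_of_exponent_le (by norm_num) hα.1.le
            _ ≤ (1 + r) ^ α := Real.rpow_le_rpow_of_nonpos (by linarith) (by linarith [hr.2]) hα.2.le
        have e2 : (1 - r ^ 2) ^ α = (1 + r) ^ α * (1 - r) ^ α := by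
          rw [← Real.mul_rpow (by linarith) hr0.le]; ring_nf
        have e3 : (1 / 2 : ℝ) ^ n ≤ r ^ n := pow_le_pow_left₀ (by norm_num) hr.1.le n
        have e4 : 0 ≤ (1 - r) ^ α := Real.rpow_nonneg hr0.le _
        have e5 : ENNReal.ofReal (r ^ n) * (ENNReal.ofReal ((1 - r ^ 2) ^ α) * σ) =
            ENNReal.ofReal (r ^ n * ((1 + r) ^ α * (1 - r) ^ α * σ.toReal)) := by
          rw [ENNReal.ofReal_mul (by positivity), ENNReal.ofReal_mul (by positivity),
            ENNReal.ofReal_toReal hσt, e2]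
        rw [e5, ← ENNReal.ofReal_mul (by positivity)]
        apply ENNReal.ofReal_le_ofReal
        calc (1 / 2) ^ n / 2 * σ.toReal * (1 - r) ^ α
            = (1 / 2) ^ n * ((1 / 2) * (1 - r) ^ α * σ.toReal) := by ring
          _ ≤ r ^ n * ((1 + r) ^ α * (1 - r) ^ α * σ.toReal) := by gcongr
    _ ≤ _ := lintegral_mono_set (Ioo_subset_Ioo (by norm_num) le_rfl)

/-- A bound for the means over spheres from bounds for the integrals against the weights
`(1 - |z|²)^α` as `α → -1`. -/
theorem hardyMean_le_of_setLIntegral_le {f : CN N → ℂ} (hf : DifferentiableOn ℂ f (ball 0 1))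
    {M B : ℝ} (hM : 0 ≤ M) (hB : 0 < B)
    (h : ∀ α ∈ Ioo (-1 : ℝ) 0, ∫⁻ z in ball (0 : CN N) 1,
      ENNReal.ofReal (‖f z‖ ^ 2) * ENNReal.ofReal ((1 - ‖z‖ ^ 2) ^ α) ≤
        ENNReal.ofReal (M * B ^ (1 + α)) * ballWeight N α univ) {r : ℝ} (hr : r ∈ Ioo (0 : ℝ) 1) :
    hardyMean f r ≤ M := by
  obtain ⟨c, hc, hcB⟩ := exists_le_ballWeight_univ (N := N)
  set m := hardyMean f r with hm
  have hm0 : 0 ≤ m := hardyMean_nonneg _ _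
  set Q := ((1 - r ^ 2)⁻¹ * (volume (ball (0 : CN N) 1)).toReal) with hQ
  have hr2 : 0 < 1 - r ^ 2 := by nlinarith [hr.1, hr.2]
  have hQ0 : 0 ≤ Q := by positivity
  -- With t = 1 + α, the total mass is at least c/t, whereas the mass of |z| < r stays below Q.
  -- Outside that ball the means are at least m, so the integral bound gives m up to a relative
  -- error Qt/c, and t → 0 finishes.
  have key : ∀ t ∈ Ioo (0 : ℝ) 1, m ≤ M * B ^ t + m * Q * t / c := by
    intro t ht
    set α := t - 1 with hαdef
    have hα : α ∈ Ioo (-1 : ℝ) 0 := ⟨by linarith [ht.1], by linarith [ht.2]⟩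
    have htα : 1 + α = t := by rw [hαdef]; ring
    have hBt := ballWeight_univ_ne_top (N := N) hα.1
    set β := (ballWeight N α univ).toReal with hβ
    -- The weight is cut off to radii at least r, where monotonicity bounds the means below by m.
    set w : ℝ → ℝ≥0∞ := (Ici r).indicator fun r => ENNReal.ofReal ((1 - r ^ 2) ^ α) with hw
    have hwm : Measurable w := (measurable_radialWeight α).indicator measurableSet_Ici
    have h1 := le_setLIntegral_ball_of_le_hardyMean hf.continuousOn hwm (m := m)
      (fun s hs hws => by
        refine hardyMean_mono hf hr hs ?_
        by_contra hlt
        exact hws (indicator_of_notMem hlt _))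
    have h2 : ∫⁻ z in ball (0 : CN N) 1, ENNReal.ofReal (‖f z‖ ^ 2) * w ‖z‖ ≤
        ENNReal.ofReal (M * B ^ t) * ballWeight N α univ := by
      rw [← htα]
      refine le_trans ?_ (h α hα)
      refine lintegral_mono fun z => ?_
      gcongr
      exact indicator_le_self _ _ _
    have h3 : ballWeight N α univ ≤ (∫⁻ z in ball (0 : CN N) 1, w ‖z‖) + ENNReal.ofReal Q := by
      have e : ENNReal.ofReal Q =
          ∫⁻ z in ball (0 : CN N) 1, ENNReal.ofReal ((1 - r ^ 2)⁻¹) := by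
        rw [setLIntegral_const, hQ, ENNReal.ofReal_mul (by positivity),
          ENNReal.ofReal_toReal measure_ball_lt_top.ne]
      rw [e, ← lintegral_add_right _ measurable_const, ballWeight_univ]
      refine setLIntegral_mono' measurableSet_ball fun z hz => ?_
      by_cases hzr : r ≤ ‖z‖
      · rw [hw, indicator_of_mem (by exact hzr)]
        exact le_self_add
      · rw [hw, indicator_of_notMem (by exact hzr), zero_add]
        apply ENNReal.ofReal_le_ofReal
        push Not at hzr
        have hz2 : 1 - r ^ 2 ≤ 1 - ‖z‖ ^ 2 := by
          have := norm_nonneg z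
          nlinarith
        calc (1 - ‖z‖ ^ 2) ^ α ≤ (1 - r ^ 2) ^ α :=
              Real.rpow_le_rpow_of_nonpos hr2 hz2 hα.2.le
          _ ≤ (1 - r ^ 2) ^ (-1 : ℝ) := Real.rpow_le_rpow_of_exponent_ge hr2
              (by nlinarith [hr.1]) hα.1.le
          _ = (1 - r ^ 2)⁻¹ := Real.rpow_neg_one _
    have h4 : ENNReal.ofReal m * ballWeight N α univ ≤
        ENNReal.ofReal (M * B ^ t) * ballWeight N α univ + ENNReal.ofReal (m * Q) := by
      calc ENNReal.ofReal m * ballWeight N α univ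
          ≤ ENNReal.ofReal m * ((∫⁻ z in ball (0 : CN N) 1, w ‖z‖) + ENNReal.ofReal Q) := by
            gcongr
        _ = ENNReal.ofReal m * (∫⁻ z in ball (0 : CN N) 1, w ‖z‖) +
            ENNReal.ofReal (m * Q) := by rw [mul_add, ENNReal.ofReal_mul hm0]
        _ ≤ _ := add_le_add (h1.trans h2) le_rfl
    have hβ' : ballWeight N α univ = ENNReal.ofReal β := (ENNReal.ofReal_toReal hBt).symm
    have hβ0 : 0 ≤ β := ENNReal.toReal_nonneg
    rw [hβ', ← ENNReal.ofReal_mul hm0, ← ENNReal.ofReal_mul (by positivity),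
      ← ENNReal.ofReal_add (by positivity) (by positivity),
      ENNReal.ofReal_le_ofReal_iff (by positivity)] at h4
    have h5 := hcB α hα
    rw [htα, ← hβ] at h5
    have hcβ : c ≤ β * t := (div_le_iff₀ ht.1).1 h5
    have hβpos : 0 < β := by
      by_contra hneg
      have : β = 0 := le_antisymm (not_lt.1 hneg) hβ0
      rw [this, zero_mul] at hcβ
      linarith
    have h6 : m * Q ≤ m * Q * t / c * β := by
      rw [div_mul_eq_mul_div, le_div_iff₀ hc]
      have : 0 ≤ m * Q := by positivity
      nlinarith
    have h7 : m * β ≤ (M * B ^ t + m * Q * t / c) * β := by linarith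
    exact le_of_mul_le_mul_right h7 hβpos
  have hlim : Tendsto (fun t : ℝ => M * B ^ t + m * Q * t / c) (𝓝[>] 0) (𝓝 M) := by
    have hcont : ContinuousAt (fun t : ℝ => M * B ^ t + m * Q * t / c) 0 := by
      have : ContinuousAt (fun t : ℝ => B ^ t) 0 := Real.continuousAt_const_rpow hB.ne'
      fun_prop
    have := hcont.tendsto.mono_left (nhdsWithin_le_nhds (s := Ioi 0))
    simpa using this
  refine ge_of_tendsto hlim ?_
  filter_upwards [Ioo_mem_nhdsGT (zero_lt_one' ℝ)] with t ht using key t ht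

end Mass

/-! ### The Hardy space satisfies the axioms -/

section HardyInstance

variable {N : ℕ} [NeZero N]

theorem HardySpace.hardyMean_le (f : HardySpace N) {r : ℝ} (hr : r ∈ Ioo (0 : ℝ) 1) :
    hardyMean f r ≤ ‖f‖ ^ 2 := by
  rw [f.norm_sq_eq]
  exact f.mean_le_sSup hr

theorem HardySpace.exists_of_hardyMean_le {f : CN N → ℂ}
    (hf : DifferentiableOn ℂ f (ball 0 1)) {M : ℝ} (hM : 0 ≤ M)
    (h : ∀ r ∈ Ioo (0 : ℝ) 1, hardyMean f r ≤ M ^ 2) :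
    ∃ g : HardySpace N, (∀ z ∈ ball (0 : CN N) 1, g z = f z) ∧ ‖g‖ ≤ M := by
  set F := (ball (0 : CN N) 1).indicator f with hF
  have hFf : ∀ z ∈ ball (0 : CN N) 1, F z = f z := fun z hz => indicator_of_mem hz f
  have hFd : DifferentiableOn ℂ F (ball 0 1) := hf.congr hFf
  have hmean : ∀ r ∈ Ioo (0 : ℝ) 1, hardyMean F r = hardyMean f r := by
    intro r hr
    simp only [hardyMean, hFf _ (rsmul_mem_ball hr _)]
  have hub : M ^ 2 ∈ upperBounds (hardyMean F '' Ioo 0 1) := by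
    rintro _ ⟨r, hr, rfl⟩
    rw [hmean r hr]
    exact h r hr
  let g : HardySpace N := ⟨F, hFd, fun z hz => indicator_of_notMem hz f, M ^ 2, hub⟩
  refine ⟨g, hFf, ?_⟩
  rw [← sq_le_sq₀ (norm_nonneg _) hM, HardySpace.norm_sq_eq]
  exact csSup_le ⟨_, mem_image_of_mem _ (⟨by norm_num, by norm_num⟩ : (1 / 2 : ℝ) ∈ Ioo (0 : ℝ) 1)⟩
    hub

/-- The inclusion of `H²` in the functions on `ℂ^N`. -/
def HardySpace.evalMap (N : ℕ) [NeZero N] : HardySpace N →ₗ[ℂ] (CN N → ℂ) where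
  toFun f := f
  map_add' _ _ := rfl
  map_smul' _ _ := rfl

theorem HardySpace.setLIntegral_le (f : HardySpace N) (α : ℝ) :
    ∫⁻ z in ball (0 : CN N) 1, ENNReal.ofReal (‖f z‖ ^ 2) * ENNReal.ofReal ((1 - ‖z‖ ^ 2) ^ α) ≤
      ENNReal.ofReal (‖f‖ ^ 2) * ballWeight N α univ := by
  rw [ballWeight_univ]
  exact setLIntegral_ball_le_of_hardyMean_le f.mem.1.continuousOn (measurable_radialWeight α)
    fun r hr => f.hardyMean_le hr

/-- Changes of variables are made in volume integrals, not on spheres: the two composition axioms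
are obtained from the weights (1 - |z|²)^α by letting α → -1, which turns the exponent N + 1 + α
into N. -/
theorem HardySpace.isBallSpace : IsBallSpace N N (HardySpace.evalMap N) where
  differentiableOn f := f.mem.1
  eq_zero f h := HardySpace.ext fun z => by
    by_cases hz : z ∈ ball (0 : CN N) 1
    · exact h z hz
    · exact f.mem.2.1 z hz
  norm_apply_zero_le f := by
    have hr : (1 / 2 : ℝ) ∈ Ioo (0 : ℝ) 1 := ⟨by norm_num, by norm_num⟩
    exact (sq_le_sq₀ (norm_nonneg _) (norm_nonneg _)).1
      ((norm_sq_zero_le_hardyMean f.mem.1 hr).trans (f.hardyMean_le hr))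
  exists_limit f g M hg hu hM := by
    have hM0 : 0 ≤ M := by
      obtain ⟨n, hn⟩ := hM.exists
      exact (norm_nonneg _).trans hn
    refine HardySpace.exists_of_hardyMean_le hg hM0 fun r hr => ?_
    have hU : TendstoUniformly (fun n (ζ : sphere (0 : CN N) 1) => f n (r • (ζ : CN N)))
        (fun ζ => g (r • (ζ : CN N))) atTop := by
      obtain ⟨s, hs1, hs2⟩ := exists_between hr.2
      rw [Metric.tendstoUniformly_iff]
      intro ε hε
      filter_upwards [Metric.tendstoUniformlyOn_iff.1 (hu s hs2) ε hε] with n hn ζ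
      refine hn _ ?_
      rw [mem_ball_zero_iff, norm_smul, Real.norm_of_nonneg hr.1.le]
      simpa using hs1
    have hlim : Tendsto (fun n => hardyMean (f n) r) atTop (𝓝 (hardyMean g r)) := by
      obtain ⟨C, hC⟩ := (isCompact_range
        (continuous_dilate hg.continuousOn hr)).isBounded.exists_norm_le
      have hC0 : 0 ≤ C := (norm_nonneg _).trans (hC _ (mem_range_self
        (Classical.choice (NormedSpace.sphere_nonempty (E := CN N) (x := 0) (r := 1)
          |>.2 zero_le_one).to_subtype)))
      refine tendsto_integral_filter_of_dominated_convergence (fun _ => (C + 1) ^ 2) ?_ ?_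
        (integrable_const _) ?_
      · exact Eventually.of_forall fun n => ((continuous_dilate (f n).mem.1.continuousOn hr).norm.pow
          2).aestronglyMeasurable
      · filter_upwards [Metric.tendstoUniformly_iff.1 hU 1 one_pos] with n hn
        refine Eventually.of_forall fun ζ => ?_
        rw [Real.norm_of_nonneg (sq_nonneg _)]
        have h1 := hn ζ
        have h2 := hC _ (mem_range_self ζ)
        rw [dist_comm, dist_eq_norm] at h1
        have h3 := norm_le_norm_add_norm_sub' (f n (r • (ζ : CN N))) (g (r • (ζ : CN N)))
        gcongr
        linarith
      · exact Eventually.of_forall fun ζ => (hU.tendsto_at ζ).norm.pow 2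
    refine le_of_tendsto hlim ?_
    filter_upwards [hM] with n hn
    exact ((f n).hardyMean_le hr).trans (by gcongr)
  exists_mul W M hW hWM f := by
    have hM0 : 0 ≤ M := (norm_nonneg _).trans (hWM 0 (by simp))
    refine HardySpace.exists_of_hardyMean_le (f := fun z => W z * f z) (hW.mul f.mem.1)
      (mul_nonneg hM0 (norm_nonneg f)) fun r hr => ?_
    rw [mul_pow]
    refine le_trans ?_ (mul_le_mul_of_nonneg_left (f.hardyMean_le hr) (sq_nonneg M))
    rw [hardyMean, hardyMean, ← integral_const_mul]
    have hc1 := continuous_dilate hW.continuousOn hr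
    have hc2 := continuous_dilate f.mem.1.continuousOn hr
    refine integral_mono (integrable_of_continuous ((hc1.mul hc2).norm.pow 2))
      (integrable_of_continuous (continuous_const.mul (hc2.norm.pow 2))) fun ζ => ?_
    simp only
    rw [norm_mul, mul_pow]
    gcongr
    exact hWM _ (rsmul_mem_ball hr ζ)
  exists_moebius c hc f := by
    have hs := defect_pos hc
    have hFd : DifferentiableOn ℂ (fun z => moebiusWeight N c z * f (moebius c z)) (ball 0 1) := by
      refine DifferentiableOn.mul (fun z hz => ?_)
        (f.mem.1.comp (differentiableOn_moebius hc) (mapsTo_moebius hc))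
      exact (differentiableAt_moebiusWeight hc (norm_mul_norm_lt_one hc
        (mem_ball_zero_iff.1 hz).le)).differentiableWithinAt
    refine HardySpace.exists_of_hardyMean_le hFd (norm_nonneg f) fun r hr => ?_
    -- For α > -1 the weight with exponent N misses the factor q^(2(1+α)). Since q ≥ s/2, that
    -- factor is at least B^(-(1+α)), a loss that disappears as α → -1.
    refine hardyMean_le_of_setLIntegral_le hFd (sq_nonneg _) (B := (2 / defect c) ^ 2)
      (by positivity) (fun α hα => ?_) hr
    have ht : 0 < 1 + α := by linarith [hα.1]
    rw [mul_comm (‖f‖ ^ 2), ENNReal.ofReal_mul (by positivity), mul_assoc]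
    refine le_trans ?_ (mul_le_mul_right (f.setLIntegral_le α) _)
    rw [setLIntegral_moebius_weight hc α (g := fun z => ‖f z‖ ^ 2) (fun z => sq_nonneg _),
      ← lintegral_const_mul' _ _ ENNReal.ofReal_ne_top]
    refine setLIntegral_mono' measurableSet_ball fun z hz => ?_
    have hz1 : ‖z‖ < 1 := mem_ball_zero_iff.1 hz
    have hDn := norm_pos_iff.2 (one_sub_inner_ne_zero (norm_mul_norm_lt_one hc hz1.le))
    have hD2 : ‖(1 - inner ℂ c z : ℂ)‖ ≤ 2 := by
      have h1 := norm_sub_le (1 : ℂ) (inner ℂ c z)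
      have h2 := norm_inner_le_norm (𝕜 := ℂ) c z
      have h3 := norm_mul_norm_lt_one hc hz1.le
      rw [norm_one] at h1
      linarith
    set q := defect c / ‖(1 - inner ℂ c z : ℂ)‖ with hq
    have hq0 : 0 < q := by positivity
    rw [← mul_assoc, ← ENNReal.ofReal_mul (p := ((2 / defect c) ^ 2) ^ (1 + α)) (by positivity)]
    refine mul_le_mul_left (ENNReal.ofReal_le_ofReal ?_) _
    rw [norm_mul, mul_pow, norm_moebiusWeight hc, ← hq, ← mul_assoc]
    gcongr
    have h1 : q ^ (2 * ((N : ℝ) + 1 + α)) = (q ^ (N : ℝ)) ^ 2 * (q ^ 2) ^ (1 + α) := by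
      rw [← Real.rpow_mul_natCast hq0.le, ← Real.rpow_natCast q 2, ← Real.rpow_mul hq0.le,
        ← Real.rpow_add hq0]
      congr 1
      push_cast
      ring
    have h2 : 1 ≤ ((2 / defect c) ^ 2) ^ (1 + α) * (q ^ 2) ^ (1 + α) := by
      rw [← Real.mul_rpow (by positivity) (by positivity), ← mul_pow]
      refine Real.one_le_rpow (one_le_pow₀ ?_) ht.le
      rw [hq, div_mul_div_comm, mul_comm, mul_div_mul_left _ _ hs.ne', le_div_iff₀ hDn]
      linarith
    rw [h1]
    have h3 : 0 ≤ (q ^ (N : ℝ)) ^ 2 := by positivity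
    nlinarith
  exists_isometry V f := by
    have hmaps : MapsTo V (ball (0 : CN N) 1) (ball 0 1) := fun z hz => by simpa using hz
    have hFd : DifferentiableOn ℂ (fun z => f (V z)) (ball 0 1) :=
      f.mem.1.comp V.differentiable.differentiableOn hmaps
    refine HardySpace.exists_of_hardyMean_le hFd (norm_nonneg f) fun r hr => ?_
    refine hardyMean_le_of_setLIntegral_le hFd (sq_nonneg _) (B := 1) one_pos (fun α _ => ?_) hr
    rw [Real.one_rpow, mul_one]
    refine le_trans (le_of_eq ?_) (f.setLIntegral_le α)
    rw [← setLIntegral_isometry V (fun z =>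
        ENNReal.ofReal (‖f z‖ ^ 2) * ENNReal.ofReal ((1 - ‖z‖ ^ 2) ^ α))]
    simp only [V.norm_map]
  exists_one := by
    obtain ⟨g, hg, -⟩ := HardySpace.exists_of_hardyMean_le (N := N) (f := fun _ => 1)
      (differentiableOn_const _) (M := 1) zero_le_one fun r _ => by simp [hardyMean_one]
    exact ⟨g, hg⟩

end HardyInstance

/-! ### Eigenvectors from bilateral orbit series -/

section Laurent

variable {E : Type*} [NormedAddCommGroup E] [NormedSpace ℂ E]

theorem integral_exp_int_mul {n : ℤ} (hn : n ≠ 0) :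
    ∫ θ in (0 : ℝ)..2 * Real.pi, Complex.exp ((-(n : ℂ) * Complex.I) * θ) = 0 := by
  have hc : -(n : ℂ) * Complex.I ≠ 0 :=
    mul_ne_zero (neg_ne_zero.2 (by exact_mod_cast hn)) Complex.I_ne_zero
  rw [integral_exp_mul_complex hc]
  have h1 : -(n : ℂ) * Complex.I * ((2 * Real.pi : ℝ) : ℂ) =
      ((-n : ℤ) : ℂ) * (2 * Real.pi * Complex.I) := by
    push_cast; ring
  rw [h1, Complex.exp_int_mul_two_pi_mul_I]
  simp

/-- A nonzero absolutely summable Laurent series does not vanish on the whole unit circle. -/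
theorem exists_tsum_exp_ne_zero [CompleteSpace E] {a : ℤ → E} (ha : Summable fun n => ‖a n‖)
    (h0 : a 0 ≠ 0) :
    ∃ θ : ℝ, ∑' n : ℤ, Complex.exp ((-(n : ℂ) * Complex.I) * θ) • a n ≠ 0 := by
  by_contra! h
  let F : ℤ → C(ℝ, E) := fun n =>
    ⟨fun θ => Complex.exp ((-(n : ℂ) * Complex.I) * θ) • a n, by fun_prop⟩
  have hnorm : ∀ (n : ℤ) (θ : ℝ), ‖F n θ‖ = ‖a n‖ := by
    intro n θ
    change ‖Complex.exp ((-(n : ℂ) * Complex.I) * θ) • a n‖ = ‖a n‖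
    rw [norm_smul, Complex.norm_exp]
    simp
  have hsum : Summable fun n => ‖(F n).restrict (TopologicalSpace.Compacts.mk (uIcc 0 (2 * Real.pi))
      isCompact_uIcc)‖ := by
    refine Summable.of_nonneg_of_le (fun _ => norm_nonneg _) (fun n => ?_) ha
    rw [ContinuousMap.norm_le _ (norm_nonneg _)]
    intro x
    exact (hnorm n x).le
  -- Integrating term by term over the circle isolates the zeroth coefficient.
  have h1 := intervalIntegral.hasSum_intervalIntegral_of_summable_norm hsum
  have h2 : ∀ n : ℤ, ∫ θ in (0 : ℝ)..2 * Real.pi, F n θ =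
      if n = 0 then ((2 * Real.pi : ℝ) : ℂ) • a 0 else 0 := by
    intro n
    change ∫ θ in (0 : ℝ)..2 * Real.pi, Complex.exp ((-(n : ℂ) * Complex.I) * θ) • a n = _
    rw [intervalIntegral.integral_smul_const]
    split_ifs with hn
    · subst hn
      simp
    · rw [integral_exp_int_mul hn, zero_smul]
  simp_rw [h2] at h1
  have h3 : ∫ θ in (0 : ℝ)..2 * Real.pi, ∑' n, F n θ = 0 := by
    have : ∀ θ : ℝ, ∑' n, F n θ = 0 := h
    simp [this]
  rw [h3] at h1
  have h4 := h1.unique (hasSum_ite_eq (0 : ℤ) (((2 * Real.pi : ℝ) : ℂ) • a 0))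
  have hpi : ((2 * Real.pi : ℝ) : ℂ) ≠ 0 := by
    exact_mod_cast (by positivity : (2 * Real.pi : ℝ) ≠ 0)
  exact (smul_ne_zero hpi h0) h4.symm

/-- If the forward and backward orbits of a vector under an invertible operator grow slowly, then
circles between the growth rates meet the point spectrum. -/
theorem exists_hasEigenvalue_of_orbit_bounds [CompleteSpace E] {T S : E →L[ℂ] E}
    (hTS : T * S = 1) (hST : S * T = 1) {g : E} (hg : g ≠ 0) {s r t C C' : ℝ} (hs : 0 ≤ s)
    (hsr : s < r) (ht : 0 ≤ t) (hrt : t < r⁻¹) (h1 : ∀ n : ℕ, ‖(T ^ n) g‖ ≤ C * s ^ n)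
    (h2 : ∀ n : ℕ, ‖(S ^ n) g‖ ≤ C' * t ^ n) :
    ∃ l : ℂ, ‖l‖ = r ∧ Module.End.HasEigenvalue (T : E →ₗ[ℂ] E) l := by
  have hr : 0 < r := hs.trans_lt hsr
  have hrc : (r : ℂ) ≠ 0 := by exact_mod_cast hr.ne'
  let u : (E →L[ℂ] E)ˣ := ⟨T, S, hTS, hST⟩
  -- The eigenvector sought is ∑ λ^(-n) T^n g with |λ| = r. The two growth bounds make both halves
  -- geometric, and the zeroth coefficient is g ≠ 0, so the sum is nonzero for some argument of λ.
  let a : ℤ → E := fun n => ((r : ℂ) ^ (-n)) • ((u ^ n : (E →L[ℂ] E)ˣ) : E →L[ℂ] E) g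
  have ha : Summable fun n => ‖a n‖ := by
    refine Summable.of_nat_of_neg ?_ ?_
    · refine Summable.of_nonneg_of_le (fun _ => norm_nonneg _) (fun n => ?_)
        ((summable_geometric_of_lt_one (r := s / r) (by positivity)
          ((div_lt_one hr).2 hsr)).mul_left C)
      have e : a n = ((r : ℂ) ^ n)⁻¹ • (T ^ n) g := by
        simp only [a, zpow_neg, zpow_natCast, Units.val_pow_eq_pow_val, u]
      rw [e, norm_smul, norm_inv, norm_pow, Complex.norm_real, Real.norm_of_nonneg hr.le, div_pow,
        ← div_eq_inv_mul, ← mul_div_assoc]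
      gcongr
      exact h1 n
    · refine Summable.of_nonneg_of_le (fun _ => norm_nonneg _) (fun n => ?_)
        ((summable_geometric_of_lt_one (r := r * t) (by positivity) (by
          rwa [← one_div, lt_div_iff₀' hr] at hrt)).mul_left C')
      have e : a (-(n : ℤ)) = ((r : ℂ) ^ n) • (S ^ n) g := by
        have e1 : ((u ^ (-(n : ℤ)) : (E →L[ℂ] E)ˣ) : E →L[ℂ] E) = S ^ n := by
          rw [zpow_neg, zpow_natCast, ← inv_pow, Units.val_pow_eq_pow_val]
          rfl
        simp only [a, neg_neg, zpow_natCast, e1]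
      rw [e, norm_smul, norm_pow, Complex.norm_real, Real.norm_of_nonneg hr.le, mul_pow]
      have := h2 n
      have hrn : 0 ≤ r ^ n := by positivity
      nlinarith
  have ha0 : a 0 ≠ 0 := by simpa [a] using hg
  obtain ⟨θ, hθ⟩ := exists_tsum_exp_ne_zero ha ha0
  set f := ∑' n : ℤ, Complex.exp ((-(n : ℂ) * Complex.I) * θ) • a n with hf
  have hsum : Summable fun n : ℤ => Complex.exp ((-(n : ℂ) * Complex.I) * θ) • a n := by
    refine Summable.of_norm (ha.congr fun n => ?_)
    rw [norm_smul (Complex.exp _), Complex.norm_exp]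
    simp
  have hTa : ∀ n, T (a n) = (r : ℂ) • a (n + 1) := by
    intro n
    simp only [a, map_smul, smul_smul]
    have e1 : T (((u ^ n : (E →L[ℂ] E)ˣ) : E →L[ℂ] E) g) =
        ((u ^ (n + 1) : (E →L[ℂ] E)ˣ) : E →L[ℂ] E) g := by
      rw [add_comm, zpow_add, zpow_one, Units.val_mul]
      rfl
    rw [e1]
    congr 1
    rw [neg_add, zpow_add₀ hrc, zpow_neg_one]
    field_simp
  refine ⟨(r : ℂ) * Complex.exp (Complex.I * θ), ?_, ?_⟩
  · rw [norm_mul, Complex.norm_real, Real.norm_of_nonneg hr.le, Complex.norm_exp]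
    simp
  · refine Module.End.hasEigenvalue_of_hasEigenvector (x := f)
      ⟨Module.End.mem_eigenspace_iff.2 ?_, hθ⟩
    change T f = _
    -- Applying T shifts the orbit by one, so the series of the multiple λf is reindexed to match.
    rw [hf, T.map_tsum hsum, ← tsum_const_smul'', ← (Equiv.addRight (1 : ℤ)).tsum_eq
      fun n => ((r : ℂ) * Complex.exp (Complex.I * θ)) •
        Complex.exp ((-(n : ℂ) * Complex.I) * θ) • a n]
    refine tsum_congr fun n => ?_
    rw [map_smul, hTa]
    simp only [Equiv.coe_addRight, smul_smul]
    congr 1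
    push_cast
    rw [mul_assoc (r : ℂ), ← Complex.exp_add, mul_comm]
    congr 2
    ring

end Laurent

/-! ### Products along orbits -/

section Cocycle

variable {X : Type*} {Ω : Set X} {φ : X → X} {W ℓ : X → ℝ} {τ M μ : ℝ}

/-- Growth of the products of a function along the orbits of a map with a Lyapunov function. -/
theorem exists_prod_iterate_le (hφ : MapsTo φ Ω Ω) (hℓ : ∀ z ∈ Ω, ℓ (φ z) = ℓ z + τ)
    (hτ : 0 < τ) (hμ : 0 < μ) (hW0 : ∀ z, 0 ≤ W z) (hWM : ∀ z ∈ Ω, W z ≤ M) :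
    ∃ c : ℝ, 0 ≤ c ∧ ∀ k : ℝ → ℝ, Monotone k →
      (∀ z ∈ Ω, W z ≤ μ ∨ k (ℓ z + τ) = k (ℓ z) + τ) → ∀ (n : ℕ), ∀ z ∈ Ω,
      ∏ j ∈ Finset.range n, W (φ^[j] z) ≤ μ ^ n * Real.exp (c * (k (ℓ (φ^[n] z)) - k (ℓ z))) := by
  -- The factor e^(cτ) is the most by which W can exceed μ, and it is paid for by a rise of k by τ.
  -- Thus k counts the steps at which W may be large; c does not depend on k, and the maximum with μ
  -- keeps it nonnegative.
  set c := Real.log (max M μ / μ) / τ with hc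
  have hq : 1 ≤ max M μ / μ := (one_le_div hμ).2 (le_max_right _ _)
  have hc0 : 0 ≤ c := div_nonneg (Real.log_nonneg hq) hτ.le
  have hcM : M ≤ μ * Real.exp (c * τ) := by
    rw [hc, div_mul_cancel₀ _ hτ.ne', Real.exp_log (by linarith), mul_div_cancel₀ _ hμ.ne']
    exact le_max_left _ _
  refine ⟨c, hc0, fun k hk hkW n => ?_⟩
  have hstep : ∀ z ∈ Ω, W z ≤ μ * Real.exp (c * (k (ℓ (φ z)) - k (ℓ z))) := by
    intro z hz
    rw [hℓ z hz]
    rcases hkW z hz with h | h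
    · refine h.trans (le_mul_of_one_le_right hμ.le (Real.one_le_exp (mul_nonneg hc0 ?_)))
      linarith [hk (show ℓ z ≤ ℓ z + τ by linarith)]
    · rw [h, add_sub_cancel_left]
      exact (hWM z hz).trans hcM
  induction n with
  | zero => intro z _; simp
  | succ n ih =>
    intro z hz
    rw [Finset.prod_range_succ']
    have h1 := ih (φ z) (hφ hz)
    have h2 := hstep z hz
    simp only [Function.iterate_succ_apply, Function.iterate_zero, id_eq]
    calc (∏ j ∈ Finset.range n, W (φ^[j] (φ z))) * W z
        ≤ (μ ^ n * Real.exp (c * (k (ℓ (φ^[n] (φ z))) - k (ℓ (φ z))))) *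
          (μ * Real.exp (c * (k (ℓ (φ z)) - k (ℓ z)))) :=
          mul_le_mul h1 h2 (hW0 z) (by positivity)
      _ = μ ^ (n + 1) * (Real.exp (c * (k (ℓ (φ^[n] (φ z))) - k (ℓ (φ z)))) *
          Real.exp (c * (k (ℓ (φ z)) - k (ℓ z)))) := by ring
      _ = _ := by rw [← Real.exp_add]; ring_nf

end Cocycle

/-! ### Growth of powers of weighted composition operators -/

section Operators

variable {N : ℕ} {p : ℝ} {H : Type*} [NormedAddCommGroup H] [InnerProductSpace ℂ H]
  {ev : H →ₗ[ℂ] (CN N → ℂ)}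

/-- `T` is the weighted composition operator `f ↦ w · (f ∘ φ)`. -/
def IsWeightedComp (ev : H →ₗ[ℂ] (CN N → ℂ)) (w : CN N → ℂ) (φ : CN N → CN N)
    (T : H →L[ℂ] H) : Prop :=
  ∀ f, ∀ z ∈ ball (0 : CN N) 1, ev (T f) z = w z * ev f (φ z)

namespace IsBallSpace

theorem exists_isWeightedComp (hH : IsBallSpace N p ev) {w : CN N → ℂ} {φ : CN N → CN N} {C : ℝ}
    (h : ∀ f, ∃ g, (∀ z ∈ ball (0 : CN N) 1, ev g z = w z * ev f (φ z)) ∧ ‖g‖ ≤ C * ‖f‖) :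
    ∃ T : H →L[ℂ] H, IsWeightedComp ev w φ T ∧ ∀ f, ‖T f‖ ≤ C * ‖f‖ := by
  choose t ht htn using h
  let L : H →ₗ[ℂ] H :=
    { toFun := t
      map_add' := fun f g => hH.ext fun z hz => by
        rw [ht _ z hz, map_add, map_add, Pi.add_apply, Pi.add_apply, ht _ z hz, ht _ z hz, mul_add]
      map_smul' := fun a f => hH.ext fun z hz => by
        rw [ht _ z hz, RingHom.id_apply, map_smul, map_smul, Pi.smul_apply, Pi.smul_apply,
          ht _ z hz, smul_eq_mul, smul_eq_mul]
        ring }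
  exact ⟨L.mkContinuous C htn, ht, htn⟩

theorem exists_multiplication (hH : IsBallSpace N p ev) {w : CN N → ℂ} {M : ℝ}
    (hw : DifferentiableOn ℂ w (ball 0 1)) (hM : ∀ z ∈ ball (0 : CN N) 1, ‖w z‖ ≤ M) :
    ∃ T : H →L[ℂ] H, IsWeightedComp ev w id T ∧ ∀ f, ‖T f‖ ≤ M * ‖f‖ :=
  hH.exists_isWeightedComp fun f => hH.exists_mul w M hw hM f

theorem exists_moebius_isometry (hH : IsBallSpace N p ev) {c : CN N} (hc : ‖c‖ < 1)
    (V : CN N ≃ₗᵢ[ℂ] CN N) :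
    ∃ U : H →L[ℂ] H, IsWeightedComp ev (fun z => moebiusWeight p c (V z))
      (fun z => moebius c (V z)) U ∧ ∀ f, ‖U f‖ ≤ ‖f‖ := by
  have h := hH.exists_isWeightedComp (w := fun z => moebiusWeight p c (V z))
    (φ := fun z => moebius c (V z)) (C := 1) fun f => ?_
  · simpa only [one_mul] using h
  · obtain ⟨g, hg, hgf⟩ := hH.exists_moebius c hc f
    obtain ⟨k, hk, hkg⟩ := hH.exists_isometry V g
    refine ⟨k, fun z hz => ?_, by rw [one_mul]; exact hkg.trans hgf⟩
    rw [hk z hz, hg (V z) (by simpa using hz)]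

end IsBallSpace

section OneSided

variable {W k ψ : CN N → ℂ} {φ χ : CN N → CN N} {T U : H →L[ℂ] H} {ℓ : CN N → ℝ} {τ M μ r : ℝ}

theorem norm_pow_le_of_contraction (hUn : ∀ f, ‖U f‖ ≤ ‖f‖) (n : ℕ) (f : H) :
    ‖(U ^ n) f‖ ≤ ‖f‖ := by
  induction n with
  | zero => simp
  | succ n ih =>
    rw [pow_succ']
    exact (hUn _).trans ih

/-- Splitting off the contraction U^n leaves a scalar product along the orbit; operator bounds
reduce to bounds on that product. -/
theorem ev_pow_eq_prod (hφ : MapsTo φ (ball 0 1) (ball 0 1)) (hU : IsWeightedComp ev k φ U)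
    (hT : IsWeightedComp ev (fun z => W z * k z) φ T) (n : ℕ) (f : H) :
    ∀ z ∈ ball (0 : CN N) 1,
      ev ((T ^ n) f) z = (∏ j ∈ Finset.range n, W (φ^[j] z)) * ev ((U ^ n) f) z := by
  induction n with
  | zero => intro z _; simp
  | succ n ih =>
    intro z hz
    rw [pow_succ', pow_succ', Finset.prod_range_succ']
    change ev (T ((T ^ n) f)) z = _ * ev (U ((U ^ n) f)) z
    rw [hT _ z hz, hU _ z hz, ih _ (hφ hz)]
    simp only [Function.iterate_succ_apply, Function.iterate_zero, id_eq]
    ring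

/-- Lets a multiplier act before U^n instead of after it, so that it can be combined with the decay
of f. -/
theorem ev_pow_mul (hφ : MapsTo φ (ball 0 1) (ball 0 1)) (hU : IsWeightedComp ev k φ U) {q f : H}
    {m : CN N → ℂ} (hq : ∀ z ∈ ball (0 : CN N) 1, ev q z = m z * ev f z) (n : ℕ) :
    ∀ z ∈ ball (0 : CN N) 1, ev ((U ^ n) q) z = m (φ^[n] z) * ev ((U ^ n) f) z := by
  induction n with
  | zero => intro z hz; simpa using hq z hz
  | succ n ih =>
    intro z hz
    rw [pow_succ']
    change ev (U ((U ^ n) q)) z = _ * ev (U ((U ^ n) f)) z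
    rw [hU _ z hz, hU _ z hz, ih _ (hφ hz), Function.iterate_succ_apply]
    ring

theorem differentiableOn_iterate (hφ : MapsTo φ (ball 0 1) (ball 0 1))
    (hφd : DifferentiableOn ℂ φ (ball 0 1)) (n : ℕ) :
    DifferentiableOn ℂ (φ^[n]) (ball 0 1) := by
  induction n with
  | zero => exact differentiableOn_id
  | succ n ih => exact ih.comp hφd hφ

theorem differentiableOn_prod_iterate (hφ : MapsTo φ (ball 0 1) (ball 0 1))
    (hφd : DifferentiableOn ℂ φ (ball 0 1)) (hW : DifferentiableOn ℂ W (ball 0 1)) (n : ℕ) :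
    DifferentiableOn ℂ (fun z => ∏ j ∈ Finset.range n, W (φ^[j] z)) (ball 0 1) := by
  induction n with
  | zero => simp
  | succ n ih =>
    simp only [Finset.prod_range_succ]
    exact ih.mul (hW.comp (differentiableOn_iterate hφ hφd n) (hφ.iterate n))

theorem leftInvOn_iterate (hφ : MapsTo φ (ball 0 1) (ball 0 1))
    (h : LeftInvOn χ φ (ball 0 1)) (n : ℕ) : LeftInvOn (χ^[n]) (φ^[n]) (ball 0 1) := by
  induction n with
  | zero => intro z _; rfl
  | succ n ih =>
    intro z hz
    rw [Function.iterate_succ_apply, Function.iterate_succ_apply', h (hφ.iterate n hz), ih hz]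

/-- Growth of the powers of a weighted composition operator. -/
theorem exists_norm_pow_le (hH : IsBallSpace N p ev) (hφ : MapsTo φ (ball 0 1) (ball 0 1))
    (hφd : DifferentiableOn ℂ φ (ball 0 1)) (hU : IsWeightedComp ev k φ U)
    (hUn : ∀ f, ‖U f‖ ≤ ‖f‖) (hT : IsWeightedComp ev (fun z => W z * k z) φ T)
    (hW : DifferentiableOn ℂ W (ball 0 1)) (hWM : ∀ z ∈ ball (0 : CN N) 1, ‖W z‖ ≤ M)
    (hℓ : ∀ z ∈ ball (0 : CN N) 1, ℓ (φ z) = ℓ z + τ) (hτ : 0 < τ) (hμ : 0 < μ) (hr : 0 ≤ r)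
    (hWμ : ∀ z ∈ ball (0 : CN N) 1, r ≤ |ℓ z| → ‖W z‖ ≤ μ) :
    ∃ C : ℝ, ∀ (n : ℕ) (f : H), ‖(T ^ n) f‖ ≤ C * μ ^ n * ‖f‖ := by
  obtain ⟨c, hc, hk⟩ := exists_prod_iterate_le (W := fun z => ‖W z‖) hφ hℓ hτ hμ
    (fun z => norm_nonneg _) hWM
  -- W may exceed μ only at heights in (-r, r). Clamping the height to [-r, r + τ] keeps full rises
  -- there and bounds the total rise by 2r + τ.
  have hb := hk (fun x => max (-r) (min x (r + τ)))
    (fun x y hxy => max_le_max le_rfl (min_le_min hxy le_rfl)) (fun z hz => by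
    by_cases h : r ≤ |ℓ z|
    · exact Or.inl (hWμ z hz h)
    · right
      push Not at h
      obtain ⟨h1, h2⟩ := abs_lt.1 h
      rw [min_eq_left (by linarith), min_eq_left (by linarith), max_eq_right (by linarith),
        max_eq_right (by linarith)])
  refine ⟨Real.exp (c * (2 * r + τ)), fun n f => ?_⟩
  have hbd : ∀ z ∈ ball (0 : CN N) 1, ‖∏ j ∈ Finset.range n, W (φ^[j] z)‖ ≤
      Real.exp (c * (2 * r + τ)) * μ ^ n := by
    intro z hz
    rw [norm_prod, mul_comm]
    refine (hb n z hz).trans ?_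
    gcongr
    have h1 : max (-r) (min (ℓ (φ^[n] z)) (r + τ)) ≤ r + τ :=
      max_le (by linarith) (min_le_right _ _)
    have h2 : -r ≤ max (-r) (min (ℓ z) (r + τ)) := le_max_left _ _
    linarith
  obtain ⟨g, hg, hgn⟩ := hH.exists_mul _ _ (differentiableOn_prod_iterate hφ hφd hW n) hbd
    ((U ^ n) f)
  have : (T ^ n) f = g := hH.ext fun z hz => by
    rw [hg z hz, ev_pow_eq_prod hφ hU hT n f z hz]
  rw [this]
  refine hgn.trans ?_
  gcongr
  exact norm_pow_le_of_contraction hUn n f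

/-- Growth of the orbits of functions that are small where `ℓ` is large. -/
theorem exists_norm_pow_apply_le (hH : IsBallSpace N p ev) (hφ : MapsTo φ (ball 0 1) (ball 0 1))
    (hχ : MapsTo χ (ball 0 1) (ball 0 1)) (hχφ : LeftInvOn χ φ (ball 0 1))
    (hφχ : LeftInvOn φ χ (ball 0 1))
    (hφd : DifferentiableOn ℂ φ (ball 0 1)) (hχd : DifferentiableOn ℂ χ (ball 0 1))
    (hU : IsWeightedComp ev k φ U)
    (hUn : ∀ f, ‖U f‖ ≤ ‖f‖) (hT : IsWeightedComp ev (fun z => W z * k z) φ T)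
    (hW : DifferentiableOn ℂ W (ball 0 1)) (hWM : ∀ z ∈ ball (0 : CN N) 1, ‖W z‖ ≤ M)
    (hℓ : ∀ z ∈ ball (0 : CN N) 1, ℓ (φ z) = ℓ z + τ) (hτ : 0 < τ) (hμ : 0 < μ) (hr : 0 ≤ r)
    (hWμ : ∀ z ∈ ball (0 : CN N) 1, ℓ z ≤ -r → ‖W z‖ ≤ μ) :
    ∃ c : ℝ, 0 ≤ c ∧ ∀ (f : H) (B : ℝ),
      (∀ z ∈ ball (0 : CN N) 1, ‖ev f z‖ * Real.exp (c * max (ℓ z) 0) ≤ B) →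
      ∃ C : ℝ, ∀ n : ℕ, ‖(T ^ n) f‖ ≤ C * μ ^ n := by
  obtain ⟨c, hc, hk⟩ := exists_prod_iterate_le (W := fun z => ‖W z‖) hφ hℓ hτ hμ
    (fun z => norm_nonneg _) hWM
  -- W is controlled only at heights below -r, so the height is truncated from below alone and the
  -- total rise depends on the final height.
  have hb := hk (fun x => max (-r) x) (fun x y hxy => max_le_max le_rfl hxy) (fun z hz => by
    by_cases h : ℓ z ≤ -r
    · exact Or.inl (hWμ z hz h)
    · right
      rw [max_eq_right (by linarith), max_eq_right (by linarith)])
  obtain ⟨e, he⟩ := hH.exists_one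
  refine ⟨c, hc, fun f B hB => ⟨Real.exp (c * r) * B * ‖e‖, fun n => ?_⟩⟩
  -- The product is rewritten as a function of the end point of the orbit segment. Its possible
  -- growth at large height is then absorbed by the decay of f, and T^n f = U^n (m f).
  set m : CN N → ℂ := fun z => ∏ j ∈ Finset.range n, W (φ^[j] (χ^[n] z)) with hm
  have hmd : DifferentiableOn ℂ m (ball 0 1) :=
    (differentiableOn_prod_iterate hφ hφd hW n).comp (differentiableOn_iterate hχ hχd n)
      (hχ.iterate n)
  have hχφn : ∀ z ∈ ball (0 : CN N) 1, χ^[n] (φ^[n] z) = z :=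
    leftInvOn_iterate hφ hχφ n
  have hφχn : ∀ z ∈ ball (0 : CN N) 1, φ^[n] (χ^[n] z) = z :=
    leftInvOn_iterate hχ hφχ n
  have hmb : ∀ z ∈ ball (0 : CN N) 1, ‖m z * ev f z‖ ≤ Real.exp (c * r) * B * μ ^ n := by
    intro z hz
    rw [norm_mul, hm, norm_prod]
    have h1 := hb n (χ^[n] z) (hχ.iterate n hz)
    rw [hφχn z hz] at h1
    have h2 : Real.exp (c * (max (-r) (ℓ z) - max (-r) (ℓ (χ^[n] z)))) ≤
        Real.exp (c * r) * Real.exp (c * max (ℓ z) 0) := by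
      rw [← Real.exp_add, ← mul_add]
      gcongr
      have h3 : -r ≤ max (-r) (ℓ (χ^[n] z)) := le_max_left _ _
      have h4 : max (-r) (ℓ z) ≤ max (ℓ z) 0 :=
        max_le (by linarith [le_max_right (ℓ z) 0]) (le_max_left _ _)
      linarith
    calc (∏ j ∈ Finset.range n, ‖W (φ^[j] (χ^[n] z))‖) * ‖ev f z‖
        ≤ (μ ^ n * (Real.exp (c * r) * Real.exp (c * max (ℓ z) 0))) * ‖ev f z‖ := by
          gcongr
          exact h1.trans (by gcongr)
      _ = Real.exp (c * r) * (‖ev f z‖ * Real.exp (c * max (ℓ z) 0)) * μ ^ n := by ring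
      _ ≤ Real.exp (c * r) * B * μ ^ n := by
          gcongr
          exact hB z hz
  obtain ⟨q, hq, hqn⟩ := hH.exists_mul _ _ (hmd.mul (hH.differentiableOn f)) hmb e
  have hq' : ∀ z ∈ ball (0 : CN N) 1, ev q z = m z * ev f z := fun z hz => by
    rw [hq z hz, he z hz, mul_one]
    rfl
  have hTq : (T ^ n) f = (U ^ n) q := hH.ext fun z hz => by
    rw [ev_pow_eq_prod hφ hU hT n f z hz, ev_pow_mul hφ hU hq' n z hz, hm]
    simp only [hχφn z hz]
  rw [hTq]
  refine (norm_pow_le_of_contraction hUn n q).trans (hqn.trans (le_of_eq ?_))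
  ring

/-- Growth of the values at a point of the powers of a weighted composition operator. -/
theorem exists_norm_ev_pow_le (hH : IsBallSpace N p ev) (hφ : MapsTo φ (ball 0 1) (ball 0 1))
    (hU : IsWeightedComp ev k φ U)
    (hUn : ∀ f, ‖U f‖ ≤ ‖f‖) (hT : IsWeightedComp ev (fun z => W z * k z) φ T)
    (hWM : ∀ z ∈ ball (0 : CN N) 1, ‖W z‖ ≤ M)
    (hℓ : ∀ z ∈ ball (0 : CN N) 1, ℓ (φ z) = ℓ z + τ) (hτ : 0 < τ) (hμ : 0 < μ)
    (hWμ : ∀ z ∈ ball (0 : CN N) 1, r ≤ ℓ z → ‖W z‖ ≤ μ) :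
    ∃ C : ℝ, 0 ≤ C ∧ ∀ (n : ℕ) (f : H), ‖ev ((T ^ n) f) 0‖ ≤ C * μ ^ n * ‖f‖ := by
  have h0 : (0 : CN N) ∈ ball (0 : CN N) 1 := by simp
  obtain ⟨c, hc, hk⟩ := exists_prod_iterate_le (W := fun z => ‖W z‖) hφ hℓ hτ hμ
    (fun z => norm_nonneg _) hWM
  -- W is controlled only at heights above r, so the height is truncated from above; the starting
  -- height is that of 0, which bounds the rise.
  have hb := hk (fun x => min x (r + τ)) (fun x y hxy => min_le_min hxy le_rfl) (fun z hz => by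
    by_cases h : r ≤ ℓ z
    · exact Or.inl (hWμ z hz h)
    · right
      rw [min_eq_left (by linarith), min_eq_left (by linarith)])
  refine ⟨Real.exp (c * (r + τ - min (ℓ 0) (r + τ))), by positivity, fun n f => ?_⟩
  rw [ev_pow_eq_prod hφ hU hT n f 0 h0, norm_mul, norm_prod]
  have h1 := hb n 0 h0
  have h2 : ‖ev ((U ^ n) f) 0‖ ≤ ‖f‖ :=
    (hH.norm_apply_zero_le _).trans (norm_pow_le_of_contraction hUn n f)
  refine mul_le_mul ?_ h2 (norm_nonneg _) (by positivity)
  rw [mul_comm]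
  refine h1.trans ?_
  gcongr
  exact min_le_right _ _

end OneSided

end Operators

/-! ### The half-plane coordinate and the height -/

section HalfPlane

theorem norm_mul_norm_lt_one_of_mem_ball {E : Type*} [SeminormedAddCommGroup E] {a z : E}
    (ha : ‖a‖ = 1) (hz : z ∈ ball (0 : E) 1) : ‖a‖ * ‖z‖ < 1 := by
  rw [ha, one_mul]
  exact mem_ball_zero_iff.1 hz

variable {E : Type*} [NormedAddCommGroup E] [InnerProductSpace ℂ E] {a b z : E}

/-- The coordinate `(1 - ⟨z, b⟩) / (1 - ⟨z, a⟩)`. -/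
noncomputable def halfPlane (a b z : E) : ℂ := (1 - inner ℂ b z) / (1 - inner ℂ a z)

theorem one_sub_inner_ne_zero_of_mem_ball (ha : ‖a‖ = 1) (hz : z ∈ ball (0 : E) 1) :
    (1 - inner ℂ a z : ℂ) ≠ 0 :=
  one_sub_inner_ne_zero (norm_mul_norm_lt_one_of_mem_ball ha hz)

theorem norm_one_sub_inner_le_two (ha : ‖a‖ ≤ 1) (hz : ‖z‖ ≤ 1) :
    ‖(1 - inner ℂ a z : ℂ)‖ ≤ 2 := by
  have h1 := norm_sub_le (1 : ℂ) (inner ℂ a z)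
  have h2 := norm_inner_le_norm (𝕜 := ℂ) a z
  have h3 : ‖a‖ * ‖z‖ ≤ 1 := mul_le_one₀ ha (norm_nonneg _) hz
  rw [norm_one] at h1
  linarith

theorem halfPlane_ne_zero (ha : ‖a‖ = 1) (hb : ‖b‖ = 1) (hz : z ∈ ball (0 : E) 1) :
    halfPlane a b z ≠ 0 :=
  div_ne_zero (one_sub_inner_ne_zero_of_mem_ball hb hz) (one_sub_inner_ne_zero_of_mem_ball ha hz)

/-- A quotient of two numbers with positive real part cannot be real and nonpositive. This gives a
holomorphic logarithm with bounded argument. -/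
theorem halfPlane_mem_slitPlane (ha : ‖a‖ = 1) (hb : ‖b‖ = 1) (hz : z ∈ ball (0 : E) 1) :
    halfPlane a b z ∈ Complex.slitPlane := by
  rw [Complex.mem_slitPlane_iff]
  by_contra! h
  have hya := re_one_sub_inner_pos (norm_mul_norm_lt_one_of_mem_ball ha hz)
  have hxb := re_one_sub_inner_pos (norm_mul_norm_lt_one_of_mem_ball hb hz)
  have h1 : (1 - inner ℂ b z : ℂ) = halfPlane a b z * (1 - inner ℂ a z) :=
    (div_mul_cancel₀ _ (one_sub_inner_ne_zero_of_mem_ball ha hz)).symm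
  have h2 := congrArg Complex.re h1
  rw [Complex.mul_re, h.2, zero_mul, sub_zero] at h2
  nlinarith [h.1]

theorem differentiableOn_one_sub_inner (a : E) (s : Set E) :
    DifferentiableOn ℂ (fun z => (1 - inner ℂ a z : ℂ)) s :=
  ((innerSL ℂ a).differentiable.const_sub 1).differentiableOn

theorem differentiableOn_halfPlane (ha : ‖a‖ = 1) :
    DifferentiableOn ℂ (halfPlane a b) (ball 0 1) := by
  have h1 := differentiableOn_one_sub_inner b (ball 0 1)
  have h2 := (differentiableOn_one_sub_inner a (ball 0 1)).fun_inv
    fun z hz => one_sub_inner_ne_zero_of_mem_ball ha hz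
  have h3 := h1.mul h2
  exact h3.congr fun z hz => div_eq_mul_inv _ _

/-- The logarithm of the modulus of the half-plane coordinate. -/
noncomputable def height (a b z : E) : ℝ := Real.log ‖halfPlane a b z‖

theorem height_swap (a b z : E) : height a b z = -height b a z := by
  rw [height, height, halfPlane, halfPlane, norm_div, norm_div, ← Real.log_inv, inv_div]

theorem exp_height (ha : ‖a‖ = 1) (hb : ‖b‖ = 1) (hz : z ∈ ball (0 : E) 1) :
    Real.exp (height a b z) = ‖(1 - inner ℂ b z : ℂ)‖ / ‖(1 - inner ℂ a z : ℂ)‖ := by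
  rw [height, Real.exp_log (norm_pos_iff.2 (halfPlane_ne_zero ha hb hz)), halfPlane, norm_div]

/-- Expanding the square gives at most 2 Re(1 - ⟨a,z⟩), because |z| ≤ 1. -/
theorem norm_sub_sq_le (ha : ‖a‖ = 1) (hz : ‖z‖ ≤ 1) :
    ‖z - a‖ ^ 2 ≤ 2 * ‖(1 - inner ℂ a z : ℂ)‖ := by
  have h1 : ‖z - a‖ ^ 2 = ‖z‖ ^ 2 - 2 * (inner ℂ a z : ℂ).re + 1 := by
    have h0 : (inner ℂ z a : ℂ).re = (inner ℂ a z : ℂ).re := by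
      rw [← inner_conj_symm, Complex.conj_re]
    rw [norm_sub_sq (𝕜 := ℂ), ha]
    simp [h0]
  have h2 := Complex.re_le_norm (1 - inner ℂ a z : ℂ)
  rw [Complex.sub_re, Complex.one_re] at h2
  nlinarith [norm_nonneg z]

/-- Points of large height are close to `a`. -/
theorem exists_dist_lt_of_le_height (ha : ‖a‖ = 1) (hb : ‖b‖ = 1) {δ : ℝ} (hδ : 0 < δ) :
    ∃ r : ℝ, 0 ≤ r ∧ ∀ z ∈ ball (0 : E) 1, r ≤ height a b z → dist z a < δ := by
  -- As |1 - ⟨b,z⟩| ≤ 2, this height forces |1 - ⟨a,z⟩| ≤ δ²/4, hence |z - a|² ≤ δ²/2.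
  refine ⟨max 0 (Real.log (8 / δ ^ 2)), le_max_left _ _, fun z hz hr => ?_⟩
  have hz1 : ‖z‖ < 1 := mem_ball_zero_iff.1 hz
  have h1 : 8 / δ ^ 2 ≤ ‖(1 - inner ℂ b z : ℂ)‖ / ‖(1 - inner ℂ a z : ℂ)‖ := by
    rw [← exp_height ha hb hz, ← Real.log_le_iff_le_exp (by positivity)]
    exact (le_max_right _ _).trans hr
  have hpos := norm_pos_iff.2 (one_sub_inner_ne_zero_of_mem_ball ha hz)
  have h2 := norm_one_sub_inner_le_two hb.le hz1.le
  have h3 := norm_sub_sq_le ha hz1.le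
  rw [div_le_div_iff₀ (by positivity) hpos] at h1
  have hδ2 : 0 < δ ^ 2 := by positivity
  have h4 : ‖z - a‖ ^ 2 < δ ^ 2 := by nlinarith
  rw [dist_eq_norm]
  exact (sq_lt_sq₀ (norm_nonneg _) hδ.le).1 h4

/-- Turns the decay needed in `exists_norm_pow_apply_le` into vanishing at a to a finite integer
order. -/
theorem exp_mul_max_height_le (ha : ‖a‖ = 1) (hb : ‖b‖ = 1) (hz : z ∈ ball (0 : E) 1) {c : ℝ}
    {m : ℕ} (hm : c ≤ m) :
    Real.exp (c * max (height a b z) 0) ≤ (2 / ‖(1 - inner ℂ a z : ℂ)‖) ^ m := by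
  have hz1 : ‖z‖ < 1 := mem_ball_zero_iff.1 hz
  have hpos := norm_pos_iff.2 (one_sub_inner_ne_zero_of_mem_ball ha hz)
  have h1 : Real.exp (max (height a b z) 0) ≤ 2 / ‖(1 - inner ℂ a z : ℂ)‖ := by
    rcases le_total (height a b z) 0 with h | h
    · rw [max_eq_right h, Real.exp_zero, one_le_div hpos]
      exact norm_one_sub_inner_le_two ha.le hz1.le
    · rw [max_eq_left h, exp_height ha hb hz]
      gcongr
      exact norm_one_sub_inner_le_two hb.le hz1.le
  calc Real.exp (c * max (height a b z) 0) ≤ Real.exp (m * max (height a b z) 0) := by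
        gcongr
    _ = Real.exp (max (height a b z) 0) ^ m := Real.exp_nat_mul _ _
    _ ≤ _ := by gcongr

end HalfPlane

/-! ### Growth bounds governed by the two fixed points, and rotations -/

section Direction

variable {N : ℕ} {p : ℝ} {H : Type*} [NormedAddCommGroup H] [InnerProductSpace ℂ H]
  {ev : H →ₗ[ℂ] (CN N → ℂ)}

/-- The source of the exponent K = p/2: the weight is of order p in s/|1 - ⟨V⁻¹c,e⟩|, and the
dilation factor is the square of that quotient. -/
theorem norm_moebiusWeight_eq_dilation {c e : CN N} (V : CN N ≃ₗᵢ[ℂ] CN N) (hc : ‖c‖ < 1) :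
    ‖moebiusWeight p c (V e)‖ = dilation c V e ^ (p / 2) := by
  have hs := defect_pos hc
  rw [norm_moebiusWeight hc, dilation, inner_symm_apply, ← div_pow, ← Real.rpow_natCast _ 2,
    ← Real.rpow_mul (by positivity)]
  congr 1
  push_cast
  ring

/-- Bounds for a weighted composition operator whose symbol attracts to `a` and repels from `b`. -/
theorem exists_isWeightedComp_bounds (hH : IsBallSpace N p ev) (hp : 0 ≤ p) {c a b : CN N}
    {V : CN N ≃ₗᵢ[ℂ] CN N} {φ χ : CN N → CN N} (hc : ‖c‖ < 1) (ha : ‖a‖ = 1) (hb : ‖b‖ = 1)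
    (hab : a ≠ b) (hfa : moebius c (V a) = a) (hfb : moebius c (V b) = b)
    (hφV : EqOn φ (fun z => moebius c (V z)) (ball 0 1))
    (hφ : MapsTo φ (ball 0 1) (ball 0 1)) (hχ : MapsTo χ (ball 0 1) (ball 0 1))
    (hχφ : LeftInvOn χ φ (ball 0 1)) (hφχ : LeftInvOn φ χ (ball 0 1))
    (hφd : DifferentiableOn ℂ φ (ball 0 1)) (hχd : DifferentiableOn ℂ χ (ball 0 1))
    {κ : ℝ} (hκ : κ = dilation c V b) (hκ1 : 1 < κ)
    {ψ : CN N → ℂ} (hψd : DifferentiableOn ℂ ψ (ball 0 1)) {M A B : ℝ}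
    (hψM : ∀ z ∈ ball (0 : CN N) 1, ‖ψ z‖ ≤ M) (hA0 : 0 ≤ A) (hB0 : 0 ≤ B)
    (hA : Tendsto (fun z => ‖ψ z‖) (𝓝[ball 0 1] a) (𝓝 A))
    (hB : Tendsto (fun z => ‖ψ z‖) (𝓝[ball 0 1] b) (𝓝 B)) :
    ∃ T : H →L[ℂ] H, IsWeightedComp ev ψ φ T ∧
      (∀ μ, A * κ ^ (p / 2) < μ → B * κ ^ (-(p / 2)) < μ →
        ∃ C : ℝ, ∀ (n : ℕ) (f : H), ‖(T ^ n) f‖ ≤ C * μ ^ n * ‖f‖) ∧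
      (∀ μ, B * κ ^ (-(p / 2)) < μ → ∃ m : ℕ, ∀ (f : H) (D : ℝ),
        (∀ z ∈ ball (0 : CN N) 1, ‖ev f z‖ ≤ D * ‖(1 - inner ℂ a z : ℂ)‖ ^ m) →
        ∃ C : ℝ, ∀ n : ℕ, ‖(T ^ n) f‖ ≤ C * μ ^ n) ∧
      (∀ μ, A * κ ^ (p / 2) < μ → ∃ C : ℝ, 0 ≤ C ∧
        ∀ (n : ℕ) (f : H), ‖ev ((T ^ n) f) 0‖ ≤ C * μ ^ n * ‖f‖) := by
  have hs := defect_pos hc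
  have hκ0 : 0 < κ := by linarith
  have hcV : ∀ z : CN N, ‖z‖ ≤ 1 → ‖c‖ * ‖V z‖ < 1 := fun z hz => by
    rw [V.norm_map]
    exact norm_mul_norm_lt_one hc hz
  obtain ⟨U, hU', hUn⟩ := hH.exists_moebius_isometry hc V
  set k : CN N → ℂ := fun z => moebiusWeight p c (V z) with hk
  have hU : IsWeightedComp ev k φ U := fun f z hz => by rw [hU' f z hz, hφV hz]
  have hk0 : ∀ z : CN N, ‖z‖ ≤ 1 → k z ≠ 0 := fun z hz => moebiusWeight_ne_zero hc (hcV z hz)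
  have hkd : ∀ z : CN N, ‖z‖ ≤ 1 → DifferentiableAt ℂ k z := fun z hz =>
    (differentiableAt_moebiusWeight hc (hcV z hz)).comp z V.differentiableAt
  have hball : ∀ z ∈ ball (0 : CN N) 1, ‖z‖ ≤ 1 := fun z hz => (mem_ball_zero_iff.1 hz).le
  -- Dividing by the weight of the contraction U leaves the part of ψ that governs growth. Its
  -- modulus tends to Aκ^(p/2) at a and to Bκ^(-p/2) at b.
  set W : CN N → ℂ := fun z => ψ z * (k z)⁻¹ with hWdef
  have hWk : ∀ z ∈ ball (0 : CN N) 1, W z * k z = ψ z := fun z hz =>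
    inv_mul_cancel_right₀ (hk0 z (hball z hz)) _
  have hWd : DifferentiableOn ℂ W (ball 0 1) := hψd.mul
    (DifferentiableOn.fun_inv (fun z hz => (hkd z (hball z hz)).differentiableWithinAt)
      fun z hz => hk0 z (hball z hz))
  have hWM : ∀ z ∈ ball (0 : CN N) 1, ‖W z‖ ≤ M * ((defect c / 2) ^ p)⁻¹ := by
    intro z hz
    have hM0 : 0 ≤ M := (norm_nonneg _).trans (hψM z hz)
    rw [hWdef, norm_mul, norm_inv, hk, norm_moebiusWeight hc]
    have h1 := norm_one_sub_inner_le_two (a := c) (z := V z) hc.le (by simpa using hball z hz)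
    have h2 := norm_pos_iff.2 (one_sub_inner_ne_zero (hcV z (hball z hz)))
    gcongr
    exact hψM z hz
  obtain ⟨P, hP, -⟩ := hH.exists_multiplication hWd hWM
  have hT : IsWeightedComp ev (fun z => W z * k z) φ (P * U) := fun f z hz => by
    change ev (P (U f)) z = W z * k z * ev f (φ z)
    rw [hP _ z hz, id_eq, hU _ z hz]
    ring
  have hlimit : ∀ e : CN N, ‖e‖ = 1 → ∀ L : ℝ,
      Tendsto (fun z => ‖ψ z‖) (𝓝[ball 0 1] e) (𝓝 L) → ∀ μ, L * (dilation c V e ^ (p / 2))⁻¹ < μ →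
      ∃ δ > 0, ∀ z ∈ ball (0 : CN N) 1, dist z e < δ → ‖W z‖ ≤ μ := by
    intro e he L hL μ hμ
    have h1 : Tendsto (fun z => ‖(k z)⁻¹‖) (𝓝[ball 0 1] e) (𝓝 (dilation c V e ^ (p / 2))⁻¹) := by
      have h2 : ContinuousAt (fun z => ‖(k z)⁻¹‖) e :=
        ((hkd e he.le).continuousAt.inv₀ (hk0 e he.le)).norm
      have h3 : ‖(k e)⁻¹‖ = (dilation c V e ^ (p / 2))⁻¹ := by
        rw [norm_inv, hk, norm_moebiusWeight_eq_dilation V hc]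
      rw [← h3]
      exact h2.tendsto.mono_left nhdsWithin_le_nhds
    have h2 := (hL.mul h1).eventually_lt_const hμ
    obtain ⟨δ, hδ, h3⟩ := Metric.mem_nhdsWithin_iff.1 h2
    refine ⟨δ, hδ, fun z hz hze => ?_⟩
    have h4 : ‖ψ z‖ * ‖(k z)⁻¹‖ < μ := h3 ⟨mem_ball.2 hze, hz⟩
    rw [hWdef, norm_mul]
    exact h4.le
  have hda : (dilation c V a ^ (p / 2))⁻¹ = κ ^ (p / 2) := by
    rw [dilation_eq_inv V hc ha hb hab hfa hfb, ← hκ, Real.inv_rpow hκ0.le, inv_inv]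
  have hdb : (dilation c V b ^ (p / 2))⁻¹ = κ ^ (-(p / 2)) := by
    rw [← hκ, Real.rpow_neg hκ0.le]
  have hnear_a : ∀ μ, A * κ ^ (p / 2) < μ → ∃ r, 0 ≤ r ∧
      ∀ z ∈ ball (0 : CN N) 1, r ≤ height a b z → ‖W z‖ ≤ μ := by
    intro μ hμ
    obtain ⟨δ, hδ, h1⟩ := hlimit a ha A hA μ (by rwa [hda])
    obtain ⟨r, hr, h2⟩ := exists_dist_lt_of_le_height ha hb hδ
    exact ⟨r, hr, fun z hz hzr => h1 z hz (h2 z hz hzr)⟩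
  have hnear_b : ∀ μ, B * κ ^ (-(p / 2)) < μ → ∃ r, 0 ≤ r ∧
      ∀ z ∈ ball (0 : CN N) 1, height a b z ≤ -r → ‖W z‖ ≤ μ := by
    intro μ hμ
    obtain ⟨δ, hδ, h1⟩ := hlimit b hb B hB μ (by rwa [hdb])
    obtain ⟨r, hr, h2⟩ := exists_dist_lt_of_le_height hb ha hδ
    refine ⟨r, hr, fun z hz hzr => h1 z hz (h2 z hz ?_)⟩
    rw [height_swap] at hzr
    linarith
  have hτ : 0 < Real.log κ := Real.log_pos hκ1
  have hℓ : ∀ z ∈ ball (0 : CN N) 1, height a b (φ z) = height a b z + Real.log κ := by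
    intro z hz
    have h1 := halfPlane_moebius V hc ha hb hab hfa hfb (mem_ball_zero_iff.1 hz)
    have h2 : halfPlane a b (φ z) = (κ : ℂ) * halfPlane a b z := by
      rw [hφV hz, hκ]
      exact h1
    rw [height, h2, norm_mul, Complex.norm_real, Real.norm_of_nonneg hκ0.le,
      Real.log_mul hκ0.ne' (norm_ne_zero_iff.2 (halfPlane_ne_zero ha hb hz)), height, add_comm]
  refine ⟨P * U, fun f z hz =>
    (hT f z hz).trans (congrArg (· * ev f (φ z)) (hWk z hz)), fun μ hμa hμb => ?_,
    fun μ hμ => ?_, fun μ hμ => ?_⟩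
  · have hμ0 : 0 < μ := lt_of_le_of_lt (by positivity) hμa
    obtain ⟨r₁, hr₁, h1⟩ := hnear_a μ hμa
    obtain ⟨r₂, hr₂, h2⟩ := hnear_b μ hμb
    refine exists_norm_pow_le hH hφ hφd hU hUn hT hWd hWM hℓ hτ hμ0 (r := max r₁ r₂)
      (hr₁.trans (le_max_left _ _)) fun z hz hzr => ?_
    rcases le_abs.1 hzr with h | h
    · exact h1 z hz ((le_max_left _ _).trans h)
    · exact h2 z hz (by linarith [le_max_right r₁ r₂])
  · have hμ0 : 0 < μ := lt_of_le_of_lt (by positivity) hμ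
    obtain ⟨r, hr, h1⟩ := hnear_b μ hμ
    obtain ⟨e, -, h2⟩ := exists_norm_pow_apply_le hH hφ hχ hχφ hφχ hφd hχd hU hUn hT hWd hWM hℓ hτ
      hμ0 hr h1
    obtain ⟨m, hm⟩ := exists_nat_ge e
    refine ⟨m, fun f D hD => h2 f (D * 2 ^ m) fun z hz => ?_⟩
    have hpos := norm_pos_iff.2 (one_sub_inner_ne_zero_of_mem_ball ha hz)
    calc ‖ev f z‖ * Real.exp (e * max (height a b z) 0)
        ≤ (D * ‖(1 - inner ℂ a z : ℂ)‖ ^ m) * (2 / ‖(1 - inner ℂ a z : ℂ)‖) ^ m :=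
          mul_le_mul (hD z hz) (exp_mul_max_height_le ha hb hz hm) (by positivity)
            ((norm_nonneg _).trans (hD z hz))
      _ = D * 2 ^ m := by
          rw [div_pow]
          field_simp
  · have hμ0 : 0 < μ := lt_of_le_of_lt (by positivity) hμ
    obtain ⟨r, hr, h1⟩ := hnear_a μ hμ
    exact exists_norm_ev_pow_le hH hφ hU hUn hT hWM hℓ hτ hμ0 h1

/-- Multiplication by powers of the half-plane coordinate rotates a weighted composition
operator. -/
theorem exists_rotation (hH : IsBallSpace N p ev) {a b : CN N} (ha : ‖a‖ = 1) (hb : ‖b‖ = 1)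
    {φ : CN N → CN N} {κ : ℝ} (hκ : 1 < κ) {ψ : CN N → ℂ} {T : H →L[ℂ] H}
    (hT : IsWeightedComp ev ψ φ T)
    (hφ : MapsTo φ (ball 0 1) (ball 0 1))
    (hφh : ∀ z ∈ ball (0 : CN N) 1, halfPlane a b (φ z) = (κ : ℂ) * halfPlane a b z) (θ : ℝ) :
    ∃ P Q : H →L[ℂ] H, P * Q = 1 ∧ Q * P = 1 ∧
      T * P = Complex.exp (θ * Complex.I) • (P * T) := by
  have hκ0 : 0 < κ := by linarith
  have hτ : 0 < Real.log κ := Real.log_pos hκ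
  -- This is h^(it) for the half-plane coordinate h. It is bounded because arg h is, its inverse is
  -- h^(-it), and composing with φ multiplies it by κ^(it).
  set u : ℝ → CN N → ℂ := fun t z => Complex.exp (Complex.I * t * Complex.log (halfPlane a b z))
    with hu
  have hud : ∀ t, DifferentiableOn ℂ (u t) (ball 0 1) := fun t =>
    (((differentiableOn_halfPlane ha).clog fun z hz =>
      halfPlane_mem_slitPlane ha hb hz).const_mul _).cexp
  have hub : ∀ t, ∀ z ∈ ball (0 : CN N) 1, ‖u t z‖ ≤ Real.exp (|t| * Real.pi) := by
    intro t z _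
    rw [hu, Complex.norm_exp]
    gcongr
    have h1 := Complex.abs_arg_le_pi (halfPlane a b z)
    have h2 : (Complex.I * t * Complex.log (halfPlane a b z)).re =
        -(t * (halfPlane a b z).arg) := by
      simp [Complex.log_im]
    rw [h2]
    calc -(t * (halfPlane a b z).arg) ≤ |t * (halfPlane a b z).arg| := neg_le_abs _
      _ = |t| * |(halfPlane a b z).arg| := abs_mul _ _
      _ ≤ |t| * Real.pi := by gcongr
  have huu : ∀ t z, u t z * u (-t) z = 1 := by
    intro t z
    rw [hu]
    simp only
    rw [← Complex.exp_add, ← Complex.exp_zero]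
    congr 1
    push_cast
    ring
  -- Chosen so that κ^(it) = e^(iθ).
  set t := θ / Real.log κ with ht
  obtain ⟨P, hP, -⟩ := hH.exists_multiplication (hud t) (hub t)
  obtain ⟨Q, hQ, -⟩ := hH.exists_multiplication (hud (-t)) (hub (-t))
  refine ⟨P, Q, ?_, ?_, ?_⟩
  · ext1 f
    refine hH.ext fun z hz => ?_
    change ev (P (Q f)) z = ev f z
    rw [hP _ z hz, id_eq, hQ _ z hz, id_eq, ← mul_assoc, huu, one_mul]
  · ext1 f
    refine hH.ext fun z hz => ?_
    change ev (Q (P f)) z = ev f z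
    rw [hQ _ z hz, id_eq, hP _ z hz, id_eq, ← mul_assoc, mul_comm (u (-t) z), huu, one_mul]
  · ext1 f
    refine hH.ext fun z hz => ?_
    change ev (T (P f)) z = ev (Complex.exp (θ * Complex.I) • P (T f)) z
    rw [map_smul, Pi.smul_apply, hT _ z hz, hP _ _ (hφ hz), hP _ z hz, id_eq, id_eq, hT _ z hz]
    have h1 : u t (φ z) = Complex.exp (θ * Complex.I) * u t z := by
      rw [hu]
      simp only
      rw [hφh z hz, Complex.log_ofReal_mul hκ0 (halfPlane_ne_zero ha hb hz), ← Complex.exp_add,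
        mul_add]
      congr 2
      have h2 : (θ : ℂ) = t * (Real.log κ : ℂ) := by
        rw [ht]
        push_cast
        rw [div_mul_cancel₀]
        exact_mod_cast hτ.ne'
      rw [h2]
      ring
    rw [h1, smul_eq_mul]
    ring

end Direction

/-! ### Rotation invariant operators with annular spectrum -/

section Annulus

variable {E : Type*} [NormedAddCommGroup E] [InnerProductSpace ℂ E]

/-- `T` is similar to each of its rotations `exp(iθ) T`. -/
def IsRotationInvariant (T : E →L[ℂ] E) : Prop :=
  ∀ θ : ℝ, ∃ P Q : E →L[ℂ] E, P * Q = 1 ∧ Q * P = 1 ∧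
    T * P = Complex.exp (θ * Complex.I) • (P * T)

theorem exists_eq_exp_mul_of_norm_eq {l l' : ℂ} (h : ‖l'‖ = ‖l‖) :
    ∃ θ : ℝ, l' = Complex.exp (θ * Complex.I) * l := by
  rcases eq_or_ne l 0 with rfl | hl
  · refine ⟨0, ?_⟩
    rw [norm_zero, norm_eq_zero] at h
    simp [h]
  · refine ⟨(l' / l).arg, ?_⟩
    have h1 := Complex.norm_mul_exp_arg_mul_I (l' / l)
    rw [norm_div, h, div_self (norm_ne_zero_iff.2 hl), Complex.ofReal_one, one_mul] at h1
    rw [h1, div_mul_cancel₀ _ hl]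

namespace IsRotationInvariant

theorem hasEigenvalue {T : E →L[ℂ] E} (hT : IsRotationInvariant T) {l l' : ℂ} (h : ‖l'‖ = ‖l‖)
    (hl : Module.End.HasEigenvalue (T : E →ₗ[ℂ] E) l) :
    Module.End.HasEigenvalue (T : E →ₗ[ℂ] E) l' := by
  obtain ⟨θ, rfl⟩ := exists_eq_exp_mul_of_norm_eq h
  obtain ⟨P, Q, -, hQP, hTP⟩ := hT θ
  obtain ⟨v, hv⟩ := hl.exists_hasEigenvector
  have hv1 : T v = l • v := hv.apply_eq_smul
  refine Module.End.hasEigenvalue_of_hasEigenvector (x := P v)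
    ⟨Module.End.mem_eigenspace_iff.2 ?_, fun h0 => hv.2 ?_⟩
  · change (T * P) v = _
    rw [hTP]
    change Complex.exp (θ * Complex.I) • P (T v) = _
    rw [hv1, map_smul, smul_smul]
  · calc v = (Q * P) v := by rw [hQP]; rfl
      _ = Q (P v) := rfl
      _ = 0 := by rw [h0, map_zero]

theorem mem_spectrum {T : E →L[ℂ] E} (hT : IsRotationInvariant T) {l l' : ℂ} (h : ‖l'‖ = ‖l‖)
    (hl : l ∈ spectrum ℂ T) : l' ∈ spectrum ℂ T := by
  obtain ⟨θ, rfl⟩ := exists_eq_exp_mul_of_norm_eq h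
  obtain ⟨P, Q, hPQ, hQP, hTP⟩ := hT θ
  let u : (E →L[ℂ] E)ˣ := ⟨P, Q, hPQ, hQP⟩
  have hT' : T = Complex.exp (θ * Complex.I) • ((u : E →L[ℂ] E) * T * (↑u⁻¹ : E →L[ℂ] E)) := by
    calc T = T * P * Q := by rw [mul_assoc, hPQ, mul_one]
      _ = Complex.exp (θ * Complex.I) • (P * T * Q) := by rw [hTP, smul_mul_assoc]
      _ = _ := rfl
  have hne : Complex.exp (θ * Complex.I) ≠ 0 := Complex.exp_ne_zero _
  have h2 := spectrum.unit_smul_eq_smul ((u : E →L[ℂ] E) * T * (↑u⁻¹ : E →L[ℂ] E))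
    (Units.mk0 _ hne)
  have h3 : spectrum ℂ T = Complex.exp (θ * Complex.I) • spectrum ℂ T := by
    conv_lhs => rw [hT']
    rw [spectrum.units_conjugate] at h2
    exact h2
  rw [h3]
  exact smul_mem_smul_set hl

/-- Adjoints turn TP = e^(iθ)PT into P*T* = e^(-iθ)T*P*. The reversal of order and the conjugation
compensate, so P* serves for the same θ. -/
theorem adjoint [CompleteSpace E] {T : E →L[ℂ] E} (hT : IsRotationInvariant T) :
    IsRotationInvariant (ContinuousLinearMap.adjoint T) := by
  intro θ
  obtain ⟨P, Q, hPQ, hQP, hTP⟩ := hT θ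
  simp only [← ContinuousLinearMap.star_eq_adjoint]
  refine ⟨star P, star Q, by rw [← star_mul, hQP, star_one], by rw [← star_mul, hPQ, star_one], ?_⟩
  have h1 := congrArg star hTP
  rw [star_smul, star_mul, star_mul] at h1
  rw [h1, smul_smul]
  have h2 : Complex.exp (θ * Complex.I) * star (Complex.exp (θ * Complex.I)) = 1 := by
    rw [Complex.star_def, Complex.mul_conj, Complex.normSq_eq_norm_sq, Complex.norm_exp_ofReal_mul_I]
    simp
  rw [h2, one_smul]

end IsRotationInvariant

/-- By spectral mapping |l|^n ≤ ‖T^n‖ ≤ |C|μ^n for all n, which is impossible for |l| > μ. -/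
theorem norm_le_of_mem_spectrum_of_norm_pow_le [CompleteSpace E] {T : E →L[ℂ] E} {C μ : ℝ}
    (hμ : 0 < μ) (h : ∀ (n : ℕ) (f : E), ‖(T ^ n) f‖ ≤ C * μ ^ n * ‖f‖) {l : ℂ}
    (hl : l ∈ spectrum ℂ T) : ‖l‖ ≤ μ := by
  by_contra! hlt
  obtain ⟨n, hn⟩ := pow_unbounded_of_one_lt |C| ((one_lt_div hμ).2 hlt)
  rcases subsingleton_or_nontrivial E with hE | hE
  · exact absurd hl (by simp [spectrum.of_subsingleton])
  have h1 : ‖T ^ n‖ ≤ |C| * μ ^ n := by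
    refine ContinuousLinearMap.opNorm_le_bound _ (by positivity) fun f => (h n f).trans ?_
    gcongr
    exact le_abs_self C
  have h2 := spectrum.norm_le_norm_of_mem (spectrum.pow_mem_pow T n hl)
  rw [norm_pow] at h2
  rw [div_pow, lt_div_iff₀ (by positivity)] at hn
  linarith

theorem le_norm_of_mem_spectrum_of_norm_pow_le [CompleteSpace E] {T S : E →L[ℂ] E}
    (hTS : T * S = 1) (hST : S * T = 1) {C μ : ℝ}
    (hμ : 0 < μ) (h : ∀ (n : ℕ) (f : E), ‖(S ^ n) f‖ ≤ C * μ ^ n * ‖f‖) {l : ℂ}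
    (hl : l ∈ spectrum ℂ T) : μ⁻¹ ≤ ‖l‖ := by
  let u : (E →L[ℂ] E)ˣ := ⟨T, S, hTS, hST⟩
  have hl0 : l ≠ 0 := spectrum.ne_zero_of_mem_of_unit (a := u) hl
  have h1 : l⁻¹ ∈ spectrum ℂ S := spectrum.inv_mem_iff (r := Units.mk0 l hl0) (a := u) |>.1 hl
  have h2 := norm_le_of_mem_spectrum_of_norm_pow_le hμ h h1
  rw [norm_inv] at h2
  exact (inv_le_comm₀ hμ (norm_pos_iff.2 hl0)).2 h2

/-- An interior point can be moved radially both inwards and outwards without leaving the annulus.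
-/
theorem interior_closedAnnulus_subset {s t : ℝ} (hs : 0 < s) (ht : 0 < t) :
    interior (closedAnnulus s t) ⊆ {l | min s t < ‖l‖ ∧ ‖l‖ < max s t} := by
  intro l hl
  have hmem := interior_subset hl
  have hl0 : 0 < ‖l‖ := (lt_min hs ht).trans_le hmem.1
  have hcont : Continuous fun x : ℝ => (x : ℂ) * l := by fun_prop
  have h1 : ∀ᶠ x : ℝ in 𝓝 1, (x : ℂ) * l ∈ closedAnnulus s t := by
    refine hcont.continuousAt.eventually ?_
    simpa using mem_interior_iff_mem_nhds.1 hl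
  obtain ⟨δ, hδ, h2⟩ := Metric.eventually_nhds_iff.1 h1
  have h3 : ∀ x : ℝ, |x - 1| < δ → 0 ≤ x → min s t ≤ x * ‖l‖ ∧ x * ‖l‖ ≤ max s t := by
    intro x hx hx0
    have := h2 (y := x) (by rwa [Real.dist_eq])
    rwa [closedAnnulus, mem_ofPred_eq, norm_mul, Complex.norm_real, Real.norm_of_nonneg hx0] at this
  have hε : 0 < min (δ / 2) (1 / 2) := by positivity
  have hε1 := min_le_left (δ / 2) (1 / 2)
  have hε2 := min_le_right (δ / 2) (1 / 2)
  set ε := min (δ / 2) (1 / 2)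
  have h4 := (h3 (1 - ε) (by rw [sub_sub_cancel_left, abs_neg, abs_of_pos hε]; linarith)
    (by linarith)).1
  have h5 := (h3 (1 + ε) (by rw [add_sub_cancel_left, abs_of_pos hε]; linarith) (by linarith)).2
  exact ⟨by nlinarith, by nlinarith⟩

theorem mem_spectrum_of_hasEigenvalue {T : E →L[ℂ] E} {l : ℂ}
    (h : Module.End.HasEigenvalue (T : E →ₗ[ℂ] E) l) : l ∈ spectrum ℂ T := by
  intro hu
  obtain ⟨v, hv⟩ := h.exists_hasEigenvector
  have hv1 : T v = l • v := hv.apply_eq_smul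
  refine hv.2 ?_
  obtain ⟨u, hu⟩ := hu
  have h0 : (u : E →L[ℂ] E) v = 0 := by
    rw [hu, sub_apply, hv1, Algebra.algebraMap_eq_smul_one]
    simp
  calc v = ((↑u⁻¹ : E →L[ℂ] E) * u) v := by rw [Units.inv_mul]; rfl
    _ = (↑u⁻¹ : E →L[ℂ] E) ((u : E →L[ℂ] E) v) := rfl
    _ = 0 := by rw [h0, map_zero]

theorem mem_spectrum_of_hasEigenvalue_adjoint [CompleteSpace E] {T : E →L[ℂ] E} {l : ℂ}
    (h : Module.End.HasEigenvalue (ContinuousLinearMap.adjoint T : E →ₗ[ℂ] E) l) :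
    star l ∈ spectrum ℂ T := by
  have h1 : l ∈ spectrum ℂ (star T) := mem_spectrum_of_hasEigenvalue h
  rwa [spectrum.map_star] at h1

/-- A rotation invariant invertible operator has a closed annulus as its spectrum if the growth of
its powers is governed by the radii and there are eigenvalues of every modulus in between. -/
theorem spectrum_eq_closedAnnulus [CompleteSpace E] [Nontrivial E] {T S : E →L[ℂ] E}
    (hTS : T * S = 1) (hST : S * T = 1) (hrot : IsRotationInvariant T) {s t : ℝ} (hs : 0 < s)
    (ht : 0 < t)
    (hT : ∀ μ, s < μ → t < μ → ∃ C : ℝ, ∀ (n : ℕ) (f : E), ‖(T ^ n) f‖ ≤ C * μ ^ n * ‖f‖)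
    (hS : ∀ μ, s⁻¹ < μ → t⁻¹ < μ → ∃ C : ℝ, ∀ (n : ℕ) (f : E), ‖(S ^ n) f‖ ≤ C * μ ^ n * ‖f‖)
    (heig : ∀ r, min s t < r → r < max s t → ∃ l : ℂ, ‖l‖ = r ∧
      (Module.End.HasEigenvalue (T : E →ₗ[ℂ] E) l ∨
        Module.End.HasEigenvalue (ContinuousLinearMap.adjoint T : E →ₗ[ℂ] E) l)) :
    spectrum ℂ T = closedAnnulus s t ∧ ∀ l ∈ interior (closedAnnulus s t),
      Module.End.HasEigenvalue (T : E →ₗ[ℂ] E) l ∨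
        Module.End.HasEigenvalue (ContinuousLinearMap.adjoint T : E →ₗ[ℂ] E) l := by
  have hm0 : 0 < min s t := lt_min hs ht
  have hsub : spectrum ℂ T ⊆ closedAnnulus s t := by
    intro l hl
    constructor
    · refine le_of_forall_lt fun c hc => ?_
      -- Values c ≤ 0 are separated because the argument below inverts a number above c; for them
      -- any admissible rate shows |l| > 0.
      rcases le_or_gt c 0 with hc0 | hc0
      · have hS' := hS (s⁻¹ + t⁻¹) (by linarith [inv_pos.2 ht]) (by linarith [inv_pos.2 hs])
        obtain ⟨C, hC⟩ := hS'
        have hpos : 0 < s⁻¹ + t⁻¹ := by positivity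
        exact hc0.trans_lt ((inv_pos.2 hpos).trans_le
          (le_norm_of_mem_spectrum_of_norm_pow_le hTS hST hpos hC hl))
      · obtain ⟨d, hcd, hd⟩ := exists_between hc
        have hd0 : 0 < d := hc0.trans hcd
        obtain ⟨C, hC⟩ := hS d⁻¹ ((inv_lt_inv₀ hs hd0).2 (hd.trans_le (min_le_left _ _)))
          ((inv_lt_inv₀ ht hd0).2 (hd.trans_le (min_le_right _ _)))
        have h1 := le_norm_of_mem_spectrum_of_norm_pow_le hTS hST (inv_pos.2 hd0) hC hl
        rw [inv_inv] at h1
        exact hcd.trans_le h1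
    · refine le_of_forall_gt_imp_ge_of_dense fun c hc => ?_
      obtain ⟨C, hC⟩ := hT c ((le_max_left _ _).trans_lt hc) ((le_max_right _ _).trans_lt hc)
      exact norm_le_of_mem_spectrum_of_norm_pow_le
        (hs.trans_le ((le_max_left _ _).trans hc.le)) hC hl
  have hIoo : ∀ r ∈ Ioo (min s t) (max s t), (r : ℂ) ∈ spectrum ℂ T := by
    rintro r ⟨h1, h2⟩
    obtain ⟨l, hl, h | h⟩ := heig r h1 h2
    · refine hrot.mem_spectrum ?_ (mem_spectrum_of_hasEigenvalue h)
      rw [hl, Complex.norm_real, Real.norm_of_nonneg (hm0.trans h1).le]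
    · refine hrot.mem_spectrum ?_ (mem_spectrum_of_hasEigenvalue_adjoint h)
      rw [norm_star, hl, Complex.norm_real, Real.norm_of_nonneg (hm0.trans h1).le]
  refine ⟨hsub.antisymm fun l hl => ?_, fun l hl => ?_⟩
  · rcases (min_le_max : min s t ≤ max s t).eq_or_lt with h | h
    · obtain ⟨l', hl'⟩ := spectrum.nonempty T
      refine hrot.mem_spectrum (le_antisymm ?_ ?_) hl'
      · exact hl.2.trans (h ▸ (hsub hl').1)
      · exact (hsub hl').2.trans (h ▸ hl.1)
    · have hclosed : IsClosed {r : ℝ | (r : ℂ) ∈ spectrum ℂ T} :=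
        (spectrum.isClosed T).preimage Complex.continuous_ofReal
      have h1 : Icc (min s t) (max s t) ⊆ {r : ℝ | (r : ℂ) ∈ spectrum ℂ T} := by
        rw [← closure_Ioo h.ne]
        exact hclosed.closure_subset_iff.2 hIoo
      refine hrot.mem_spectrum ?_ (h1 hl)
      simp
  · obtain ⟨h1, h2⟩ := interior_closedAnnulus_subset hs ht hl
    obtain ⟨l', hl', h | h⟩ := heig ‖l‖ h1 h2
    · exact Or.inl (hrot.hasEigenvalue hl'.symm h)
    · exact Or.inr (hrot.adjoint.hasEigenvalue hl'.symm h)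

end Annulus

/-! ### Fixed points of the symbol and of its inverse -/

section Symbol

variable {N : ℕ} {φ χ : CN N → CN N} {c a b e : CN N} {V : CN N ≃ₗᵢ[ℂ] CN N}

theorem nhdsWithin_ball_neBot (ha : ‖a‖ = 1) : (𝓝[ball (0 : CN N) 1] a).NeBot := by
  rw [← mem_closure_iff_nhdsWithin_neBot, closure_ball _ one_ne_zero, mem_closedBall_zero_iff]
  exact ha.le

theorem continuousAt_moebius_isometry (V : CN N ≃ₗᵢ[ℂ] CN N) (hc : ‖c‖ < 1) (he : ‖e‖ ≤ 1) :
    ContinuousAt (fun z => moebius c (V z)) e :=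
  (differentiableAt_moebius_isometry V
    (one_sub_inner_ne_zero (norm_symm_mul_norm_lt V hc he))).continuousAt

theorem moebius_eq_of_isBoundaryFixedPt (hc : ‖c‖ < 1)
    (hφV : EqOn φ (fun z => moebius c (V z)) (ball 0 1)) (ha : IsBoundaryFixedPt φ a) :
    moebius c (V a) = a := by
  have ha1 : ‖a‖ = 1 := mem_sphere_zero_iff_norm.1 ha.1
  have := nhdsWithin_ball_neBot ha1
  have h1 : Tendsto φ (𝓝[ball 0 1] a) (𝓝 (moebius c (V a))) :=
    ((continuousAt_moebius_isometry V hc ha1.le).tendsto.mono_left nhdsWithin_le_nhds).congr'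
      (eventually_nhdsWithin_of_forall fun z hz => (hφV hz).symm)
  exact tendsto_nhds_unique h1 ha.2

theorem IsBoundaryFixedPt.tendsto_nhdsWithin (hφ : MapsTo φ (ball 0 1) (ball 0 1))
    (ha : IsBoundaryFixedPt φ a) : Tendsto φ (𝓝[ball 0 1] a) (𝓝[ball 0 1] a) :=
  tendsto_nhdsWithin_iff.2 ⟨ha.2, eventually_nhdsWithin_of_forall fun _ hz => hφ hz⟩

/-- A boundary fixed point of an automorphism is fixed by the inverse. -/
theorem IsBoundaryFixedPt.of_leftInvOn (hφ : MapsTo φ (ball 0 1) (ball 0 1))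
    (hχφ : LeftInvOn χ φ (ball 0 1)) (hc : ‖c‖ < 1)
    (hχV : EqOn χ (fun z => moebius c (V z)) (ball 0 1)) (ha : IsBoundaryFixedPt φ a) :
    IsBoundaryFixedPt χ a := by
  have ha1 : ‖a‖ = 1 := mem_sphere_zero_iff_norm.1 ha.1
  have := nhdsWithin_ball_neBot ha1
  have h1 : Tendsto χ (𝓝[ball 0 1] a) (𝓝 (moebius c (V a))) :=
    ((continuousAt_moebius_isometry V hc ha1.le).tendsto.mono_left nhdsWithin_le_nhds).congr'
      (eventually_nhdsWithin_of_forall fun z hz => (hχV hz).symm)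
  have h2 := h1.comp (ha.tendsto_nhdsWithin hφ)
  have h3 : Tendsto (χ ∘ φ) (𝓝[ball 0 1] a) (𝓝 a) :=
    (tendsto_id.mono_left nhdsWithin_le_nhds).congr'
      (eventually_nhdsWithin_of_forall fun z hz => (hχφ hz).symm)
  rw [tendsto_nhds_unique h2 h3] at h1
  exact ⟨ha.1, h1⟩

theorem halfPlane_apply_eq (hc : ‖c‖ < 1)
    (hφV : EqOn φ (fun z => moebius c (V z)) (ball 0 1)) (ha : IsBoundaryFixedPt φ a)
    (hb : IsBoundaryFixedPt φ b) (hab : a ≠ b) :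
    ∀ z ∈ ball (0 : CN N) 1, halfPlane a b (φ z) = (dilation c V b : ℂ) * halfPlane a b z := by
  intro z hz
  rw [hφV hz]
  exact halfPlane_moebius V hc (mem_sphere_zero_iff_norm.1 ha.1) (mem_sphere_zero_iff_norm.1 hb.1)
    hab (moebius_eq_of_isBoundaryFixedPt hc hφV ha) (moebius_eq_of_isBoundaryFixedPt hc hφV hb)
    (mem_ball_zero_iff.1 hz)

theorem halfPlane_zero (a b : CN N) : halfPlane a b 0 = 1 := by
  simp [halfPlane]

theorem halfPlane_iterate_zero (hφ : MapsTo φ (ball 0 1) (ball 0 1)) {κ : ℂ}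
    (h : ∀ z ∈ ball (0 : CN N) 1, halfPlane a b (φ z) = κ * halfPlane a b z) (n : ℕ) :
    halfPlane a b (φ^[n] 0) = κ ^ n := by
  induction n with
  | zero => simp [halfPlane_zero]
  | succ n ih =>
    rw [Function.iterate_succ_apply', h _ (hφ.iterate n (mem_ball_self one_pos)), ih, pow_succ']

/-- The dilation coefficient at the repelling fixed point is larger than one. -/
theorem one_lt_dilation (hφ : MapsTo φ (ball 0 1) (ball 0 1)) (hc : ‖c‖ < 1)
    (hφV : EqOn φ (fun z => moebius c (V z)) (ball 0 1)) (ha : IsBoundaryFixedPt φ a)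
    (hb : IsBoundaryFixedPt φ b) (hab : a ≠ b) (hDW : IsDenjoyWolffPt φ a) :
    1 < dilation c V b := by
  have ha1 : ‖a‖ = 1 := mem_sphere_zero_iff_norm.1 ha.1
  have hb1 : ‖b‖ = 1 := mem_sphere_zero_iff_norm.1 hb.1
  have hκ0 := dilation_pos V hc hb1
  by_contra! hκ
  have h0 : (0 : CN N) ∈ ball (0 : CN N) 1 := mem_ball_self one_pos
  have hlim : Tendsto (fun n : ℕ => φ^[n] 0) atTop (𝓝 a) :=
    (hDW {0} isCompact_singleton (singleton_subset_iff.2 h0)).tendsto_at (mem_singleton _)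
  have hcont : ∀ e : CN N, Continuous fun z : CN N => ‖(1 - inner ℂ e z : ℂ)‖ := fun e => by
    fun_prop
  have hA := ((hcont a).tendsto a).comp hlim
  have hB := ((hcont b).tendsto a).comp hlim
  -- The quotient of the two sides is κ^n ≤ 1. The right side tends to 0 as the orbit tends to a,
  -- which would force ⟨b,a⟩ = 1 and hence a = b.
  have hle : ∀ n : ℕ, ‖(1 - inner ℂ b (φ^[n] 0) : ℂ)‖ ≤ ‖(1 - inner ℂ a (φ^[n] 0) : ℂ)‖ := by
    intro n
    have h1 := halfPlane_iterate_zero hφ (halfPlane_apply_eq hc hφV ha hb hab) n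
    have hpos := norm_pos_iff.2 (one_sub_inner_ne_zero_of_mem_ball ha1 (hφ.iterate n h0))
    have h2 := congrArg norm h1
    rw [halfPlane, norm_div, norm_pow, Complex.norm_real, Real.norm_of_nonneg hκ0.le] at h2
    rw [← div_le_one hpos, h2]
    exact pow_le_one₀ hκ0.le hκ
  have h3 := le_of_tendsto_of_tendsto' hB hA hle
  rw [inner_self_eq_one ha1, sub_self, norm_zero] at h3
  exact one_sub_inner_ne_zero_of_ne hb1 ha1 hab.symm (norm_le_zero_iff.1 h3)

end Symbol

/-! ### The spectrum in the abstract setting -/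

section Spectrum

variable {N : ℕ} {p : ℝ} {H : Type*} [NormedAddCommGroup H] [InnerProductSpace ℂ H]
  {ev : H →ₗ[ℂ] (CN N → ℂ)}

namespace IsBallSpace

theorem nontrivial (hH : IsBallSpace N p ev) : Nontrivial H := by
  obtain ⟨f, hf⟩ := hH.exists_one
  refine ⟨⟨f, 0, fun h => ?_⟩⟩
  have h1 := hf 0 (mem_ball_self one_pos)
  rw [h] at h1
  simp at h1

/-- The reproducing kernel at the origin. -/
theorem exists_kernel_zero [CompleteSpace H] (hH : IsBallSpace N p ev) :
    ∃ g : H, g ≠ 0 ∧ ∀ f : H, inner ℂ g f = ev f 0 := by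
  let L : H →L[ℂ] ℂ := ((LinearMap.proj (0 : CN N)).comp ev).mkContinuous 1 fun f => by
    rw [one_mul]
    exact hH.norm_apply_zero_le f
  have hL : ∀ f, inner ℂ ((InnerProductSpace.toDual ℂ H).symm L) f = ev f 0 := fun f =>
    InnerProductSpace.toDual_symm_apply
  refine ⟨_, fun h => ?_, hL⟩
  obtain ⟨f, hf⟩ := hH.exists_one
  have h1 := hL f
  rw [h, inner_zero_left, hf 0 (mem_ball_self one_pos)] at h1
  exact zero_ne_one h1

/-- With x = (T*)^n g, the kernel property gives ‖x‖² = (T^n x)(0) ≤ R‖x‖. Thus growth of values at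
0 controls the orbit of the kernel under the adjoint. -/
theorem norm_adjoint_pow_le [CompleteSpace H] {T : H →L[ℂ] H} {g : H}
    (hg : ∀ f : H, inner ℂ g f = ev f 0) {n : ℕ} {R : ℝ} (hR : 0 ≤ R)
    (h : ∀ f : H, ‖ev ((T ^ n) f) 0‖ ≤ R * ‖f‖) :
    ‖(ContinuousLinearMap.adjoint T ^ n) g‖ ≤ R := by
  have h1 : ContinuousLinearMap.adjoint T ^ n = ContinuousLinearMap.adjoint (T ^ n) := by
    rw [← ContinuousLinearMap.star_eq_adjoint, ← ContinuousLinearMap.star_eq_adjoint, star_pow]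
  rw [h1]
  set x := ContinuousLinearMap.adjoint (T ^ n) g
  have h2 : inner ℂ x x = ev ((T ^ n) x) 0 := by
    rw [← hg]
    exact ContinuousLinearMap.adjoint_inner_left _ _ _
  have h3 := congrArg norm h2
  rw [inner_self_eq_norm_sq_to_K, norm_pow, RCLike.norm_ofReal, abs_norm] at h3
  have h4 := h x
  rw [← h3, sq] at h4
  rcases (norm_nonneg x).eq_or_lt with h0 | h0
  · rw [← h0]
    exact hR
  · exact le_of_mul_le_mul_right h4 h0

/-- The function (1 - ⟨z,a⟩)^m (1 - ⟨z,b⟩)^n vanishes to the required orders at both fixed points,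
so it suits the forward and the backward orbit at once; the spare factor is at most 2 in modulus. -/
theorem exists_pow_mul_pow (hH : IsBallSpace N p ev) {a b : CN N} (ha : ‖a‖ = 1) (hb : ‖b‖ = 1)
    (m n : ℕ) : ∃ g : H, g ≠ 0 ∧
      (∀ z ∈ ball (0 : CN N) 1, ‖ev g z‖ ≤ 2 ^ n * ‖(1 - inner ℂ a z : ℂ)‖ ^ m) ∧
      ∀ z ∈ ball (0 : CN N) 1, ‖ev g z‖ ≤ 2 ^ m * ‖(1 - inner ℂ b z : ℂ)‖ ^ n := by
  have hle : ∀ e : CN N, ‖e‖ = 1 → ∀ z ∈ ball (0 : CN N) 1, ‖(1 - inner ℂ e z : ℂ)‖ ≤ 2 :=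
    fun e he z hz => norm_one_sub_inner_le_two he.le (mem_ball_zero_iff.1 hz).le
  obtain ⟨f, hf⟩ := hH.exists_one
  obtain ⟨g, hg, -⟩ := hH.exists_mul
    (fun z => (1 - inner ℂ a z : ℂ) ^ m * (1 - inner ℂ b z : ℂ) ^ n) (2 ^ m * 2 ^ n)
    (((differentiableOn_one_sub_inner a _).pow m).mul ((differentiableOn_one_sub_inner b _).pow n))
    (fun z hz => by
      rw [norm_mul, norm_pow, norm_pow]
      gcongr
      · exact hle a ha z hz
      · exact hle b hb z hz) f
  have hg' : ∀ z ∈ ball (0 : CN N) 1, ‖ev g z‖ =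
      ‖(1 - inner ℂ a z : ℂ)‖ ^ m * ‖(1 - inner ℂ b z : ℂ)‖ ^ n := fun z hz => by
    rw [hg z hz, hf z hz, mul_one, norm_mul, norm_pow, norm_pow]
  refine ⟨g, fun h => ?_, fun z hz => ?_, fun z hz => ?_⟩
  · have h1 := hg' 0 (mem_ball_self one_pos)
    rw [h] at h1
    simp at h1
  · rw [hg' z hz, mul_comm]
    gcongr
    exact hle b hb z hz
  · rw [hg' z hz]
    gcongr
    exact hle a ha z hz

/-- The spectrum of a weighted composition operator whose symbol is an automorphism with two
boundary fixed points. -/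
theorem exists_isWeightedComp_spectrum_eq [CompleteSpace H] (hH : IsBallSpace N p ev) (hp : 0 ≤ p)
    {φ : CN N → CN N} (hφ : IsBallAut φ) {a b c : CN N} {V : CN N ≃ₗᵢ[ℂ] CN N} (hc : ‖c‖ < 1)
    (hφV : EqOn φ (fun z => moebius c (V z)) (ball 0 1)) (ha : IsBoundaryFixedPt φ a)
    (hb : IsBoundaryFixedPt φ b) (hab : a ≠ b) {κ : ℝ} (hκ : κ = dilation c V b) (hκ1 : 1 < κ)
    {ψ : CN N → ℂ} (hψ : MemBallAlgebra ψ) (hψ0 : BoundedAwayFromZero ψ) :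
    ∃ T : H →L[ℂ] H, IsWeightedComp ev ψ φ T ∧
      spectrum ℂ T = closedAnnulus (‖ψ a‖ * κ ^ (p / 2)) (‖ψ b‖ * κ ^ (-(p / 2))) ∧
      ∀ l ∈ interior (closedAnnulus (‖ψ a‖ * κ ^ (p / 2)) (‖ψ b‖ * κ ^ (-(p / 2)))),
        Module.End.HasEigenvalue (T : H →ₗ[ℂ] H) l ∨
          Module.End.HasEigenvalue (ContinuousLinearMap.adjoint T : H →ₗ[ℂ] H) l := by
  obtain ⟨hφd, hφm, χ, hχd, hχm, hχφ, hφχ⟩ := hφ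
  have hχ : IsBallAut χ := ⟨hχd, hχm, φ, hφd, hφm, hφχ, hχφ⟩
  obtain ⟨c', V', hc', hχV⟩ := exists_moebius_of_isBallAut hχ
  have ha' := ha.of_leftInvOn hφm hχφ hc' hχV
  have hb' := hb.of_leftInvOn hφm hχφ hc' hχV
  have ha1 : ‖a‖ = 1 := mem_sphere_zero_iff_norm.1 ha.1
  have hb1 : ‖b‖ = 1 := mem_sphere_zero_iff_norm.1 hb.1
  have hκ0 : 0 < κ := by linarith
  have hfa := moebius_eq_of_isBoundaryFixedPt hc hφV ha
  have hfb := moebius_eq_of_isBoundaryFixedPt hc hφV hb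
  have hfa' := moebius_eq_of_isBoundaryFixedPt hc' hχV ha'
  have hfb' := moebius_eq_of_isBoundaryFixedPt hc' hχV hb'
  have h0 : (0 : CN N) ∈ ball (0 : CN N) 1 := mem_ball_self one_pos
  have hφh : ∀ z ∈ ball (0 : CN N) 1, halfPlane a b (φ z) = (κ : ℂ) * halfPlane a b z := by
    rw [hκ]
    exact halfPlane_apply_eq hc hφV ha hb hab
  -- The inverse multiplies the half-plane coordinate by κ⁻¹, so its factor at b is κ⁻¹ and at a it
  -- is κ: the same bounds apply with a and b exchanged.
  have hκ' : κ = dilation c' V' a := by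
    have h1 := halfPlane_apply_eq hc' hχV ha' hb' hab _ (hφm h0)
    rw [hχφ h0, hφh 0 h0, halfPlane_zero, mul_one] at h1
    have h2 : dilation c' V' b * κ = 1 := by exact_mod_cast h1.symm
    rw [dilation_eq_inv V' hc' ha1 hb1 hab hfa' hfb']
    exact eq_inv_of_mul_eq_one_right h2
  obtain ⟨ε, hε, hψε⟩ := hψ0
  obtain ⟨M, hM⟩ := (isCompact_closedBall (0 : CN N) 1).exists_bound_of_continuousOn hψ.1
  have hψM : ∀ z ∈ ball (0 : CN N) 1, ‖ψ z‖ ≤ M := fun z hz => hM z (ball_subset_closedBall hz)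
  have hψne : ∀ z ∈ ball (0 : CN N) 1, ψ z ≠ 0 := fun z hz =>
    norm_pos_iff.1 (hε.trans_le (hψε z hz))
  have hlim : ∀ e : CN N, ‖e‖ = 1 → Tendsto (fun z => ‖ψ z‖) (𝓝[ball 0 1] e) (𝓝 ‖ψ e‖) :=
    fun e he => ((hψ.1 e (mem_closedBall_zero_iff.2 he.le)).mono ball_subset_closedBall).norm
  have hpos : ∀ e : CN N, ‖e‖ = 1 → 0 < ‖ψ e‖ := fun e he => by
    have := nhdsWithin_ball_neBot he
    exact hε.trans_le (ge_of_tendsto (hlim e he) (eventually_nhdsWithin_of_forall hψε))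
  have hψa := hpos a ha1
  have hψb := hpos b hb1
  obtain ⟨T, hT, hTn, hTf, hTe⟩ := exists_isWeightedComp_bounds hH hp hc ha1 hb1 hab hfa hfb hφV hφm
    hχm hχφ hφχ hφd hχd hκ hκ1 hψ.2 hψM (norm_nonneg _) (norm_nonneg _) (hlim a ha1) (hlim b hb1)
  have hlim' : ∀ e : CN N, IsBoundaryFixedPt χ e →
      Tendsto (fun z => ‖(ψ (χ z))⁻¹‖) (𝓝[ball 0 1] e) (𝓝 ‖ψ e‖⁻¹) := fun e he => by
    have he1 : ‖e‖ = 1 := mem_sphere_zero_iff_norm.1 he.1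
    simp only [norm_inv]
    exact ((hlim e he1).comp (he.tendsto_nhdsWithin hχm)).inv₀ (hpos e he1).ne'
  -- The inverse of T is the weighted composition with symbol χ = φ⁻¹ and weight 1/(ψ ∘ χ); χ
  -- attracts to b and repels from a.
  obtain ⟨S, hS, hSn, hSf, hSe⟩ := exists_isWeightedComp_bounds hH hp hc' hb1 ha1 hab.symm hfb' hfa'
    hχV hχm hφm hφχ hχφ hχd hφd hκ' hκ1 (ψ := fun z => (ψ (χ z))⁻¹)
    ((hψ.2.comp hχd hχm).fun_inv fun z hz => hψne _ (hχm hz)) (M := ε⁻¹)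
    (fun z hz => by
      rw [norm_inv]
      exact inv_anti₀ hε (hψε _ (hχm hz)))
    (inv_nonneg.2 (norm_nonneg _)) (inv_nonneg.2 (norm_nonneg _)) (hlim' b hb') (hlim' a ha')
  have hTS : T * S = 1 := by
    ext1 f
    refine hH.ext fun z hz => ?_
    change ev (T (S f)) z = ev f z
    rw [hT _ z hz, hS _ _ (hφm hz)]
    beta_reduce
    rw [hχφ hz, mul_inv_cancel_left₀ (hψne z hz)]
  have hST : S * T = 1 := by
    ext1 f
    refine hH.ext fun z hz => ?_
    change ev (S (T f)) z = ev f z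
    rw [hS _ z hz, hT _ _ (hχm hz), hφχ hz, inv_mul_cancel_left₀ (hψne _ (hχm hz))]
  have hRa : ‖ψ a‖⁻¹ * κ ^ (-(p / 2)) = (‖ψ a‖ * κ ^ (p / 2))⁻¹ := by
    rw [Real.rpow_neg hκ0.le, mul_inv]
  have hRb : ‖ψ b‖⁻¹ * κ ^ (p / 2) = (‖ψ b‖ * κ ^ (-(p / 2)))⁻¹ := by
    rw [Real.rpow_neg hκ0.le, mul_inv, inv_inv]
  rw [hRa, hRb] at hSn
  rw [hRa] at hSf
  rw [hRb] at hSe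
  have hs : 0 < ‖ψ a‖ * κ ^ (p / 2) := by positivity
  have ht : 0 < ‖ψ b‖ * κ ^ (-(p / 2)) := by positivity
  set s := ‖ψ a‖ * κ ^ (p / 2)
  set t := ‖ψ b‖ * κ ^ (-(p / 2))
  have := hH.nontrivial
  refine ⟨T, hT, spectrum_eq_closedAnnulus hTS hST
    (fun θ => exists_rotation hH ha1 hb1 hκ1 hT hφm hφh θ) hs ht hTn
    (fun μ h1 h2 => hSn μ h2 h1) fun r h1 h2 => ?_⟩
  have hr : 0 < r := (lt_min hs ht).trans h1
  -- For t < r < s the eigenvector belongs to T and comes from a function vanishing at both fixed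
  -- points: its forward rate is just above t and its backward rate just above 1/s.
  rcases le_total t s with hts | hst
  · rw [min_eq_right hts] at h1
    rw [max_eq_left hts] at h2
    obtain ⟨μ, hμ1, hμ2⟩ := exists_between h1
    obtain ⟨ν, hν1, hν2⟩ := exists_between ((inv_lt_inv₀ hs hr).2 h2)
    obtain ⟨m, hm⟩ := hTf μ hμ1
    obtain ⟨n, hn⟩ := hSf ν hν1
    obtain ⟨g, hg0, hga, hgb⟩ := hH.exists_pow_mul_pow ha1 hb1 m n
    obtain ⟨C, hC⟩ := hm g _ hga
    obtain ⟨D, hD⟩ := hn g _ hgb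
    obtain ⟨l, hl, h⟩ := exists_hasEigenvalue_of_orbit_bounds hTS hST hg0 (ht.trans hμ1).le hμ2
      ((inv_pos.2 hs).trans hν1).le hν2 hC hD
    exact ⟨l, hl, Or.inl h⟩
  -- For s < r < t evaluations at 0 grow along T at a rate just above s and along S just above 1/t,
  -- so the kernel at 0 generates an eigenvector of the adjoint.
  · rw [min_eq_left hst] at h1
    rw [max_eq_right hst] at h2
    obtain ⟨μ, hμ1, hμ2⟩ := exists_between h1
    obtain ⟨ν, hν1, hν2⟩ := exists_between ((inv_lt_inv₀ ht hr).2 h2)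
    have hμ0 : 0 < μ := hs.trans hμ1
    have hν0 : 0 < ν := (inv_pos.2 ht).trans hν1
    obtain ⟨C, hC0, hC⟩ := hTe μ hμ1
    obtain ⟨D, hD0, hD⟩ := hSe ν hν1
    obtain ⟨g, hg0, hg⟩ := hH.exists_kernel_zero
    have hTS' : ContinuousLinearMap.adjoint T * ContinuousLinearMap.adjoint S = 1 := by
      rw [← ContinuousLinearMap.star_eq_adjoint, ← ContinuousLinearMap.star_eq_adjoint, ← star_mul,
        hST, star_one]
    have hST' : ContinuousLinearMap.adjoint S * ContinuousLinearMap.adjoint T = 1 := by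
      rw [← ContinuousLinearMap.star_eq_adjoint, ← ContinuousLinearMap.star_eq_adjoint, ← star_mul,
        hTS, star_one]
    obtain ⟨l, hl, h⟩ := exists_hasEigenvalue_of_orbit_bounds hTS' hST' hg0 hμ0.le hμ2 hν0.le hν2
      (fun n => norm_adjoint_pow_le hg (by positivity) (hC n))
      (fun n => norm_adjoint_pow_le hg (by positivity) (hD n))
    exact ⟨l, hl, Or.inr h⟩

end IsBallSpace

/-- The poles lie where ⟨V⁻¹c,z⟩ = 1, a closed set disjoint from the closed ball because |c| < 1. -/
theorem isHolomorphicExtension_moebius {φ : CN N → CN N} {c : CN N} {V : CN N ≃ₗᵢ[ℂ] CN N}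
    (hc : ‖c‖ < 1) (hφV : EqOn φ (fun z => moebius c (V z)) (ball 0 1)) :
    IsHolomorphicExtension φ fun z => moebius c (V z) := by
  refine ⟨⟨{z | (1 - inner ℂ (V.symm c) z : ℂ) ≠ 0}, isOpen_ne_fun (by fun_prop) (by fun_prop),
    fun z hz => one_sub_inner_ne_zero (norm_symm_mul_norm_lt V hc (mem_closedBall_zero_iff.1 hz)),
    fun z hz => (differentiableAt_moebius_isometry V hz).differentiableWithinAt⟩, hφV.symm⟩

end Spectrum

end WCO

/-! ### The theorem for the Hardy and Bergman spaces -/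

theorem theorem3p11 (N : ℕ) [NeZero N] (φ : CN N → CN N) (hφ : IsBallAut φ)
    (hfix : ∀ z ∈ ball (0 : CN N) 1, φ z ≠ z)
    (a b : CN N) (ha : IsBoundaryFixedPt φ a) (hb : IsBoundaryFixedPt φ b) (hab : a ≠ b)
    (hDW : IsDenjoyWolffPt φ a)
    (ψ : CN N → ℂ) (hψ : MemBallAlgebra ψ) (hψ0 : BoundedAwayFromZero ψ) :
    ∃ Φ : CN N → CN N, IsHolomorphicExtension φ Φ ∧ (fderiv ℂ Φ a).IsInvertible ∧
    ∃ ρ : ℝ, ρ = specRad (fderiv ℂ Φ a).inverse ∧ ρ = specRad (fderiv ℂ Φ b) ∧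
      (∃ (_ : CompleteSpace (HardySpace N)) (T : HardySpace N →L[ℂ] HardySpace N),
        (∀ (f : HardySpace N), ∀ z ∈ ball (0 : CN N) 1, (T f) z = ψ z * f (φ z)) ∧
        spectrum ℂ T = closedAnnulus (‖ψ a‖ * ρ ^ ((N : ℝ) / 2)) (‖ψ b‖ * ρ ^ (-((N : ℝ) / 2))) ∧
        ∀ l ∈ interior
            (closedAnnulus (‖ψ a‖ * ρ ^ ((N : ℝ) / 2)) (‖ψ b‖ * ρ ^ (-((N : ℝ) / 2)))),
          Module.End.HasEigenvalue (T : HardySpace N →ₗ[ℂ] HardySpace N) l ∨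
          Module.End.HasEigenvalue
            (ContinuousLinearMap.adjoint T : HardySpace N →ₗ[ℂ] HardySpace N) l) ∧
      (∀ (γ : ℝ) (hγ : -1 < γ - 2) (K : ℝ), K = ((N : ℝ) - 1 + γ) / 2 →
        ∃ (_ : CompleteSpace (BergmanSpace N hγ)) (T : BergmanSpace N hγ →L[ℂ] BergmanSpace N hγ),
          (∀ (f : BergmanSpace N hγ), ∀ z ∈ ball (0 : CN N) 1, (T f) z = ψ z * f (φ z)) ∧
          spectrum ℂ T = closedAnnulus (‖ψ a‖ * ρ ^ K) (‖ψ b‖ * ρ ^ (-K)) ∧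
          ∀ l ∈ interior (closedAnnulus (‖ψ a‖ * ρ ^ K) (‖ψ b‖ * ρ ^ (-K))),
            Module.End.HasEigenvalue (T : BergmanSpace N hγ →ₗ[ℂ] BergmanSpace N hγ) l ∨
            Module.End.HasEigenvalue
              (ContinuousLinearMap.adjoint T : BergmanSpace N hγ →ₗ[ℂ] BergmanSpace N hγ) l) := by
  obtain ⟨c, V, hc, hφV⟩ := exists_moebius_of_isBallAut hφ
  have ha1 : ‖a‖ = 1 := mem_sphere_zero_iff_norm.1 ha.1
  have hb1 : ‖b‖ = 1 := mem_sphere_zero_iff_norm.1 hb.1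
  have hfa := moebius_eq_of_isBoundaryFixedPt hc hφV ha
  have hfb := moebius_eq_of_isBoundaryFixedPt hc hφV hb
  have hκ1 : 1 < dilation c V b := one_lt_dilation hφ.2.1 hc hφV ha hb hab hDW
  have hda := dilation_eq_inv V hc ha1 hb1 hab hfa hfb
  obtain ⟨hinv, hradius⟩ := isInvertible_and_specRad_inverse_of_dilation (dilation_pos V hc ha1)
    (hda ▸ inv_le_one_of_one_le₀ hκ1.le) ha1 (inner_fderiv_moebius V hc ha1 hfa)
    fun h hh => norm_sq_fderiv_moebius V hc ha1 hfa hh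
  -- ρ is the dilation factor at b; the factor at a is its reciprocal, so the inverse of the
  -- derivative there has spectral radius ρ.
  refine ⟨fun z => moebius c (V z), isHolomorphicExtension_moebius hc hφV, hinv,
    dilation c V b, by rw [hradius, hda, inv_inv], ?_, ?_, ?_⟩
  · exact (specRad_eq_of_dilation hκ1.le hb1 (inner_fderiv_moebius V hc hb1 hfb)
      fun h hh => norm_sq_fderiv_moebius V hc hb1 hfb hh).symm
  · have hH := HardySpace.isBallSpace (N := N)
    have hN : (0 : ℝ) ≤ N := N.cast_nonneg
    have := hH.completeSpace hN
    exact ⟨this, hH.exists_isWeightedComp_spectrum_eq hN hφ hc hφV ha hb hab rfl hκ1 hψ hψ0⟩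
  · intro γ hγ K hK
    have hH := BergmanSpace.isBallSpace (N := N) hγ
    have hN : (0 : ℝ) ≤ N := N.cast_nonneg
    have hp : (0 : ℝ) ≤ N + 1 + (γ - 2) := by linarith
    -- With α = γ - 2 the Bergman exponent is p = N + 1 + α = N - 1 + γ, so K = p/2.
    have hKp : K = (N + 1 + (γ - 2)) / 2 := by rw [hK]; ring
    have := hH.completeSpace hp
    rw [hKp]
    exact ⟨this, hH.exists_isWeightedComp_spectrum_eq hp hφ hc hφV ha hb hab rfl hκ1 hψ hψ0⟩
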